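/- **Setting.** Let $\mathcal F$ be one of the following three families of finite simple undirected graphs: all paths with at least two nodes, all cycles (with at least three nodes), or the union of the two. Let $\Pi$ be a locally checkable labeling problem (LCL) with finite input label set $I$ and finite output label set $O$: there are constants $r\ge 0$ and $\Delta\ge 2$ and a set $\mathcal S$ of centered graphs of radius at most $r$ and maximum degree at most $\Delta$, with inputs and outputs on their nodes, such that on every graph $G$ of maximum degree at most $\Delta$ with inputs $x$, an output labeling $y$ is permissible if and only if the labeled radius-$r$ neighborhood of every node is isomorphic to a member of $\mathcal S$. A *deterministic LOCAL* algorithm of locality $T$ for $\Pi$ on $\mathcal F$ knows $n$ and determines the output of each node $v$ of an $n$-node graph $G$ from the subgraph induced by the radius-$T(n)$ neighborhood of $v$, with its inputs and unique identifiers from $\{1,\dots,n^c\}$ ($c\ge 1$ a fixed integer constant); the output has to be permissible on every $G\in\mathcal F$, for all inputs and all identifiers. In *randomized online-LOCAL* with locality $T$, the algorithm knows $n$ and the set of nodes; the nodes are presented in an adversarial order $v_1,\dots,v_n$; when $v_i$ is presented, the algorithm sees the subgraph induced by $\bigcup_{j\le i} N_{T(n)}(v_j)$ with its inputs, the order $v_1,\dots,v_i$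 and all earlier outputs, and chooses the output of $v_i$ at random. The adversary is oblivious (graph, inputs and order are fixed independently of the randomness). On every $n$-node graph in $\mathcal F$, for all inputs and all orders, the output must be permissible except with probability at most $1/n$. The randomized online-LOCAL complexity of $\Pi$ on $\mathcal F$ is, for each $n$, the least locality that suffices for $n$-node graphs. **Theorem.** 1. If $\Pi$ can be solved on $\mathcal F$ with locality $T$ in randomized online-LOCAL, then it can be solved on $\mathcal F$ with locality $O(T+\log^* n)$ in deterministic LOCAL. 2. If $\Pi$ has a randomized online-LOCAL complexity $T(n)$ on $\mathcal F$ (i.e. it can be solved there at all), then $T(n)=O(1)$ or $T(n)=\Theta(n)$. 3. $\Pi$ can be solved on $\mathcal F$ with locality $O(1)$ in randomized online-LOCAL if and only if it can be solved on $\mathcal F$ with locality $O(\log^* n)$ in deterministic LOCAL. The constants in the asymptotic notation may depend on $\Pi$, $\mathcal F$, $c$ and the function $T$. -/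

import Mathlib

open Filter Asymptotics
open scoped ENNReal

noncomputable section

theorem clog_two_lt {n : ℕ} (h : ¬ n ≤ 1) : Nat.clog 2 n < n := by
  have h1 : n - 1 < 2 ^ (n - 1) := Nat.lt_two_pow_self
  have h2 : Nat.clog 2 n ≤ n - 1 := (Nat.clog_le_iff_le_pow (by norm_num)).2 (by omega)
  omega

/-- The iterated logarithm to base two. Rounding up does not change it: for integers, `log₂ n ≤ m`
holds exactly if `⌈log₂ n⌉ ≤ m` does. -/
def logStar (n : ℕ) : ℕ :=
  if n ≤ 1 then 0 else 1 + logStar (Nat.clog 2 n)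
termination_by n
decreasing_by exact clog_two_lt ‹_›

/-- The set of nodes at distance at most `t` from `v`. -/
def nbhd {V : Type*} (G : SimpleGraph V) (t : ℕ) (v : V) : Set V :=
  {u | G.edist v u ≤ (t : ℕ∞)}

theorem self_mem_nbhd {V : Type*} (G : SimpleGraph V) (t : ℕ) (v : V) : v ∈ nbhd G t v := by
  simp [nbhd]

/-- All nodes have degree at most `Δ`. -/
def DegreeAtMost {V : Type*} (G : SimpleGraph V) (Δ : ℕ) : Prop :=
  ∀ v, (G.neighborSet v).encard ≤ (Δ : ℕ∞)

/-! ### Labeling problems -/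

/-- A labeling problem: permissible output labelings for each finite graph with node inputs,
closed under graph isomorphism. -/
structure LabelingProblem (I O : Type*) where
  sol : ∀ {n : ℕ}, SimpleGraph (Fin n) → (Fin n → I) → Set (Fin n → O)
  iso_closed : ∀ {n : ℕ} (G G' : SimpleGraph (Fin n)) (φ : G ≃g G') (x : Fin n → I)
    (y : Fin n → O), y ∈ sol G' x → y ∘ φ ∈ sol G (x ∘ φ)

/-- A finite centered graph with an input and an output labeling. -/
structure CenteredLabeledGraph (I O : Type*) where
  size : ℕ
  graph : SimpleGraph (Fin size)
  center : Fin size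
  input : Fin size → I
  output : Fin size → O

/-- The radius-`r` neighborhood of `v`, with its labels, is isomorphic to `H`. -/
def NbhdIso {I O : Type*} {n : ℕ} (G : SimpleGraph (Fin n)) (x : Fin n → I) (y : Fin n → O)
    (r : ℕ) (v : Fin n) (H : CenteredLabeledGraph I O) : Prop :=
  ∃ φ : G.induce (nbhd G r v) ≃g H.graph,
    φ ⟨v, self_mem_nbhd G r v⟩ = H.center ∧
      ∀ u, H.input (φ u) = x u ∧ H.output (φ u) = y u

/-- `P` is locally checkable with checking radius `r` on graphs of maximum degree at most `Δ`. -/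
def LabelingProblem.IsLCL {I O : Type*} (P : LabelingProblem I O) (r Δ : ℕ) : Prop :=
  ∃ S : Set (CenteredLabeledGraph I O),
    (∀ H ∈ S, (∀ u, u ∈ nbhd H.graph r H.center) ∧ DegreeAtMost H.graph Δ) ∧
    ∀ (n : ℕ) (G : SimpleGraph (Fin n)) (x : Fin n → I), DegreeAtMost G Δ →
      ∀ y : Fin n → O, y ∈ P.sol G x ↔ ∀ v, ∃ H ∈ S, NbhdIso G x y r v H

/-! ### Paths and cycles -/

/-- A graph family: for each `n`, a set of graphs on `n` nodes. -/
abbrev GraphFamily : Type := ∀ n : ℕ, Set (SimpleGraph (Fin n))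

/-- Paths with at least one edge. -/
def paths : GraphFamily := fun n => {G | 2 ≤ n ∧ Nonempty (G ≃g SimpleGraph.pathGraph n)}

/-- Simple cycles. -/
def cycles : GraphFamily := fun n => {G | 3 ≤ n ∧ Nonempty (G ≃g SimpleGraph.cycleGraph n)}

def pathsAndCycles : GraphFamily := fun n => paths n ∪ cycles n

/-- Inputs restricted to the set `U`; `none` marks the nodes outside `U`. -/
def restrictInput {V I : Type*} (x : V → I) (U : Set V) (u : V) : Option I :=
  open scoped Classical in if u ∈ U then some (x u) else none

/-! ### The deterministic LOCAL model -/

/-- What a node sees: its own identifier, and the graph and the inputs in its neighborhood. Nodes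
are named by their identifiers; the visible nodes are those whose input is not `none`. -/
structure LocalView (I : Type*) where
  center : ℕ
  graph : SimpleGraph ℕ
  input : ℕ → Option I

/-- The radius-`t` view of the node `v`, i.e. the subgraph induced by its radius-`t` neighborhood
together with identifiers and inputs. -/
def localView {I : Type*} {n : ℕ} (t : ℕ) (G : SimpleGraph (Fin n)) (x : Fin n → I)
    (ident : Fin n ↪ ℕ) (v : Fin n) : LocalView I where
  center := ident v
  graph := ((G.induce (nbhd G t v)).spanningCoe).map ident
  input := Function.extend ident (restrictInput x (nbhd G t v)) (fun _ => none)

/-- On all `n`-node graphs of the family with any inputs, and any unique identifiers from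
`{1, …, n ^ c}`, the problem is solved by some deterministic LOCAL algorithm of locality `t`
(a map from radius-`t` views to outputs). -/
def LabelingProblem.LocalSolvable {I O : Type*} (P : LabelingProblem I O) (F : GraphFamily)
    (c n t : ℕ) : Prop :=
  ∃ a : LocalView I → O, ∀ G ∈ F n, ∀ (x : Fin n → I) (ident : Fin n ↪ ℕ),
    (∀ v, 1 ≤ ident v ∧ ident v ≤ n ^ c) →
      (fun v => a (localView t G x ident v)) ∈ P.sol G x

/-- Some deterministic LOCAL algorithm, which knows `n`, solves the problem with locality `T n`. -/
def LabelingProblem.HasLocalLocality {I O : Type*} (P : LabelingProblem I O) (F : GraphFamily)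
    (c : ℕ) (T : ℕ → ℕ) : Prop :=
  ∀ n, P.LocalSolvable F c n (T n)

/-! ### The randomized online-LOCAL model -/

/-- What an online-LOCAL algorithm knows when it has to label a node: the nodes presented so far
in order (the last one is to be labeled now), the subgraph revealed so far (with all inputs of the
revealed nodes, `none` elsewhere), and the outputs given so far (`none` elsewhere). -/
structure OnlineView (n : ℕ) (I O : Type*) where
  order : List (Fin n)
  graph : SimpleGraph (Fin n)
  input : Fin n → Option I
  output : Fin n → Option O

/-- The nodes within distance `t` of the presented nodes `σ 0, …, σ k`. -/
def revealed {n : ℕ} (t : ℕ) (G : SimpleGraph (Fin n)) (σ : Equiv.Perm (Fin n)) (k : ℕ) :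
    Set (Fin n) :=
  {u | ∃ j : Fin n, (j : ℕ) ≤ k ∧ u ∈ nbhd G t (σ j)}

def onlineView {I O : Type*} {n : ℕ} (t : ℕ) (G : SimpleGraph (Fin n)) (x : Fin n → I)
    (σ : Equiv.Perm (Fin n)) (k : ℕ) (y : Fin n → Option O) : OnlineView n I O where
  order := ((List.finRange n).take (k + 1)).map σ
  graph := (G.induce (revealed t G σ k)).spanningCoe
  input := restrictInput x (revealed t G σ k)
  output := y

/-- The partial labeling after the first `k` nodes have been presented to the deterministic
online-LOCAL algorithm `a` in the order `σ`. -/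
def onlineRun {I O : Type*} {n : ℕ} (a : OnlineView n I O → O) (t : ℕ) (G : SimpleGraph (Fin n))
    (x : Fin n → I) (σ : Equiv.Perm (Fin n)) : ℕ → Fin n → Option O
  | 0 => fun _ => none
  | k + 1 =>
    if h : k < n then
      Function.update (onlineRun a t G x σ k) (σ ⟨k, h⟩)
        (some (a (onlineView t G x σ k (onlineRun a t G x σ k))))
    else onlineRun a t G x σ k

/-- The algorithm `a` ends with a permissible output labeling. -/
def OnlineSuccess {I O : Type*} (P : LabelingProblem I O) {n : ℕ} (a : OnlineView n I O → O)
    (t : ℕ) (G : SimpleGraph (Fin n)) (x : Fin n → I) (σ : Equiv.Perm (Fin n)) : Prop :=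
  ∃ y ∈ P.sol G x, onlineRun a t G x σ n = fun v => some (y v)

/-- Some randomized online-LOCAL algorithm (a random deterministic one) of locality `t` fails with
probability at most `1 / n` on each `n`-node graph of the family, each input and each order. The
adversary is oblivious: graph, input and order are fixed before the random choice. -/
def LabelingProblem.RandOnlineSolvable {I O : Type*} (P : LabelingProblem I O) (F : GraphFamily)
    (n t : ℕ) : Prop :=
  ∃ A : PMF (OnlineView n I O → O), ∀ G ∈ F n, ∀ (x : Fin n → I) (σ : Equiv.Perm (Fin n)),
    A.toOuterMeasure {a | ¬ OnlineSuccess P a t G x σ} ≤ (n : ℝ≥0∞)⁻¹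

/-- Some randomized online-LOCAL algorithm, which knows `n`, solves the problem with locality
`T n`. -/
def LabelingProblem.HasRandOnlineLocality {I O : Type*} (P : LabelingProblem I O)
    (F : GraphFamily) (T : ℕ → ℕ) : Prop :=
  ∀ n, P.RandOnlineSolvable F n (T n)

/-- `T` is the randomized online-LOCAL complexity of the problem: for each `n`, the least
locality with which the problem can be solved. -/
def LabelingProblem.IsRandOnlineComplexity {I O : Type*} (P : LabelingProblem I O)
    (F : GraphFamily) (T : ℕ → ℕ) : Prop :=
  ∀ n, IsLeast {t | P.RandOnlineSolvable F n t} (T n)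

end

/-!
Along a path or a cycle, a permissible labeling is a run of a finite automaton that reads the inputs
and whose states are the labelings of `2 * r + 1` consecutive nodes. A word of inputs matters only
through its effect on states, in both directions, so there are finitely many types of words, and
sufficiently long words can be pumped without a change of type.

Suppose that an online algorithm has locality at most `ε n` for a single large `n`. The adversary
first presents patches of `2 * r + 1` nodes with all types of long surroundings, far apart, so that
the algorithm cannot tell how the patches are oriented and ordered along the graph. By a union bound
over the constantly many arrangements, some outputs for the patches can be completed in all of them.
This yields a finite object, a patch labeling: any two consecutive patches can be completed in
between. A patch may meet a copy of itself, which is why there are more copies than states.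

Conversely, given a patch labeling, a sparse maximal set of nodes suffices to solve the problem:
label the patches around these nodes and complete the labeling between them. The LOCAL model finds
such a set in `O(log* n)` rounds by color reduction, and the online-LOCAL model finds it greedily
with constant locality. Without a patch labeling the locality is `Ω(n)`, and `O(n)` rounds always
suffice to gather the whole graph.
-/

/-! ### Neighborhoods -/

section Neighborhoods

variable {V : Type*} {G : SimpleGraph V} {s t : ℕ} {u v w : V}

theorem mem_nbhd_iff_exists_walk : u ∈ nbhd G t v ↔ ∃ p : G.Walk v u, p.length ≤ t := by
  constructor
  · intro h
    obtain ⟨p, hp⟩ := SimpleGraph.exists_walk_of_edist_ne_top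
      (ne_top_of_le_ne_top (ENat.natCast_ne_top t) h)
    have hlen : (p.length : ℕ∞) ≤ t := hp ▸ h
    exact ⟨p, by exact_mod_cast hlen⟩
  · rintro ⟨p, hp⟩
    exact (SimpleGraph.edist_le p).trans (by exact_mod_cast hp)

theorem nbhd_mono (h : s ≤ t) (v : V) : nbhd G s v ⊆ nbhd G t v :=
  fun _ hu => le_trans (α := ℕ∞) hu (by exact_mod_cast h)

theorem nbhd_zero (G : SimpleGraph V) (v : V) : nbhd G 0 v = {v} := by
  ext u
  rw [nbhd, Set.mem_ofPred_eq, Nat.cast_zero, nonpos_iff_eq_zero, SimpleGraph.edist_eq_zero_iff,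
    eq_comm, Set.mem_singleton_iff]

theorem mem_nbhd_comm : u ∈ nbhd G t v ↔ v ∈ nbhd G t u := by
  simp [nbhd, SimpleGraph.edist_comm]

theorem mem_nbhd_trans (hu : u ∈ nbhd G s v) (hw : w ∈ nbhd G t u) : w ∈ nbhd G (s + t) v :=
  SimpleGraph.edist_triangle.trans ((add_le_add hu hw).trans_eq (Nat.cast_add s t).symm)

theorem mem_nbhd_of_adj (h : G.Adj v u) : u ∈ nbhd G 1 v :=
  mem_nbhd_iff_exists_walk.2 ⟨h.toWalk, le_rfl⟩

theorem mem_nbhd_succ : u ∈ nbhd G (t + 1) v ↔ u ∈ nbhd G t v ∨ ∃ w ∈ nbhd G t v, G.Adj w u := by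
  constructor
  · intro hu
    obtain ⟨p, hp⟩ := mem_nbhd_iff_exists_walk.1 (mem_nbhd_comm.1 hu)
    cases p with
    | nil => exact Or.inl (self_mem_nbhd G t u)
    | cons hadj q =>
      refine Or.inr ⟨_, mem_nbhd_comm.1 (mem_nbhd_iff_exists_walk.2 ⟨q, ?_⟩), hadj.symm⟩
      simpa using hp
  · rintro (hu | ⟨w, hw, hadj⟩)
    · exact nbhd_mono (Nat.le_succ t) v hu
    · exact mem_nbhd_trans hw (mem_nbhd_of_adj hadj)

theorem nbhd_congr {G' : SimpleGraph V}
    (h : ∀ s < t, ∀ a ∈ nbhd G s v, ∀ b, G.Adj a b ↔ G'.Adj a b) : nbhd G t v = nbhd G' t v := by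
  induction t with
  | zero => rw [nbhd_zero, nbhd_zero]
  | succ t ih =>
    have hprev : nbhd G t v = nbhd G' t v := ih fun s hs => h s (by omega)
    ext u
    rw [mem_nbhd_succ, mem_nbhd_succ, ← hprev]
    exact or_congr Iff.rfl (exists_congr fun w => and_congr_right fun hw => h t (by omega) w hw u)

theorem spanningCoe_induce_adj {U : Set V} :
    (G.induce U).spanningCoe.Adj u v ↔ G.Adj u v ∧ u ∈ U ∧ v ∈ U := by
  simp

theorem nbhd_spanningCoe_induce {U : Set V} (hU : nbhd G t v ⊆ U) :
    nbhd (G.induce U).spanningCoe t v = nbhd G t v := by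
  refine (nbhd_congr fun s hs a ha b => ?_).symm
  rw [spanningCoe_induce_adj]
  refine ⟨fun hab => ⟨hab, hU (nbhd_mono hs.le v ha), hU (nbhd_mono hs v ?_)⟩, And.left⟩
  exact mem_nbhd_succ.2 (Or.inr ⟨a, ha, hab⟩)

end Neighborhoods

/-! ### Two-sided infinite sequences -/

/-- The sequence `z` recentered such that position `p` becomes position `0`. -/
def shiftBy {α : Type*} (z : ℤ → α) (p : ℤ) : ℤ → α := fun i => z (p + i)

section shiftBy

variable {α β : Type*} (z : ℤ → α)

theorem shiftBy_apply (p i : ℤ) : shiftBy z p i = z (p + i) := rfl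

theorem shiftBy_zero : shiftBy z 0 = z := by
  ext i
  rw [shiftBy_apply, zero_add]

theorem shiftBy_shiftBy (p q : ℤ) : shiftBy (shiftBy z p) q = shiftBy z (p + q) := by
  ext i
  simp only [shiftBy_apply, add_assoc]

theorem shiftBy_comp_neg (p : ℤ) :
    shiftBy (fun i => z (-i)) p = fun i => shiftBy z (-p) (-i) := by
  ext i
  simp only [shiftBy_apply, neg_add]

theorem shiftBy_congr {z z' : ℤ → α} {ρ σ : ℕ} {p : ℤ} (h : ∀ i : ℤ, |i| ≤ ρ → z i = z' i)
    (hp : |p| + σ ≤ ρ) (i : ℤ) (hi : |i| ≤ σ) : shiftBy z p i = shiftBy z' p i :=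
  h _ ((abs_add_le p i).trans (by omega))

end shiftBy

/-! ### Charts of paths and cycles -/

/-- A parametrization of the nodes of a path or a cycle by integers. A path occupies an interval of
length `n`, with `none` outside of it; a cycle is traversed with period `n`. -/
structure IsChart {n : ℕ} (G : SimpleGraph (Fin n)) (ψ : ℤ → Option (Fin n)) : Prop where
  surj : ∀ v, ∃ i, ψ i = some v
  adj_iff : ∀ {i v}, ψ i = some v → ∀ w, G.Adj v w ↔ ψ (i + 1) = some w ∨ ψ (i - 1) = some w
  le_abs_sub : ∀ {i j v}, ψ i = some v → ψ j = some v → i ≠ j → (n : ℤ) ≤ |i - j|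
  shiftBy_eq : ∀ {i j v}, ψ i = some v → ψ j = some v → shiftBy ψ i = shiftBy ψ j
  ordConnected : {i | ψ i ≠ none}.OrdConnected

namespace IsChart

variable {n : ℕ} {G : SimpleGraph (Fin n)} {ψ : ℤ → Option (Fin n)}

theorem neg (h : IsChart G ψ) : IsChart G (fun i => ψ (-i)) where
  surj v := by
    obtain ⟨i, hi⟩ := h.surj v
    exact ⟨-i, by simpa using hi⟩
  adj_iff {i v} hv w := by
    rw [h.adj_iff hv, or_comm, neg_add', neg_sub', sub_neg_eq_add]
  le_abs_sub {i j v} hi hj hij := by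
    simpa only [neg_sub_neg, abs_sub_comm j i] using h.le_abs_sub hi hj (by omega)
  shiftBy_eq {i j v} hi hj := by
    rw [shiftBy_comp_neg, shiftBy_comp_neg, h.shiftBy_eq hi hj]
  ordConnected := ⟨fun _ hi _ hk _ hj =>
    h.ordConnected.out hk hi ⟨neg_le_neg hj.2, neg_le_neg hj.1⟩⟩

theorem recenter (h : IsChart G ψ) (p : ℤ) : IsChart G (shiftBy ψ p) where
  surj v := by
    obtain ⟨i, hi⟩ := h.surj v
    exact ⟨i - p, by simpa [shiftBy_apply] using hi⟩
  adj_iff {i v} hv w := by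
    rw [h.adj_iff hv, add_assoc, add_sub_assoc]
    rfl
  le_abs_sub {i j v} hi hj hij := by
    simpa only [add_sub_add_left_eq_sub] using h.le_abs_sub hi hj (by omega)
  shiftBy_eq {i j v} hi hj := by
    rw [shiftBy_shiftBy, shiftBy_shiftBy, h.shiftBy_eq hi hj]
  ordConnected := ⟨fun _ hi _ hk _ hj =>
    h.ordConnected.out hi hk ⟨add_le_add_right hj.1 p, add_le_add_right hj.2 p⟩⟩

theorem exists_step_toward_center (h : IsChart G ψ) {i : ℤ} {u v : Fin n} (h0 : ψ 0 = some v)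
    (hu : ψ i = some u) (hi : i ≠ 0) :
    ∃ j w, |j| + 1 = |i| ∧ ψ j = some w ∧ G.Adj w u := by
  have hmem0 : (0 : ℤ) ∈ {i | ψ i ≠ none} := by simp [h0]
  have hmem : i ∈ {i | ψ i ≠ none} := by simp [hu]
  rcases hi.lt_or_gt with hneg | hpos
  · obtain ⟨w, hw⟩ := Option.ne_none_iff_exists'.1
      (h.ordConnected.out hmem hmem0 (⟨by omega, by omega⟩ : i + 1 ∈ Set.Icc i 0))
    refine ⟨i + 1, w, ?_, hw, (h.adj_iff hw u).2 (Or.inr (by rwa [add_sub_cancel_right]))⟩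
    rw [abs_of_neg hneg, abs_of_nonpos (by omega)]
    ring
  · obtain ⟨w, hw⟩ := Option.ne_none_iff_exists'.1
      (h.ordConnected.out hmem0 hmem (⟨by omega, by omega⟩ : i - 1 ∈ Set.Icc 0 i))
    refine ⟨i - 1, w, ?_, hw, (h.adj_iff hw u).2 (Or.inl (by rwa [sub_add_cancel]))⟩
    rw [abs_of_pos hpos, abs_of_nonneg (by omega)]
    ring

theorem mem_nbhd_iff_of_zero (h : IsChart G ψ) {v u : Fin n} (h0 : ψ 0 = some v) {t : ℕ} :
    u ∈ nbhd G t v ↔ ∃ i : ℤ, |i| ≤ t ∧ ψ i = some u := by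
  induction t generalizing u with
  | zero => simp [nbhd_zero, h0, eq_comm]
  | succ t ih =>
    rw [mem_nbhd_succ]
    constructor
    · rintro (hu | ⟨w, hw, hadj⟩)
      · obtain ⟨i, hi, hu⟩ := ih.1 hu
        exact ⟨i, by push_cast; omega, hu⟩
      · obtain ⟨i, hi, hw⟩ := ih.1 hw
        rw [abs_le] at hi
        rcases (h.adj_iff hw u).1 hadj with hu | hu
        · exact ⟨i + 1, by rw [abs_le]; push_cast; omega, hu⟩
        · exact ⟨i - 1, by rw [abs_le]; push_cast; omega, hu⟩
    · rintro ⟨i, hi, hu⟩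
      by_cases hi0 : i = 0
      · exact Or.inl (ih.2 ⟨i, by simp [hi0], hu⟩)
      · obtain ⟨j, w, hj, hw, hadj⟩ := h.exists_step_toward_center h0 hu hi0
        exact Or.inr ⟨w, ih.2 ⟨j, by push_cast at hi; omega, hw⟩, hadj⟩

theorem mem_nbhd_iff (h : IsChart G ψ) {p : ℤ} {v : Fin n} (hp : ψ p = some v) {t : ℕ}
    {u : Fin n} : u ∈ nbhd G t v ↔ ∃ i : ℤ, |i| ≤ t ∧ ψ (p + i) = some u :=
  (h.recenter p).mem_nbhd_iff_of_zero (by rwa [shiftBy_apply, add_zero])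

theorem degreeAtMost (h : IsChart G ψ) {Δ : ℕ} (hΔ : 2 ≤ Δ) : DegreeAtMost G Δ := by
  intro v
  obtain ⟨p, hp⟩ := h.surj v
  have hsub : some '' G.neighborSet v ⊆ {ψ (p + 1), ψ (p - 1)} := by
    rintro _ ⟨w, hw, rfl⟩
    exact ((h.adj_iff hp w).1 hw).imp Eq.symm Eq.symm
  calc (G.neighborSet v).encard = (some '' G.neighborSet v).encard :=
        ((Option.some_injective _).encard_image _).symm
    _ ≤ ({ψ (p + 1), ψ (p - 1)} : Set (Option (Fin n))).encard := Set.encard_le_encard hsub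
    _ ≤ 2 := by simpa [one_add_one_eq_two] using Set.encard_insert_le {ψ (p - 1)} (ψ (p + 1))
    _ ≤ Δ := by exact_mod_cast hΔ

end IsChart

/-- The chart of the path on `n` nodes that visits them in the order given by `π`. -/
def pathChart {n : ℕ} (π : Fin n → Fin n) (i : ℤ) : Option (Fin n) :=
  if h : 0 ≤ i ∧ i < n then some (π ⟨i.toNat, by omega⟩) else none

/-- The chart of the cycle on `n` nodes that visits them in the order given by `π`. -/
def cycleChart {n : ℕ} (hn : 0 < n) (π : Fin n → Fin n) (i : ℤ) : Option (Fin n) :=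
  some (π ⟨(i % n).toNat, by
    have := Int.emod_nonneg i (b := n) (by omega)
    have := Int.emod_lt_of_pos i (b := n) (by omega)
    omega⟩)

section charts

variable {n : ℕ} {G : SimpleGraph (Fin n)}

theorem pathChart_eq_some {π : Fin n ≃ Fin n} {i : ℤ} {j : Fin n} :
    pathChart π i = some (π j) ↔ i = j := by
  unfold pathChart
  split_ifs with h
  · simp only [Option.some.injEq, π.apply_eq_iff_eq, Fin.ext_iff]
    omega
  · simp only [false_iff]
    rintro rfl
    exact h ⟨by simp, by simp⟩

theorem pathChart_ne_none {π : Fin n → Fin n} {i : ℤ} : pathChart π i ≠ none ↔ 0 ≤ i ∧ i < n := by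
  unfold pathChart
  split_ifs with h <;> simp [h]

theorem isChart_pathChart (π : Fin n ≃ Fin n)
    (h : ∀ i j, G.Adj (π i) (π j) ↔ (SimpleGraph.pathGraph n).Adj i j) :
    IsChart G (pathChart π) where
  surj v := by
    obtain ⟨a, rfl⟩ := π.surjective v
    exact ⟨a, pathChart_eq_some.2 rfl⟩
  adj_iff {i v} hv w := by
    obtain ⟨a, rfl⟩ := π.surjective v
    obtain ⟨b, rfl⟩ := π.surjective w
    rw [pathChart_eq_some] at hv
    rw [pathChart_eq_some, pathChart_eq_some, h, SimpleGraph.pathGraph_adj]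
    omega
  le_abs_sub {i j v} hi hj hij := by
    obtain ⟨a, rfl⟩ := π.surjective v
    exact absurd ((pathChart_eq_some.1 hi).trans (pathChart_eq_some.1 hj).symm) hij
  shiftBy_eq {i j v} hi hj := by
    obtain ⟨a, rfl⟩ := π.surjective v
    rw [pathChart_eq_some.1 hi, pathChart_eq_some.1 hj]
  ordConnected := by
    simp only [pathChart_ne_none]
    exact Set.ordConnected_Ico

theorem cycleChart_eq_some (hn : 0 < n) {π : Fin n ≃ Fin n} {i : ℤ} {j : Fin n} :
    cycleChart hn π i = some (π j) ↔ (n : ℤ) ∣ i - j := by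
  have hmod : (n : ℤ) ∣ i - j ↔ i % n = j := by
    rw [← Int.modEq_iff_dvd, Int.ModEq, Int.emod_eq_of_lt (a := (j : ℤ)) (by omega) (by omega),
      eq_comm]
  have := Int.emod_nonneg i (b := n) (by omega)
  simp only [cycleChart, Option.some.injEq, π.apply_eq_iff_eq, Fin.ext_iff, hmod]
  omega

theorem cycleGraph_adj_iff_dvd (hn : 3 ≤ n) (a b : Fin n) :
    (SimpleGraph.cycleGraph n).Adj a b ↔ (n : ℤ) ∣ a + 1 - b ∨ (n : ℤ) ∣ a - 1 - b := by
  have val_sub_eq_one (x y : Fin n) : ((x - y : Fin n) : ℕ) = 1 ↔ (n : ℤ) ∣ y + 1 - x := by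
    have hy := y.2
    calc ((x - y : Fin n) : ℕ) = 1 ↔ n - y + x ≡ 1 [MOD n] := by
          rw [Fin.val_sub, Nat.ModEq, Nat.mod_eq_of_lt (show 1 < n by omega)]
      _ ↔ (n : ℤ) ∣ y + 1 - x - n := by
          rw [Nat.modEq_iff_dvd]
          push_cast [hy.le]
          ring_nf
      _ ↔ (n : ℤ) ∣ y + 1 - x := dvd_sub_self_right
  rw [SimpleGraph.cycleGraph_adj', val_sub_eq_one, val_sub_eq_one, or_comm,
    ← dvd_neg (b := (b : ℤ) + 1 - a)]
  ring_nf

theorem isChart_cycleChart (hn : 3 ≤ n) (π : Fin n ≃ Fin n)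
    (h : ∀ i j, G.Adj (π i) (π j) ↔ (SimpleGraph.cycleGraph n).Adj i j) :
    IsChart G (cycleChart (by omega) π) where
  surj v := by
    obtain ⟨a, rfl⟩ := π.surjective v
    exact ⟨a, (cycleChart_eq_some _).2 (by simp)⟩
  adj_iff {i v} hv w := by
    obtain ⟨a, rfl⟩ := π.surjective v
    obtain ⟨b, rfl⟩ := π.surjective w
    rw [cycleChart_eq_some] at hv
    rw [cycleChart_eq_some, cycleChart_eq_some, h, cycleGraph_adj_iff_dvd hn,
      show i + 1 - (b : ℤ) = (a + 1 - b) + (i - a) by ring, dvd_add_left hv,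
      show i - 1 - (b : ℤ) = (a - 1 - b) + (i - a) by ring, dvd_add_left hv]
  le_abs_sub {i j v} hi hj hij := by
    obtain ⟨a, rfl⟩ := π.surjective v
    rw [cycleChart_eq_some] at hi hj
    have hdvd : (n : ℤ) ∣ i - j := by simpa using dvd_sub hi hj
    exact Int.le_of_dvd (abs_pos.2 (by omega)) ((dvd_abs _ _).2 hdvd)
  shiftBy_eq {i j v} hi hj := by
    obtain ⟨a, rfl⟩ := π.surjective v
    rw [cycleChart_eq_some] at hi hj
    have hdvd : (n : ℤ) ∣ j - i := by simpa using dvd_sub hj hi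
    ext1 k
    have hmod : (i + k) % n = (j + k) % n := Int.modEq_iff_dvd.2 (by simpa using hdvd)
    simp only [shiftBy_apply, cycleChart, hmod]
  ordConnected := by simp [cycleChart, Set.ordConnected_univ]

end charts

/-- The three graph families of the theorem. -/
def IsPathCycleFamily (F : GraphFamily) : Prop :=
  F = paths ∨ F = cycles ∨ F = pathsAndCycles

namespace IsPathCycleFamily

variable {F : GraphFamily} {n : ℕ} {G : SimpleGraph (Fin n)}

theorem pathGraph_mem (hF : IsPathCycleFamily F) (hFc : F ≠ cycles) (hn : 2 ≤ n)
    (hG : Nonempty (G ≃g SimpleGraph.pathGraph n)) : G ∈ F n := by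
  rcases hF with rfl | rfl | rfl
  exacts [⟨hn, hG⟩, absurd rfl hFc, Or.inl ⟨hn, hG⟩]

theorem mem_cycles_or (hF : IsPathCycleFamily F) (hG : G ∈ F n) :
    G ∈ cycles n ∨ G ∈ paths n ∧ F ≠ cycles := by
  have hpath : SimpleGraph.pathGraph 2 ∉ cycles 2 := fun h => absurd h.1 (by norm_num)
  have hpath' : SimpleGraph.pathGraph 2 ∈ paths 2 := ⟨le_rfl, ⟨SimpleGraph.Iso.refl⟩⟩
  rcases hF with rfl | rfl | rfl
  · exact Or.inr ⟨hG, fun h => hpath (h ▸ hpath')⟩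
  · exact Or.inl hG
  · exact hG.symm.imp_right fun hG => ⟨hG, fun h => hpath (h ▸ Or.inl hpath')⟩

theorem two_le (hF : IsPathCycleFamily F) (hG : G ∈ F n) : 2 ≤ n := by
  rcases hF.mem_cycles_or hG with h | h
  · have := h.1
    omega
  · exact h.1.1

theorem connected (hF : IsPathCycleFamily F) (hG : G ∈ F n) : G.Connected := by
  obtain ⟨m, rfl⟩ := Nat.exists_eq_add_of_le' (hF.two_le hG)
  rcases hF.mem_cycles_or hG with ⟨_, ⟨e⟩⟩ | ⟨⟨_, ⟨e⟩⟩, _⟩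
  · exact e.connected_iff.2 SimpleGraph.cycleGraph_connected
  · exact e.connected_iff.2 (SimpleGraph.pathGraph_connected _)

theorem exists_chart (hF : IsPathCycleFamily F) (hG : G ∈ F n) :
    ∃ ψ, IsChart G ψ ∧ (F = cycles → ∀ i, ψ i ≠ none) := by
  rcases hF.mem_cycles_or hG with ⟨hn, ⟨e⟩⟩ | ⟨⟨_, ⟨e⟩⟩, hFc⟩
  · exact ⟨_, isChart_cycleChart hn e.symm.toEquiv fun i j => e.symm.map_adj_iff,
      fun _ i => by simp [cycleChart]⟩
  · exact ⟨_, isChart_pathChart e.symm.toEquiv fun i j => e.symm.map_adj_iff,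
      fun h => absurd h hFc⟩

theorem exists_mem_of_perm (hF : IsPathCycleFamily F) (hn : 3 ≤ n) (π : Fin n ≃ Fin n) :
    ∃ G ∈ F n, ∃ ψ, IsChart G ψ ∧ (∀ i : Fin n, ψ i = some (π i)) ∧
      (F ≠ cycles → ∀ i < 0, ψ i = none) := by
  have hadj (H : SimpleGraph (Fin n)) (i j) : (H.comap π.symm).Adj (π i) (π j) ↔ H.Adj i j := by
    simp
  have hiso (H : SimpleGraph (Fin n)) : Nonempty (H.comap π.symm ≃g H) :=
    ⟨SimpleGraph.Iso.comap π.symm H⟩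
  by_cases hFc : F = cycles
  · subst hFc
    exact ⟨_, ⟨hn, hiso _⟩, _, isChart_cycleChart hn π (hadj _),
      fun i => (cycleChart_eq_some _).2 (by simp), fun h => absurd rfl h⟩
  · refine ⟨_, hF.pathGraph_mem hFc (by omega) (hiso _), _, isChart_pathChart π (hadj _),
      fun i => pathChart_eq_some.2 rfl, fun _ i hi => ?_⟩
    by_contra h
    exact hi.not_ge (pathChart_ne_none.1 h).1

end IsPathCycleFamily

/-! ### Equal views give equal charts up to reversal -/

/-- The labels next to position `i`. -/
def nbrLabels {N : Type*} (z : ℤ → Option N) (i : ℤ) : Set N :=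
  {b | z (i + 1) = some b ∨ z (i - 1) = some b}

/-- A sequence of labels without gaps in which no two positions at distance two have the same label:
the labels read off while walking along a path or a cycle. -/
structure IsWalkSeq {N : Type*} (z : ℤ → Option N) : Prop where
  ne_of_eq_some : ∀ {i b}, z (i + 1) = some b → z (i - 1) ≠ some b
  ordConnected : {i | z i ≠ none}.OrdConnected

theorem nbrLabels_comp_neg {N : Type*} (z : ℤ → Option N) (i : ℤ) :
    nbrLabels (fun i => z (-i)) i = nbrLabels z (-i) := by
  ext b
  rw [nbrLabels, nbrLabels, Set.mem_ofPred_eq, Set.mem_ofPred_eq, neg_add', neg_sub',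
    sub_neg_eq_add, or_comm]

theorem option_pair_eq_or_swap {N : Type*} {A B C D : Option N}
    (hAB : ∀ {b}, A = some b → B ≠ some b) (hCD : ∀ {b}, C = some b → D ≠ some b)
    (h : ∀ b, (A = some b ∨ B = some b) ↔ (C = some b ∨ D = some b)) :
    (A = C ∧ B = D) ∨ (A = D ∧ B = C) := by
  have hA {a} (hA : A = some a) := (h a).1 (Or.inl hA)
  have hB {b} (hB : B = some b) := (h b).1 (Or.inr hB)
  have hC {c} (hC : C = some c) := (h c).2 (Or.inl hC)
  have hD {d} (hD : D = some d) := (h d).2 (Or.inr hD)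
  clear h
  rcases A with _ | a <;> rcases B with _ | b <;> rcases C with _ | c <;> rcases D with _ | d <;>
    grind

namespace IsWalkSeq

variable {N : Type*} {z z' : ℤ → Option N} {t : ℕ}

theorem comp_neg (h : IsWalkSeq z) : IsWalkSeq (fun i => z (-i)) where
  ne_of_eq_some {i b} hb hb' := by
    rw [neg_add'] at hb
    rw [neg_sub', sub_neg_eq_add] at hb'
    exact h.ne_of_eq_some hb' hb
  ordConnected := ⟨fun _ hi _ hk _ hj =>
    h.ordConnected.out hk hi ⟨neg_le_neg hj.2, neg_le_neg hj.1⟩⟩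

theorem next_eq (h : IsWalkSeq z) (h' : IsWalkSeq z') {i : ℤ}
    (hnbr : nbrLabels z i = nbrLabels z' i) (hprev : z (i - 1) = z' (i - 1)) :
    z (i + 1) = z' (i + 1) := by
  ext b
  have hb : (z (i + 1) = some b ∨ z (i - 1) = some b) ↔
      (z' (i + 1) = some b ∨ z' (i - 1) = some b) :=
    Set.ext_iff.1 hnbr b
  have hz := h.ne_of_eq_some (i := i) (b := b)
  have hz' := h'.ne_of_eq_some (i := i) (b := b)
  rw [← hprev] at hb hz'
  tauto

theorem eq_none_of_le (h : IsWalkSeq z) {i j : ℤ} (h0 : z 0 ≠ none) (hi : 0 ≤ i) (hij : i ≤ j)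
    (hnone : z i = none) : z j = none := by
  by_contra hj
  exact h.ordConnected.out h0 hj ⟨hi, hij⟩ hnone

theorem eq_on_ray (h : IsWalkSeq z) (h' : IsWalkSeq z')
    (hnbr : ∀ i : ℤ, |i| < t → z i ≠ none → z i = z' i → nbrLabels z i = nbrLabels z' i)
    (h0 : z 0 = z' 0) (hne : z 0 ≠ none) (h1 : z 1 = z' 1) (m : ℕ) (hm : m ≤ t) :
    z m = z' m := by
  induction m using Nat.twoStepInduction with
  | zero => simpa using h0
  | one => simpa using h1
  | more m ihm ihm1 =>
    have hcur : z (m + 1) = z' (m + 1) := by exact_mod_cast ihm1 (by omega)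
    have hprev : z m = z' m := ihm (by omega)
    rw [show ((m + 2 : ℕ) : ℤ) = m + 1 + 1 by push_cast; ring]
    by_cases hnone : z (m + 1) = none
    · rw [h.eq_none_of_le hne (by omega) (by omega) hnone,
        h'.eq_none_of_le (h0 ▸ hne) (by omega) (by omega) (hcur ▸ hnone)]
    · refine h.next_eq h' (hnbr _ (by rw [abs_lt]; omega) hnone hcur) ?_
      rwa [add_sub_cancel_right]

theorem eq_on_window (h : IsWalkSeq z) (h' : IsWalkSeq z')
    (hnbr : ∀ i : ℤ, |i| < t → z i ≠ none → z i = z' i → nbrLabels z i = nbrLabels z' i)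
    (h0 : z 0 = z' 0) (hne : z 0 ≠ none) (h1 : z 1 = z' 1) (h1' : z (-1) = z' (-1)) (i : ℤ)
    (hi : |i| ≤ t) : z i = z' i := by
  obtain ⟨m, rfl | rfl⟩ := Int.eq_nat_or_neg i
  · exact h.eq_on_ray h' hnbr h0 hne h1 m (by simpa using hi)
  · refine h.comp_neg.eq_on_ray h'.comp_neg (fun i hi hz hzz' => ?_) (by simpa using h0)
      (by simpa using hne) h1' m (by simpa using hi)
    rw [nbrLabels_comp_neg, nbrLabels_comp_neg]
    exact hnbr (-i) (by rwa [abs_neg]) hz hzz'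

theorem eq_or_eq_neg_on_window (h : IsWalkSeq z) (h' : IsWalkSeq z')
    (hnbr : ∀ i j : ℤ, |i| < t → |j| < t → z i ≠ none → z i = z' j →
      nbrLabels z i = nbrLabels z' j)
    (h0 : z 0 = z' 0) (hne : z 0 ≠ none) :
    (∀ i : ℤ, |i| ≤ t → z i = z' i) ∨ (∀ i : ℤ, |i| ≤ t → z i = z' (-i)) := by
  rcases Nat.eq_zero_or_pos t with rfl | ht
  · refine Or.inl fun i hi => ?_
    rwa [show i = 0 by simpa using hi]
  have h00 := Set.ext_iff.1 (hnbr 0 0 (by simpa using ht) (by simpa using ht) hne h0)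
  rcases option_pair_eq_or_swap h.ne_of_eq_some h'.ne_of_eq_some h00 with ⟨h1, h2⟩ | ⟨h1, h2⟩
  · exact Or.inl (h.eq_on_window h' (fun i hi => hnbr i i hi hi) h0 hne h1 h2)
  · refine Or.inr (h.eq_on_window h'.comp_neg (fun i hi hz hzz' => ?_) (by simpa using h0) hne
      h1 h2)
    rw [nbrLabels_comp_neg]
    exact hnbr i (-i) hi (by rwa [abs_neg]) hz hzz'

end IsWalkSeq

namespace IsChart

variable {N : Type*} {n : ℕ} {G : SimpleGraph (Fin n)} {ψ : ℤ → Option (Fin n)}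

theorem isWalkSeq_map (h : IsChart G ψ) (hn : 3 ≤ n) (g : Fin n ↪ N) :
    IsWalkSeq (fun i => (ψ i).map g) where
  ne_of_eq_some {i b} hb hb' := by
    obtain ⟨u, hu, rfl⟩ := Option.map_eq_some_iff.1 hb
    obtain ⟨w, hw, hwu⟩ := Option.map_eq_some_iff.1 hb'
    have hle := h.le_abs_sub hu (g.injective hwu ▸ hw) (by omega)
    rw [show i + 1 - (i - 1) = 2 by ring, abs_two] at hle
    omega
  ordConnected := by simpa using h.ordConnected

theorem nbrLabels_map (h : IsChart G ψ) (g : Fin n → N) {i : ℤ} {v : Fin n} (hv : ψ i = some v) :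
    nbrLabels (fun i => (ψ i).map g) i = g '' G.neighborSet v := by
  ext b
  simp only [nbrLabels, Set.mem_ofPred_eq, Option.map_eq_some_iff, Set.mem_image,
    SimpleGraph.mem_neighborSet, h.adj_iff hv, ← exists_or, or_and_right]

theorem map_eq_or_eq_neg {n' : ℕ} (hn : 3 ≤ n) (hn' : 3 ≤ n') {G' : SimpleGraph (Fin n')} {ψ'}
    (h : IsChart G ψ) (h' : IsChart G' ψ') (g : Fin n ↪ N) (g' : Fin n' ↪ N) {v v' p p'}
    (hp : ψ p = some v) (hp' : ψ' p' = some v') (hv : g v = g' v') {t : ℕ}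
    (hnbr : ∀ s < t, ∀ a ∈ nbhd G s v, ∀ a' ∈ nbhd G' s v', g a = g' a' →
      g '' G.neighborSet a = g' '' G'.neighborSet a') :
    (∀ i : ℤ, |i| ≤ t → (ψ (p + i)).map g = (ψ' (p' + i)).map g') ∨
      (∀ i : ℤ, |i| ≤ t → (ψ (p + i)).map g = (ψ' (p' - i)).map g') := by
  have hwalk := (h.recenter p).isWalkSeq_map hn g
  have hwalk' := (h'.recenter p').isWalkSeq_map hn' g'
  simp only [sub_eq_add_neg]
  refine hwalk.eq_or_eq_neg_on_window hwalk' (fun i j hi hj hne hij => ?_)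
    (by simp [shiftBy_apply, hp, hp', hv]) (by simp [shiftBy_apply, hp])
  obtain ⟨b, hb⟩ := Option.ne_none_iff_exists'.1 hne
  obtain ⟨u, hu, hub⟩ := Option.map_eq_some_iff.1 hb
  obtain ⟨u', hu', hub'⟩ := Option.map_eq_some_iff.1 (hij.symm.trans hb)
  have := abs_nonneg i
  refine ((h.recenter p).nbrLabels_map g hu).trans
    (Eq.trans ?_ ((h'.recenter p').nbrLabels_map g' hu').symm)
  exact hnbr (t - 1) (by omega) u ((h.mem_nbhd_iff hp).2 ⟨i, by omega, hu⟩) u'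
    ((h'.mem_nbhd_iff hp').2 ⟨j, by omega, hu'⟩) (hub.trans hub'.symm)

end IsChart

/-! ### Local checking in charts -/

/-- `S` contains exactly those labeled radius-`r` neighborhoods of graphs of maximum degree at most
`Δ` that `P` permits. -/
def LabelingProblem.IsCheckedBy {I O : Type*} (P : LabelingProblem I O)
    (S : Set (CenteredLabeledGraph I O)) (r Δ : ℕ) : Prop :=
  ∀ (n : ℕ) (G : SimpleGraph (Fin n)) (x : Fin n → I), DegreeAtMost G Δ →
    ∀ y : Fin n → O, y ∈ P.sol G x ↔ ∀ v, ∃ H ∈ S, NbhdIso G x y r v H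

/-- The positions of absolute value at most `r` at which `ω` is defined. -/
abbrev WindowDom {α : Type*} (r : ℕ) (ω : ℤ → Option α) : Type := {i : ℤ // |i| ≤ r ∧ ω i ≠ none}

/-- The window of radius `r` of the labeled sequence `ω` around position `0`, regarded as a path
with center `0`, is isomorphic to `H`. -/
def WindowIso {I O : Type*} (H : CenteredLabeledGraph I O) (r : ℕ)
    (ω : ℤ → Option (I × O)) : Prop :=
  ∃ φ : WindowDom r ω ≃ Fin H.size,
    (∀ i j, H.graph.Adj (φ i) (φ j) ↔ (j : ℤ) = i + 1 ∨ (j : ℤ) = i - 1) ∧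
    (∀ i : WindowDom r ω, (i : ℤ) = 0 → φ i = H.center) ∧
    ∀ i : WindowDom r ω, ω i = some (H.input (φ i), H.output (φ i))

/-- The constraint that an LCL with the allowed neighborhoods `S` puts on position `0` of a labeled
sequence; there is no constraint if this position is not a node. -/
def WindowOK {I O : Type*} (S : Set (CenteredLabeledGraph I O)) (r : ℕ)
    (ω : ℤ → Option (I × O)) : Prop :=
  ω 0 = none ∨ ∃ H ∈ S, WindowIso H r ω

section WindowOK

variable {I O : Type*} {S : Set (CenteredLabeledGraph I O)} {H : CenteredLabeledGraph I O} {r : ℕ}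
  {ω ω' : ℤ → Option (I × O)}

theorem WindowIso.congr (hω : WindowIso H r ω) (h : ∀ i : ℤ, |i| ≤ r → ω i = ω' i) :
    WindowIso H r ω' := by
  obtain ⟨φ, hadj, hcenter, hlabel⟩ := hω
  have hdom (i : ℤ) : (|i| ≤ r ∧ ω' i ≠ none) ↔ (|i| ≤ r ∧ ω i ≠ none) :=
    and_congr_right fun hi => by rw [h i hi]
  exact ⟨(Equiv.subtypeEquivRight hdom).trans φ, fun i j => hadj _ _, fun i hi => hcenter _ hi,
    fun i => (h i i.2.1).symm.trans (hlabel (Equiv.subtypeEquivRight hdom i))⟩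

theorem WindowIso.neg (hω : WindowIso H r ω) : WindowIso H r (fun i => ω (-i)) := by
  obtain ⟨φ, hadj, hcenter, hlabel⟩ := hω
  refine ⟨((Equiv.neg ℤ).subtypeEquiv fun i => by simp).trans φ, fun i j => ?_,
    fun i hi => hcenter _ (by simp [hi]), fun i => hlabel ⟨-i, by simpa using i.2⟩⟩
  rw [Equiv.trans_apply, Equiv.trans_apply, hadj]
  simp only [Equiv.subtypeEquiv_apply, Equiv.neg_apply]
  omega

theorem WindowOK.of_eq_none (h : ω 0 = none) : WindowOK S r ω :=
  Or.inl h

theorem WindowOK.congr (hω : WindowOK S r ω) (h : ∀ i : ℤ, |i| ≤ r → ω i = ω' i) :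
    WindowOK S r ω' :=
  hω.imp (h 0 (by simp) ▸ ·) fun ⟨H, hH, hiso⟩ => ⟨H, hH, hiso.congr h⟩

theorem WindowOK.neg (hω : WindowOK S r ω) : WindowOK S r (fun i => ω (-i)) :=
  hω.imp (neg_zero (G := ℤ) ▸ ·) fun ⟨H, hH, hiso⟩ => ⟨H, hH, hiso.neg⟩

theorem nbhdIso_iff_windowIso {n : ℕ} {G : SimpleGraph (Fin n)} {v : Fin n} {x : Fin n → I}
    {y : Fin n → O} (e : WindowDom r ω ≃ nbhd G r v)
    (hadj : ∀ i j, G.Adj (e i) (e j) ↔ (j : ℤ) = i + 1 ∨ (j : ℤ) = i - 1)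
    (hcenter : ∀ i : WindowDom r ω, (i : ℤ) = 0 ↔ (e i : Fin n) = v)
    (hlabel : ∀ i : WindowDom r ω, ω i = some (x (e i), y (e i))) :
    NbhdIso G x y r v H ↔ WindowIso H r ω := by
  constructor
  · rintro ⟨φ, hφ, hφxy⟩
    refine ⟨e.trans φ.toEquiv, fun i j => φ.map_adj_iff.trans (hadj i j), fun i hi => ?_,
      fun i => ?_⟩
    · rw [← hφ]
      exact congrArg φ (Subtype.ext ((hcenter i).1 hi))
    · rw [hlabel, ← (hφxy (e i)).1, ← (hφxy (e i)).2]
      rfl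
  · rintro ⟨φ, hφadj, hφ, hφxy⟩
    refine ⟨⟨e.symm.trans φ, fun {a b} => (hφadj _ _).trans ?_⟩, hφ _ ?_, fun a => ?_⟩
    · rw [← hadj, e.apply_symm_apply, e.apply_symm_apply]
      rfl
    · rw [hcenter, e.apply_symm_apply]
    · have h := (hφxy (e.symm a)).symm.trans (hlabel (e.symm a))
      rwa [e.apply_symm_apply, Option.some_inj, Prod.mk.injEq] at h

end WindowOK

namespace IsChart

variable {I O α : Type*} {S : Set (CenteredLabeledGraph I O)} {r n : ℕ} {G : SimpleGraph (Fin n)}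
  {ψ : ℤ → Option (Fin n)}

theorem eq_of_abs_sub_lt (h : IsChart G ψ) {i j : ℤ} {v : Fin n} (hi : ψ i = some v)
    (hj : ψ j = some v) (hij : |i - j| < n) : i = j := by
  by_contra hne
  exact (h.le_abs_sub hi hj hne).not_gt hij

theorem adj_iff_of_window (h : IsChart G ψ) (hn : 2 * r + 2 ≤ n) {i j : ℤ} (hi : |i| ≤ r)
    (hj : |j| ≤ r) {u w : Fin n} (hu : ψ i = some u) (hw : ψ j = some w) :
    G.Adj u w ↔ j = i + 1 ∨ j = i - 1 := by
  rw [abs_le] at hi hj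
  rw [h.adj_iff hu]
  refine or_congr ⟨fun hw' => ?_, ?_⟩ ⟨fun hw' => ?_, ?_⟩
  · exact h.eq_of_abs_sub_lt hw hw' (by rw [abs_lt]; omega)
  · rintro rfl
    exact hw
  · exact h.eq_of_abs_sub_lt hw hw' (by rw [abs_lt]; omega)
  · rintro rfl
    exact hw

theorem exists_equiv_nbhd (h : IsChart G ψ) {v : Fin n} (h0 : ψ 0 = some v)
    (hn : 2 * r + 2 ≤ n) (g : Fin n → α) :
    ∃ e : WindowDom r (fun i => (ψ i).map g) ≃ nbhd G r v,
      ∀ i : WindowDom r (fun i => (ψ i).map g), ψ i = some (e i : Fin n) := by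
  have hsome (i : WindowDom r (fun i => (ψ i).map g)) : ψ i ≠ none := by simpa using i.2.2
  choose f hf using fun i => Option.ne_none_iff_exists'.1 (hsome i)
  refine ⟨Equiv.ofBijective
    (fun i => ⟨f i, (h.mem_nbhd_iff_of_zero h0).2 ⟨i, i.2.1, hf i⟩⟩) ⟨fun i j hij => ?_, ?_⟩, hf⟩
  · have hi := abs_le.1 i.2.1
    have hj := abs_le.1 j.2.1
    refine Subtype.ext (h.eq_of_abs_sub_lt (hf i) ?_ (by rw [abs_lt]; omega))
    rw [hf j, Subtype.mk.inj hij]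
  · rintro ⟨u, hu⟩
    obtain ⟨i, hi, hiu⟩ := (h.mem_nbhd_iff_of_zero h0).1 hu
    refine ⟨⟨i, hi, by simp [hiu]⟩, Subtype.ext (Option.some_injective _ ?_)⟩
    rw [← hf, hiu]

theorem nbhdIso_iff (h : IsChart G ψ) (x : Fin n → I) (y : Fin n → O) {v : Fin n}
    (h0 : ψ 0 = some v) (hn : 2 * r + 2 ≤ n) (H : CenteredLabeledGraph I O) :
    NbhdIso G x y r v H ↔ WindowIso H r (fun i => (ψ i).map fun v => (x v, y v)) := by
  obtain ⟨e, he⟩ := h.exists_equiv_nbhd h0 hn fun v => (x v, y v)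
  refine nbhdIso_iff_windowIso e
    (fun i j => h.adj_iff_of_window hn i.2.1 j.2.1 (he i) (he j)) (fun i => ⟨fun hi => ?_,
    fun hi => ?_⟩) (fun i => by rw [he i, Option.map_some])
  · rw [← Option.some_inj, ← he, hi, h0]
  · refine h.eq_of_abs_sub_lt (he i) (by rw [hi]; exact h0) ?_
    rw [sub_zero]
    exact i.2.1.trans_lt (by omega)

theorem mem_sol_iff {P : LabelingProblem I O} {Δ : ℕ} (hΔ : 2 ≤ Δ) (hS : P.IsCheckedBy S r Δ)
    (h : IsChart G ψ) (x : Fin n → I) (y : Fin n → O) (hn : 2 * r + 2 ≤ n) :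
    y ∈ P.sol G x ↔ ∀ p, WindowOK S r (fun i => (ψ (p + i)).map fun v => (x v, y v)) := by
  rw [hS n G x (h.degreeAtMost hΔ) y]
  have hlocal {p : ℤ} {v : Fin n} (hp : ψ p = some v) : (∃ H ∈ S, NbhdIso G x y r v H) ↔
      WindowOK S r (fun i => (ψ (p + i)).map fun v => (x v, y v)) := by
    have h0 : shiftBy ψ p 0 = some v := by rwa [shiftBy_apply, add_zero]
    simp only [(h.recenter p).nbhdIso_iff x y h0 hn, WindowOK, add_zero, hp, Option.map_some,
      reduceCtorEq, false_or, shiftBy_apply]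
  constructor
  · intro hv p
    rcases hp : ψ p with _ | v
    · exact .of_eq_none (by simp [hp])
    · exact (hlocal hp).1 (hv v)
  · intro hall v
    obtain ⟨p, hp⟩ := h.surj v
    exact (hlocal hp).2 (hall p)

end IsChart

/-! ### Labelings as runs of an automaton -/

/-- The labels at the `d` positions from `a` on. -/
def labelsAt {Λ : Type*} (d : ℕ) (y : ℤ → Λ) (a : ℤ) : Fin d → Λ := fun j => y (a + (j : ℕ))

/-- The factor of length `k` of the two-sided infinite word `X` that starts at `a`. -/
def factor {I : Type*} (X : ℤ → I) (a : ℤ) (k : ℕ) : List I := List.ofFn (labelsAt k X a)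

section factor

variable {I Λ : Type*}

theorem init_labelsAt {d : ℕ} (y : ℤ → Λ) (a : ℤ) :
    Fin.init (labelsAt (d + 1) y a) = labelsAt d y a := by
  funext j
  simp [labelsAt, Fin.init]

theorem tail_labelsAt {d : ℕ} (y : ℤ → Λ) (a : ℤ) :
    Fin.tail (labelsAt (d + 1) y a) = labelsAt d y (a + 1) := by
  funext j
  simp [labelsAt, Fin.tail, add_assoc, add_comm (1 : ℤ)]

theorem labelsAt_congr {d : ℕ} {y y' : ℤ → Λ} {a : ℤ}
    (h : ∀ i, a ≤ i → i < a + d → y i = y' i) : labelsAt d y a = labelsAt d y' a := by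
  funext j
  exact h _ (by omega) (by omega)

theorem labelsAt_eq_iff {d : ℕ} {y y' : ℤ → Λ} {a : ℤ} :
    labelsAt d y a = labelsAt d y' a ↔ ∀ i, a ≤ i → i < a + d → y i = y' i := by
  refine ⟨fun h i hi hi' => ?_, labelsAt_congr⟩
  have := congrFun h ⟨(i - a).toNat, by omega⟩
  rwa [labelsAt, labelsAt, Int.toNat_of_nonneg (by omega), add_sub_cancel] at this

theorem exists_labelsAt_eq_and_eqOn {d : ℕ} (ω : Fin (d + 1) → Λ) {y : ℤ → Λ} {a : ℤ}
    (h : labelsAt d y (a + 1) = Fin.tail ω) :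
    ∃ y', labelsAt (d + 1) y' a = ω ∧ Set.EqOn y' y (Set.Ioi a) := by
  refine ⟨Function.update y a (ω 0), funext fun j => ?_,
    fun i hi => Function.update_of_ne (ne_of_gt hi) _ _⟩
  induction j using Fin.cases with
  | zero => simp [labelsAt]
  | succ j =>
    rw [labelsAt, Function.update_of_ne (by rw [Fin.val_succ]; omega)]
    refine Eq.trans ?_ (congrFun h j)
    rw [labelsAt, Fin.val_succ]
    push_cast
    ring_nf

theorem exists_labelsAt_eq [Nonempty Λ] {d : ℕ} (ω : Fin d → Λ) (a : ℤ) :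
    ∃ y : ℤ → Λ, labelsAt d y a = ω := by
  inhabit Λ
  refine ⟨fun i => if h : 0 ≤ i - a ∧ i - a < d then ω ⟨(i - a).toNat, by omega⟩ else default,
    funext fun j => ?_⟩
  exact (dif_pos (by omega)).trans (by simp)

theorem length_factor (X : ℤ → I) (a : ℤ) (k : ℕ) : (factor X a k).length = k :=
  List.length_ofFn

theorem factor_succ (X : ℤ → I) (a : ℤ) (k : ℕ) :
    factor X a (k + 1) = X a :: factor X (a + 1) k := by
  rw [factor, factor, List.ofFn_succ, ← tail_labelsAt]
  exact congrArg₂ List.cons (by simp [labelsAt]) rfl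

theorem factor_one (X : ℤ → I) (a : ℤ) : factor X a 1 = [X a] :=
  factor_succ X a 0

theorem factor_add (X : ℤ → I) (a : ℤ) (k l : ℕ) :
    factor X a (k + l) = factor X a k ++ factor X (a + k) l := by
  unfold factor labelsAt
  simp [List.ofFn_add, add_assoc]

theorem factor_congr {X X' : ℤ → I} {a : ℤ} {k : ℕ}
    (h : ∀ i, a ≤ i → i < a + k → X i = X' i) : factor X a k = factor X' a k :=
  congrArg List.ofFn (labelsAt_congr h)

theorem labelsAt_shiftBy {d : ℕ} (y : ℤ → Λ) (b a : ℤ) :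
    labelsAt d (shiftBy y b) a = labelsAt d y (b + a) := by
  funext j
  simp only [labelsAt, shiftBy_apply, add_assoc]

theorem factor_shiftBy (X : ℤ → I) (b a : ℤ) (k : ℕ) :
    factor (shiftBy X b) a k = factor X (b + a) k :=
  congrArg List.ofFn (labelsAt_shiftBy X b a)

theorem reverse_factor (X : ℤ → I) (a : ℤ) (k : ℕ) :
    (factor X a k).reverse = factor (fun i => X (-i)) (-(a + k) + 1) k := by
  induction k generalizing a with
  | zero => rfl
  | succ k ih =>
    rw [factor_succ, List.reverse_cons, ih, factor_add _ _ k 1, factor_one]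
    congr 2
    · push_cast
      ring
    · congr 1
      push_cast
      ring

end factor

section automaton

variable {I O : Type*}

/-- The labels of `2 * r + 1` consecutive positions. -/
abbrev State (I O : Type*) (r : ℕ) : Type _ := Fin (2 * r + 1) → Option (I × O)

variable (S : Set (CenteredLabeledGraph I O)) (r : ℕ)

/-- Among `2 * r + 2` consecutive labels, those around the two middle positions are allowed. -/
def PairOK (ω : Fin (2 * r + 1 + 1) → Option (I × O)) : Prop :=
  ∃ y : ℤ → Option (I × O), labelsAt _ y 0 = ω ∧ WindowOK S r (fun i => y (r + i)) ∧
    WindowOK S r (fun i => y (r + 1 + i))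

/-- The automaton moves by one position and reads the input of the new position. -/
def Step (p : State I O r) (a : I) (q : State I O r) : Prop :=
  ∃ ω : Fin (2 * r + 1 + 1) → Option (I × O), PairOK S r ω ∧ Fin.init ω = p ∧ Fin.tail ω = q ∧
    ∃ o, ω (Fin.last _) = some (a, o)

/-- The automaton can go from `p` to `q` by reading a word. -/
def Reach : State I O r → List I → State I O r → Prop
  | p, [], q => p = q
  | p, a :: w, q => ∃ p', Step S r p a p' ∧ Reach p' w q

variable {S r}

theorem pairOK_labelsAt {y : ℤ → Option (I × O)} {a : ℤ} : PairOK S r (labelsAt _ y a) ↔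
    WindowOK S r (fun i => y (a + r + i)) ∧ WindowOK S r (fun i => y (a + r + 1 + i)) := by
  constructor
  · rintro ⟨y', h, hmid, hmid'⟩
    have hy' (i : ℤ) (h0 : 0 ≤ i) (hi : i < 2 * r + 2) : y' i = y (a + i) := by
      simpa [labelsAt, Int.toNat_of_nonneg h0] using congrFun h ⟨i.toNat, by omega⟩
    refine ⟨hmid.congr fun i hi => ?_, hmid'.congr fun i hi => ?_⟩
    · rw [abs_le] at hi
      rw [hy' _ (by omega) (by omega), add_assoc]
    · rw [abs_le] at hi
      rw [hy' _ (by omega) (by omega), add_assoc, add_assoc, add_assoc]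
  · rintro ⟨hmid, hmid'⟩
    refine ⟨fun i => y (a + i), ?_, by simpa only [add_assoc] using hmid,
      by simpa only [add_assoc] using hmid'⟩
    unfold labelsAt
    simp only [zero_add]

theorem reach_append {p q : State I O r} {w w' : List I} :
    Reach S r p (w ++ w') q ↔ ∃ m, Reach S r p w m ∧ Reach S r m w' q := by
  induction w generalizing p with
  | nil => simp [Reach]
  | cons a w ih =>
    simp only [List.cons_append, Reach, ih]
    constructor
    · rintro ⟨p', h, m, hpm, hmq⟩
      exact ⟨m, ⟨p', h, hpm⟩, hmq⟩
    · rintro ⟨m, ⟨p', h, hpm⟩, hmq⟩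
      exact ⟨p', h, m, hpm, hmq⟩

variable (S r) in
/-- From position `i`, the automaton can follow the labeling `y` of the inputs `X` by one step. -/
def Follows (X : ℤ → I) (y : ℤ → Option (I × O)) (i : ℤ) : Prop :=
  PairOK S r (labelsAt _ y i) ∧ ∃ o, y (i + (2 * r + 1 : ℕ)) = some (X (i + (2 * r + 1 : ℕ)), o)

theorem Follows.congr {X : ℤ → I} {y y' : ℤ → Option (I × O)} {a i : ℤ} (h : Follows S r X y i)
    (hyy' : Set.EqOn y' y (Set.Ioi a)) (hi : a < i) : Follows S r X y' i := by
  rw [Follows, labelsAt_congr fun j hj _ => hyy' (show a < j by omega),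
    hyy' (show a < i + (2 * r + 1 : ℕ) by omega)]
  exact h

theorem reach_of_follows {X : ℤ → I} {y : ℤ → Option (I × O)} {a : ℤ} {k : ℕ}
    (h : ∀ i, a ≤ i → i < a + k → Follows S r X y i) :
    Reach S r (labelsAt _ y a) (factor X (a + (2 * r + 1 : ℕ)) k) (labelsAt _ y (a + k)) := by
  induction k generalizing a with
  | zero => simp [Reach, factor]
  | succ k ih =>
    obtain ⟨hpair, hlast⟩ := h a le_rfl (by push_cast; omega)
    have hrest := ih (a := a + 1) fun i hi hi' => h i (by omega) (by push_cast; omega)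
    rw [add_right_comm, add_assoc a 1, add_comm (1 : ℤ)] at hrest
    rw [factor_succ]
    refine ⟨labelsAt _ y (a + 1),
      ⟨labelsAt _ y a, hpair, init_labelsAt y a, tail_labelsAt y a, ?_⟩, by exact_mod_cast hrest⟩
    simpa [labelsAt] using hlast

theorem exists_follows_of_reach {X : ℤ → I} {a : ℤ} {k : ℕ} {p q : State I O r}
    (h : Reach S r p (factor X (a + (2 * r + 1 : ℕ)) k) q) :
    ∃ y : ℤ → Option (I × O), labelsAt _ y a = p ∧ labelsAt _ y (a + k) = q ∧
      ∀ i, a ≤ i → i < a + k → Follows S r X y i := by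
  induction k generalizing a p with
  | zero =>
    obtain ⟨y, hy⟩ := exists_labelsAt_eq p a
    exact ⟨y, hy, by simpa using hy.trans h, fun i hi hi' => by push_cast at hi'; omega⟩
  | succ k ih =>
    rw [factor_succ] at h
    obtain ⟨p', ⟨ω, hpair, rfl, rfl, o, ho⟩, hrest⟩ := h
    rw [add_right_comm a] at hrest
    obtain ⟨y', hp, hq, hy'⟩ := ih hrest
    obtain ⟨y, rfl, hyy'⟩ := exists_labelsAt_eq_and_eqOn ω hp
    refine ⟨y, (init_labelsAt y a).symm, ?_, fun i hi hi' => ?_⟩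
    · rw [← hq, labelsAt_congr fun i hi _ => hyy' (show a < i by push_cast at hi; omega)]
      congr 1
      push_cast
      ring
    · rcases hi.eq_or_lt with rfl | hai
      · exact ⟨hpair, o, by simpa [labelsAt] using ho⟩
      · exact (hy' i (by omega) (by push_cast at hi'; omega)).congr hyy' hai

theorem windowOK_of_follows {X : ℤ → I} {y : ℤ → Option (I × O)} {a : ℤ} {k : ℕ} (hk : 0 < k)
    (hy : ∀ i, a ≤ i → i < a + k → Follows S r X y i) {c : ℤ} (hac : a + r ≤ c)
    (hc : c ≤ a + k + r) : WindowOK S r (shiftBy y c) := by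
  by_cases hck : c < a + k + r
  · have := (pairOK_labelsAt.1 (hy (c - r) (by omega) (by omega)).1).1
    rwa [sub_add_cancel] at this
  · have := (pairOK_labelsAt.1 (hy (c - r - 1) (by omega) (by omega)).1).2
    rwa [sub_right_comm, sub_add_cancel, sub_add_cancel] at this

/-! ### Types of words -/

/-- The possible effects of a word and of its reversal on states. -/
abbrev EffectPair (I O : Type*) (r : ℕ) : Type _ :=
  Set (State I O r × State I O r) × Set (State I O r × State I O r)

variable (S r) in
/-- The effect of a word read in both directions. -/
def effect (w : List I) : EffectPair I O r :=
  ({pq | Reach S r pq.1 w pq.2}, {pq | Reach S r pq.1 w.reverse pq.2})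

theorem reach_congr {w w' : List I} (h : effect S r w = effect S r w') {p q : State I O r} :
    Reach S r p w q ↔ Reach S r p w' q :=
  Set.ext_iff.1 (congrArg Prod.fst h) (p, q)

theorem reach_reverse_congr {w w' : List I} (h : effect S r w = effect S r w')
    {p q : State I O r} : Reach S r p w.reverse q ↔ Reach S r p w'.reverse q :=
  Set.ext_iff.1 (congrArg Prod.snd h) (p, q)

variable (S r) in
/-- The automaton whose state after reading a word is the effect of the word. -/
def effectDFA : DFA I (EffectPair I O r) where
  step T a := ({pq | ∃ m, (pq.1, m) ∈ T.1 ∧ Reach S r m [a] pq.2},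
    {pq | ∃ m, Reach S r pq.1 [a] m ∧ (m, pq.2) ∈ T.2})
  start := effect S r []
  accept := ∅

theorem effectDFA_eval (w : List I) : (effectDFA S r).eval w = effect S r w := by
  induction w using List.reverseRecOn with
  | nil => rfl
  | append_singleton w a ih =>
    rw [DFA.eval_append_singleton, ih]
    ext pq
    · exact reach_append.symm
    · simp only [effect, List.reverse_append, List.reverse_singleton]
      exact reach_append.symm

theorem evalFrom_flatten_replicate {α σ : Type*} (M : DFA α σ) {q : σ} {w : List α}
    (h : M.evalFrom q w = q) (k : ℕ) : M.evalFrom q (List.replicate k w).flatten = q := by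
  induction k with
  | zero => rfl
  | succ k ih => rw [List.replicate_succ, List.flatten_cons, DFA.evalFrom_of_append, h, ih]

theorem exists_effect_eq_of_card_le_length [Finite I] [Finite O] {w : List I}
    (hw : Nat.card (EffectPair I O r) ≤ w.length) (L : ℕ) :
    ∃ w', effect S r w' = effect S r w ∧ L ≤ w'.length ∧ w'.length ≤ w.length * (L + 1) := by
  have := Fintype.ofFinite (EffectPair I O r)
  rw [Nat.card_eq_fintype_card] at hw
  obtain ⟨q, a, b, c, rfl, -, hb, ha, hq, hc⟩ :=
    (effectDFA S r).evalFrom_split hw (s := (effectDFA S r).start) rfl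
  refine ⟨a ++ (List.replicate L b).flatten ++ c, ?_, ?_, ?_⟩
  · rw [← effectDFA_eval, ← effectDFA_eval]
    change (effectDFA S r).evalFrom _ _ = _
    rw [DFA.evalFrom_of_append, DFA.evalFrom_of_append, ha, evalFrom_flatten_replicate _ hq, hc]
    rfl
  · have : 1 ≤ b.length := List.length_pos_iff.2 hb
    simp only [List.length_append, List.length_flatten, List.map_replicate,
      List.sum_replicate, smul_eq_mul]
    nlinarith
  · simp only [List.length_append, List.length_flatten, List.map_replicate,
      List.sum_replicate, smul_eq_mul]
    nlinarith [Nat.zero_le (a.length * L), Nat.zero_le (c.length * L)]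

/-- A choice of labelings of a patch of `2 * r + 1` nodes, which depends on the inputs of the patch
and on the effects of the two words that leave the patch. -/
abbrev PatchLabeling (I O : Type*) (r : ℕ) : Type _ :=
  EffectPair I O r → (Fin (2 * r + 1) → I) → EffectPair I O r → Set (State I O r)

variable (S r) in
/-- The combinatorial condition that characterizes the easy problems: far apart patches can be
labeled independently such that the labelings of any two consecutive patches, and, if `paths` holds,
of an end of the path and a patch, can be completed in between. -/
structure IsPatchLabeling (paths : Prop) (L : PatchLabeling I O r) : Prop where
  nonempty : ∀ (v w : List I) (u), v.length = Nat.card (EffectPair I O r) →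
    w.length = Nat.card (EffectPair I O r) → (L (effect S r v) u (effect S r w)).Nonempty
  input : ∀ α u β, ∀ p ∈ L α u β, ∀ j, ∃ o, p j = some (u j, o)
  rev : ∀ α u β, ∀ p ∈ L α u β, p ∘ Fin.rev ∈ L β (u ∘ Fin.rev) α
  join : ∀ α u v w u' β, ∀ p ∈ L α u (effect S r v), ∀ q ∈ L (effect S r w) u' β, ∀ m,
    Reach S r p (v ++ m ++ w.reverse ++ List.ofFn u') q
  join_end : paths → ∀ w u β, ∀ q ∈ L (effect S r w) u β, ∀ m,
    Reach S r (fun _ => none) (m ++ w.reverse ++ List.ofFn u) q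

end automaton

/-! ### Local rules -/

/-- A function of labeled two-sided infinite sequences that depends only on the radius-`ρ` window
around `0` and not on the direction. -/
structure IsRule {α β : Type*} (ρ : ℕ) (Y : (ℤ → Option α) → β) : Prop where
  congr : ∀ ⦃z z' : ℤ → Option α⦄, (∀ i : ℤ, |i| ≤ ρ → z i = z' i) → Y z = Y z'
  comp_neg : ∀ z, Y (fun i => z (-i)) = Y z

section IsRule

variable {α β γ δ : Type*} {ρ σ : ℕ}

theorem IsRule.of_le [PartialOrder β] {Y : (ℤ → Option α) → β}
    (hcongr : ∀ ⦃z z' : ℤ → Option α⦄, (∀ i : ℤ, |i| ≤ ρ → z i = z' i) → Y z ≤ Y z')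
    (hneg : ∀ z, Y z ≤ Y (fun i => z (-i))) : IsRule ρ Y where
  congr _ _ h := le_antisymm (hcongr h) (hcongr fun i hi => (h i hi).symm)
  comp_neg z := le_antisymm (by simpa only [neg_neg] using hneg fun i => z (-i)) (hneg z)

theorem IsRule.mono {Y : (ℤ → Option α) → β} (h : IsRule ρ Y) (hρσ : ρ ≤ σ) : IsRule σ Y where
  congr _ _ hz := h.congr fun i hi => hz i (hi.trans (by exact_mod_cast hρσ))
  comp_neg := h.comp_neg

theorem IsRule.comp {Y : (ℤ → Option α) → β} {Z : (ℤ → Option γ) → δ} (hZ : IsRule σ Z)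
    (hY : IsRule ρ Y) (f : α → β → γ) :
    IsRule (σ + ρ) (fun z => Z fun i => (z i).map fun a => f a (Y (shiftBy z i))) where
  congr z z' h := hZ.congr fun i hi => by
    rw [h i (hi.trans (by simp)), hY.congr (shiftBy_congr h (by push_cast; omega))]
  comp_neg z := by
    refine Eq.trans (congrArg Z (funext fun i => ?_)) (hZ.comp_neg _)
    rw [shiftBy_comp_neg, hY.comp_neg]

end IsRule

/-! ### Patches around marked nodes -/

/-- Some element of `s`, which depends only on `s`; it is arbitrary if `s` is empty. -/
noncomputable def pick {α : Type*} [Nonempty α] (s : Set α) : α := Classical.epsilon (· ∈ s)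

theorem pick_mem {α : Type*} [Nonempty α] {s : Set α} (h : s.Nonempty) : pick s ∈ s :=
  Classical.epsilon_spec h

theorem pick_singleton {α : Type*} [Nonempty α] (a : α) : pick {a} = a :=
  pick_mem (Set.singleton_nonempty a)

/-- What a node knows: a name that is unique nearby, its input, and whether it belongs to a
distinguished sparse set of nodes. -/
structure NodeInfo (I : Type*) where
  name : ℕ
  input : I
  chosen : Prop

theorem exists_forall_name_eq {I O : Type*} [Nonempty O] {z : ℤ → Option (NodeInfo I)} {s : Set ℤ}
    (hs : ∀ i ∈ s, ∀ j ∈ s, ∀ a b, z i = some a → z j = some b → a.name = b.name → i = j)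
    (o : ℤ → O) : ∃ g : ℕ → O, ∀ i ∈ s, ∀ a, z i = some a → g a.name = o i := by
  classical
  refine ⟨fun m => if h : ∃ i ∈ s, ∃ a, z i = some a ∧ a.name = m then o h.choose
    else Classical.arbitrary O, fun i hi a ha => ?_⟩
  have hex : ∃ j ∈ s, ∃ b, z j = some b ∧ b.name = a.name := ⟨i, hi, a, ha, rfl⟩
  refine (dif_pos hex).trans ?_
  obtain ⟨hj, b, hb, hba⟩ := hex.choose_spec
  rw [hs _ hj i hi b a hb ha hba]

/-- The node at `0` is chosen and farther than `k` from the ends of the path. -/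
def Marked {I : Type*} (k : ℕ) (z : ℤ → Option (NodeInfo I)) : Prop :=
  (∃ a, z 0 = some a ∧ a.chosen) ∧ ∀ j : ℤ, |j| ≤ k → z j ≠ none

theorem isRule_marked {I : Type*} (k : ℕ) : IsRule k (Marked (I := I) k) := by
  refine .of_le (fun z z' h => ?_) fun z => ?_
  · rintro ⟨h0, hk⟩
    exact ⟨by rwa [← h 0 (by simp)], fun j hj => by rw [← h j hj]; exact hk j hj⟩
  · rintro ⟨h0, hk⟩
    exact ⟨by simpa only [neg_zero] using h0, fun j hj => hk (-j) (by rwa [abs_neg])⟩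

theorem Marked.ne_none {I : Type*} {k : ℕ} {z : ℤ → Option (NodeInfo I)} {m i : ℤ}
    (h : Marked k (shiftBy z m)) (hi : |i - m| ≤ k) : z i ≠ none := by
  simpa only [shiftBy_apply, add_sub_cancel] using h.2 (i - m) hi

/-- The inputs of a sequence. -/
noncomputable def inputs {I : Type*} [Nonempty I] (z : ℤ → Option (NodeInfo I)) (i : ℤ) : I :=
  (z i).elim (Classical.arbitrary I) NodeInfo.input

section patch

variable {I O : Type*} (S : Set (CenteredLabeledGraph I O)) (r : ℕ) (L : PatchLabeling I O r)
  (κ B : ℕ)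

/-- The labelings that `L` allows for the patch around position `m` of the word `X`, where the words
of length `κ` that leave the patch are taken into account. -/
def patchStates (X : ℤ → I) (m : ℤ) : Set (State I O r) :=
  L (effect S r (factor X (m - r - κ) κ).reverse) (labelsAt _ X (m - r))
    (effect S r (factor X (m + r + 1) κ))

variable {S r L κ} in
theorem patchStates_shiftBy (X : ℤ → I) (p m : ℤ) :
    patchStates S r L κ (shiftBy X p) m = patchStates S r L κ X (p + m) := by
  simp only [patchStates, factor_shiftBy, labelsAt_shiftBy, ← add_sub_assoc, ← add_assoc]

variable {S r L κ} in
theorem patchStates_congr {X X' : ℤ → I} {m : ℤ} (h : ∀ i : ℤ, |i - m| ≤ (r + κ : ℕ) → X i = X' i) :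
    patchStates S r L κ X m = patchStates S r L κ X' m := by
  have hX (i : ℤ) (hi : m - r - κ ≤ i) (hi' : i < m + r + 1 + κ) : X i = X' i :=
    h i (by rw [abs_le]; omega)
  rw [patchStates, patchStates,
    factor_congr fun i hi hi' => hX i (by omega) (by omega),
    factor_congr (a := m + r + 1) fun i hi hi' => hX i (by omega) (by omega),
    labelsAt_congr fun i hi hi' => hX i (by omega) (by push_cast at hi'; omega)]

theorem labelsAt_comp_rev {Λ : Type*} {r : ℕ} (y : ℤ → Λ) (m : ℤ) :
    labelsAt (2 * r + 1) y (m - r) ∘ Fin.rev =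
      labelsAt (2 * r + 1) (fun i => y (-i)) (-m - r) := by
  funext j
  simp only [Function.comp_apply, labelsAt, Fin.val_rev]
  congr 1
  omega

variable {S r L κ} in
theorem IsPatchLabeling.comp_rev_mem_patchStates {b : Prop} (hL : IsPatchLabeling S r b L)
    {X : ℤ → I} {m : ℤ} {p : State I O r} (hp : p ∈ patchStates S r L κ X m) :
    p ∘ Fin.rev ∈ patchStates S r L κ (fun i => X (-i)) (-m) := by
  have hrev := hL.rev _ _ _ p hp
  rw [labelsAt_comp_rev, reverse_factor] at hrev
  rw [patchStates, reverse_factor]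
  simp only [neg_neg]
  convert hrev using 5
  · ring
  · ring

variable {S r L κ} in
theorem IsPatchLabeling.patchStates_nonempty {b : Prop} (hL : IsPatchLabeling S r b L)
    (hκ : κ = Nat.card (EffectPair I O r)) (X : ℤ → I) (m : ℤ) :
    (patchStates S r L κ X m).Nonempty :=
  hL.nonempty _ _ _ (by rw [List.length_reverse, length_factor, hκ]) (by rw [length_factor, hκ])

variable {S r L κ} in
theorem IsPatchLabeling.reach_of_mem_patchStates {b : Prop} (hL : IsPatchLabeling S r b L)
    {X : ℤ → I} {m₁ m₂ : ℤ} {k : ℕ} (hm : m₂ = m₁ + k) (hk : 2 * r + 1 + 2 * κ ≤ k)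
    {p q : State I O r} (hp : p ∈ patchStates S r L κ X m₁) (hq : q ∈ patchStates S r L κ X m₂) :
    Reach S r p (factor X (m₁ + r + 1) k) q := by
  obtain ⟨l, rfl⟩ := Nat.exists_eq_add_of_le hk
  have hjoin := hL.join _ _ _ _ _ _ p hp q hq (factor X (m₁ + r + 1 + κ) l)
  rw [List.reverse_reverse] at hjoin
  rw [show 2 * r + 1 + 2 * κ + l = κ + l + κ + (2 * r + 1) by ring, factor_add, factor_add,
    factor_add]
  push_cast at hm
  convert hjoin using 4
  · push_cast
    omega
  · rw [factor]
    congr 2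
    push_cast
    omega

variable {S r L κ} in
theorem IsPatchLabeling.reach_none_of_mem_patchStates {b : Prop} (hL : IsPatchLabeling S r b L)
    (hb : b) {X : ℤ → I} {a m : ℤ} {k : ℕ} (hm : m + r + 1 = a + k) (hk : 2 * r + 1 + κ ≤ k)
    {q : State I O r} (hq : q ∈ patchStates S r L κ X m) :
    Reach S r (fun _ => none) (factor X a k) q := by
  obtain ⟨l, rfl⟩ := Nat.exists_eq_add_of_le hk
  have hjoin := hL.join_end hb _ _ _ q hq (factor X a l)
  rw [List.reverse_reverse] at hjoin
  rw [show 2 * r + 1 + κ + l = l + κ + (2 * r + 1) by ring, factor_add, factor_add]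
  push_cast at hm
  convert hjoin using 4
  · omega
  · rw [factor]
    congr 2
    push_cast
    omega

variable [Nonempty I]

/-- The allowed labelings of the patch around `0`, as functions of the names. -/
def patchSet (z : ℤ → Option (NodeInfo I)) : Set (ℕ → O) :=
  {g | labelsAt _ (fun i => (z i).map fun a => (a.input, g a.name)) (-r) ∈
    patchStates S r L κ (inputs z) 0}

variable {S r L κ} in
theorem isRule_patchSet {b : Prop} (hL : IsPatchLabeling S r b L) :
    IsRule (r + κ) (patchSet S r L κ) := by
  refine .of_le (fun z z' h g hg => ?_) fun z g hg => ?_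
  · rw [patchSet, Set.mem_ofPred_eq] at hg ⊢
    rw [patchStates_congr (X' := inputs z) fun i hi => by
      rw [sub_zero] at hi
      rw [inputs, inputs, h i hi]]
    convert hg using 1
    refine labelsAt_congr fun i hi hi' => ?_
    rw [h i (by rw [abs_le]; push_cast at hi' ⊢; omega)]
  · have hrev := hL.comp_rev_mem_patchStates hg
    rw [← zero_sub (r : ℤ), labelsAt_comp_rev, neg_zero, zero_sub] at hrev
    exact hrev

variable [Nonempty O]

/-- The labels that the node at `0` gets from patches. -/
def patchLabel (z : ℤ → Option (NodeInfo I)) : Set O :=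
  {o | ∃ j : ℤ, |j| ≤ r ∧ Marked (r + κ) (shiftBy z j) ∧
    ∃ a, z 0 = some a ∧ o = pick (patchSet S r L κ (shiftBy z j)) a.name}

open scoped Classical in
/-- The output of the node at `0` if all nodes outside patches use `g`, which assigns outputs to
names. -/
noncomputable def patchedOutput (z : ℤ → Option (NodeInfo I)) (g : ℕ → O) (a : NodeInfo I) : O :=
  if (patchLabel S r L κ z).Nonempty then pick (patchLabel S r L κ z) else g a.name

/-- The labeling in which all nodes outside patches use `g`, which assigns outputs to names. -/
noncomputable def patchedLabeling (z : ℤ → Option (NodeInfo I)) (g : ℕ → O) (i : ℤ) :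
    Option (I × O) :=
  (z i).map fun a => (a.input, patchedOutput S r L κ (shiftBy z i) g a)

/-- The ways to label the names such that the block that contains `0`, i.e. the part between two
consecutive marked nodes, is labeled correctly. -/
def blockSet (z : ℤ → Option (NodeInfo I)) : Set (ℕ → O) :=
  {g | ∀ i : ℤ, |i| ≤ B → z i ≠ none →
    (∀ j, 0 < j ∧ j < i ∨ i < j ∧ j < 0 → ¬ Marked (r + κ) (shiftBy z j)) →
    WindowOK S r (shiftBy (patchedLabeling S r L κ z g) i)}

/-- The output of the node at `0`. -/
noncomputable def fillOutput (z : ℤ → Option (NodeInfo I)) (a : NodeInfo I) : O :=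
  patchedOutput S r L κ z (pick (blockSet S r L κ B z)) a

/-- The labeling that results from completing the labelings of all patches. -/
noncomputable def filledLabeling (z : ℤ → Option (NodeInfo I)) (i : ℤ) : Option (I × O) :=
  (z i).map fun a => (a.input, fillOutput S r L κ B (shiftBy z i) a)

variable {S r L κ B} {z : ℤ → Option (NodeInfo I)}

theorem patchLabel_nonempty_iff {i : ℤ} (hi : z i ≠ none) :
    (patchLabel S r L κ (shiftBy z i)).Nonempty ↔
      ∃ m, |m - i| ≤ r ∧ Marked (r + κ) (shiftBy z m) := by
  obtain ⟨a, ha⟩ := Option.ne_none_iff_exists'.1 hi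
  constructor
  · rintro ⟨o, j, hj, hm, -⟩
    exact ⟨i + j, by rwa [add_sub_cancel_left], by rwa [shiftBy_shiftBy] at hm⟩
  · rintro ⟨m, hmi, hm⟩
    exact ⟨_, m - i, hmi, by rwa [shiftBy_shiftBy, add_sub_cancel], a,
      by rwa [shiftBy_apply, add_zero], rfl⟩

theorem patchedLabeling_shiftBy (z : ℤ → Option (NodeInfo I)) (g : ℕ → O) (p : ℤ) :
    patchedLabeling S r L κ (shiftBy z p) g = shiftBy (patchedLabeling S r L κ z g) p := by
  funext i
  simp only [patchedLabeling, shiftBy_apply, shiftBy_shiftBy]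

theorem filledLabeling_shiftBy (z : ℤ → Option (NodeInfo I)) (p : ℤ) :
    filledLabeling S r L κ B (shiftBy z p) = shiftBy (filledLabeling S r L κ B z) p := by
  funext i
  simp only [filledLabeling, shiftBy_apply, shiftBy_shiftBy]

theorem isRule_patchLabel {b : Prop} (hL : IsPatchLabeling S r b L) :
    IsRule (2 * r + κ) (patchLabel S r L κ) := by
  refine .of_le (fun z z' h => ?_) fun z => ?_
  · rintro _ ⟨j, hj, hm, a, ha, rfl⟩
    have hshift := shiftBy_congr (σ := r + κ) h (p := j) (by push_cast; omega)
    exact ⟨j, hj, (isRule_marked _).congr hshift ▸ hm, a, by rw [← h 0 (by simp; omega), ha],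
      by rw [(isRule_patchSet hL).congr hshift]⟩
  · rintro _ ⟨j, hj, hm, a, ha, rfl⟩
    refine ⟨-j, by rwa [abs_neg], ?_, a, by simpa only [neg_zero] using ha, ?_⟩
    · rwa [shiftBy_comp_neg, (isRule_marked _).comp_neg, neg_neg]
    · rw [shiftBy_comp_neg, (isRule_patchSet hL).comp_neg, neg_neg]

theorem isRule_patchedOutput {b : Prop} (hL : IsPatchLabeling S r b L) :
    IsRule (2 * r + κ) (patchedOutput S r L κ) where
  congr z z' h := by
    funext g a
    rw [patchedOutput, patchedOutput, (isRule_patchLabel hL).congr h]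
  comp_neg z := by
    funext g a
    rw [patchedOutput, patchedOutput, (isRule_patchLabel hL).comp_neg]

theorem patchedLabeling_congr {b : Prop} (hL : IsPatchLabeling S r b L)
    {z z' : ℤ → Option (NodeInfo I)} {ρ : ℕ} (h : ∀ i : ℤ, |i| ≤ ρ → z i = z' i) (g : ℕ → O) {i : ℤ}
    (hi : |i| + 2 * r + κ ≤ ρ) :
    patchedLabeling S r L κ z g i = patchedLabeling S r L κ z' g i := by
  rw [patchedLabeling, patchedLabeling, h i (by omega), (isRule_patchedOutput hL).congr
    (shiftBy_congr h (by push_cast; omega))]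

theorem patchedLabeling_comp_neg {b : Prop} (hL : IsPatchLabeling S r b L)
    (z : ℤ → Option (NodeInfo I)) (g : ℕ → O) (i : ℤ) :
    patchedLabeling S r L κ (fun j => z (-j)) g i = patchedLabeling S r L κ z g (-i) := by
  rw [patchedLabeling, patchedLabeling, shiftBy_comp_neg, (isRule_patchedOutput hL).comp_neg]

theorem isRule_blockSet {b : Prop} (hL : IsPatchLabeling S r b L) :
    IsRule (B + 3 * r + κ) (blockSet S r L κ B) := by
  refine .of_le (fun z z' h g hg i hi hz hm => ?_) fun z g hg i hi hz hm => ?_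
  · rw [← h i (by push_cast; omega)] at hz
    refine (hg i hi hz fun j hj hjm => hm j hj ?_).congr fun j hj =>
      patchedLabeling_congr hL h g ?_
    · have : |j| ≤ B := by
        rw [abs_le] at hi ⊢
        omega
      rwa [← (isRule_marked _).congr (shiftBy_congr h (by push_cast; omega))]
    · have := abs_add_le i j
      push_cast
      omega
  · refine (hg (-i) (by rwa [abs_neg]) hz fun j hj hjm => hm (-j) (by omega) ?_).neg.congr
      fun j _ => ?_
    · rwa [shiftBy_comp_neg, (isRule_marked _).comp_neg, neg_neg]
    · rw [shiftBy_apply, shiftBy_apply, patchedLabeling_comp_neg hL, neg_add]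

theorem isRule_fillOutput {b : Prop} (hL : IsPatchLabeling S r b L) :
    IsRule (B + 3 * r + κ) (fillOutput S r L κ B) where
  congr z z' h := by
    funext a
    rw [fillOutput, fillOutput, (isRule_blockSet hL).congr h,
      ((isRule_patchedOutput hL).mono (by omega)).congr h]
  comp_neg z := by
    funext a
    rw [fillOutput, fillOutput, (isRule_blockSet hL).comp_neg, (isRule_patchedOutput hL).comp_neg]

theorem filledLabeling_comp_neg {b : Prop} (hL : IsPatchLabeling S r b L)
    (z : ℤ → Option (NodeInfo I)) (i : ℤ) :
    filledLabeling S r L κ B (fun j => z (-j)) i = filledLabeling S r L κ B z (-i) := by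
  rw [filledLabeling, filledLabeling, shiftBy_comp_neg, (isRule_fillOutput hL).comp_neg]

end patch

section block

variable {I O : Type*} [Nonempty I] [Nonempty O] {S : Set (CenteredLabeledGraph I O)} {r : ℕ}
  {L : PatchLabeling I O r} {κ B : ℕ} {z : ℤ → Option (NodeInfo I)} {a : ℤ} {k : ℕ}

variable (S r L κ B) in
/-- The positions from `a` to `a + k + 2 * r` form a block: the first and the last `2 * r + 1` of
them belong to patches or lie beyond the end of the path, and the nodes in between have to complete
the labeling of these two segments; `visible` says that each of these nodes sees the whole block. -/
structure IsBlock (z : ℤ → Option (NodeInfo I)) (a : ℤ) (k : ℕ) : Prop where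
  ends : ∀ i, a ≤ i ∧ i ≤ a + 2 * r ∨ a + k ≤ i ∧ i ≤ a + k + 2 * r →
    z i = none ∨ (patchLabel S r L κ (shiftBy z i)).Nonempty
  mid : ∀ i, a + 2 * r < i → i < a + k →
    z i ≠ none ∧ ¬ (patchLabel S r L κ (shiftBy z i)).Nonempty
  inj : ∀ i ∈ Set.Icc a (a + k + 2 * r), ∀ j ∈ Set.Icc a (a + k + 2 * r), ∀ b c,
    z i = some b → z j = some c → b.name = c.name → i = j
  visible : ∀ l, a + 2 * r < l → l < a + k → ∀ i, z i ≠ none →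
    ((|i - l| ≤ B ∧ ∀ j, l < j ∧ j < i ∨ i < j ∧ j < l → ¬ Marked (r + κ) (shiftBy z j)) ↔
      a + r ≤ i ∧ i ≤ a + k + r)
  reach : ∀ g, Reach S r (labelsAt _ (patchedLabeling S r L κ z g) a)
    (factor (inputs z) (a + (2 * r + 1 : ℕ)) k) (labelsAt _ (patchedLabeling S r L κ z g) (a + k))

theorem patchedLabeling_eq_of_patchLabel {i : ℤ}
    (hi : z i = none ∨ (patchLabel S r L κ (shiftBy z i)).Nonempty) (g g' : ℕ → O) :
    patchedLabeling S r L κ z g i = patchedLabeling S r L κ z g' i := by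
  rcases hi with hi | hi <;> simp [patchedLabeling, patchedOutput, hi]

namespace IsBlock

variable (h : IsBlock S r L κ B z a k)
include h

theorem exists_windowOK_patchedLabeling (hk : 0 < k) : ∃ g, ∀ c, a + r ≤ c → c ≤ a + k + r →
    WindowOK S r (shiftBy (patchedLabeling S r L κ z g) c) := by
  obtain ⟨g₀⟩ : Nonempty (ℕ → O) := inferInstance
  obtain ⟨y, hya, hyk, hy⟩ := exists_follows_of_reach (h.reach g₀)
  obtain ⟨g, hg⟩ := exists_forall_name_eq h.inj
    fun i => (y i).elim (Classical.arbitrary O) Prod.snd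
  have hyg (i : ℤ) (hi : a ≤ i) (hi' : i ≤ a + k + 2 * r) :
      y i = patchedLabeling S r L κ z g i := by
    by_cases hstart : i ≤ a + 2 * r
    · rw [patchedLabeling_eq_of_patchLabel (h.ends i (by omega)) g g₀]
      exact labelsAt_eq_iff.1 hya i hi (by push_cast; omega)
    by_cases hend : a + k ≤ i
    · rw [patchedLabeling_eq_of_patchLabel (h.ends i (by omega)) g g₀]
      exact labelsAt_eq_iff.1 hyk i hend (by push_cast; omega)
    obtain ⟨hzi, hpatch⟩ := h.mid i (by omega) (by omega)
    obtain ⟨b, hb⟩ := Option.ne_none_iff_exists'.1 hzi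
    obtain ⟨-, o, ho⟩ := hy (i - (2 * r + 1 : ℕ)) (by push_cast; omega) (by push_cast; omega)
    rw [sub_add_cancel] at ho
    simp [patchedLabeling, patchedOutput, hpatch, hb, ho, hg i ⟨hi, hi'⟩ b hb, inputs]
  refine ⟨g, fun c hac hc => (windowOK_of_follows hk hy hac hc).congr fun j hj => ?_⟩
  rw [abs_le] at hj
  exact hyg (c + j) (by omega) (by omega)

theorem blockSet_eq {l : ℤ} (hal : a + 2 * r < l) (hl : l < a + k) :
    blockSet S r L κ B (shiftBy z l) = {g | ∀ i, z i ≠ none → a + r ≤ i ∧ i ≤ a + k + r →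
      WindowOK S r (shiftBy (patchedLabeling S r L κ z g) i)} := by
  ext g
  simp only [blockSet, patchedLabeling_shiftBy, shiftBy_shiftBy, Set.mem_ofPred_eq, shiftBy_apply]
  constructor
  · intro hg i hzi hi
    obtain ⟨hB, hmarked⟩ := (h.visible l hal hl i hzi).2 hi
    have := hg (i - l) hB (by rwa [add_sub_cancel]) fun j hj => hmarked (l + j) (by omega)
    rwa [add_sub_cancel] at this
  · intro hg i hi hzi hm
    refine hg (l + i) hzi ((h.visible l hal hl _ hzi).1
      ⟨by rwa [add_sub_cancel_left], fun j hj => ?_⟩)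
    have := hm (j - l) (by omega)
    rwa [add_sub_cancel] at this

theorem windowOK_filledLabeling (hk : 0 < k) {c : ℤ} (hac : a + r ≤ c) (hc : c ≤ a + k + r) :
    WindowOK S r (shiftBy (filledLabeling S r L κ B z) c) := by
  rcases hzc : z c with _ | b
  · exact .of_eq_none (by simp [shiftBy_apply, filledLabeling, hzc])
  have hne : {g | ∀ i, z i ≠ none → a + r ≤ i ∧ i ≤ a + k + r →
      WindowOK S r (shiftBy (patchedLabeling S r L κ z g) i)}.Nonempty := by
    obtain ⟨g, hg⟩ := h.exists_windowOK_patchedLabeling hk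
    exact ⟨g, fun i _ hi => hg i hi.1 hi.2⟩
  refine (pick_mem hne c (by simp [hzc]) ⟨hac, hc⟩).congr fun j hj => ?_
  rw [abs_le] at hj
  by_cases hmid : a + 2 * r < c + j ∧ c + j < a + k
  · rw [← h.blockSet_eq hmid.1 hmid.2]
    rfl
  · exact patchedLabeling_eq_of_patchLabel (h.ends (c + j) (by omega)) _
      (pick (blockSet S r L κ B (shiftBy z (c + j))))

end IsBlock

section patch_of_marked

variable {b : Prop} (hL : IsPatchLabeling S r b L) (hκ : κ = Nat.card (EffectPair I O r)) {m : ℤ}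
  (hm : Marked (r + κ) (shiftBy z m))

theorem patchLabel_eq_singleton {i : ℤ} (hm : Marked (r + κ) (shiftBy z m))
    (huniq : ∀ j, |j - m| ≤ 2 * r → Marked (r + κ) (shiftBy z j) → j = m)
    (hi : |i - m| ≤ r) {c : NodeInfo I} (hc : z i = some c) :
    patchLabel S r L κ (shiftBy z i) = {pick (patchSet S r L κ (shiftBy z m)) c.name} := by
  ext o
  simp only [patchLabel, shiftBy_shiftBy, shiftBy_apply, add_zero, hc, Option.some_inj,
    exists_eq_left', Set.mem_ofPred_eq, Set.mem_singleton_iff]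
  constructor
  · rintro ⟨j, hj, hjm, rfl⟩
    rw [huniq (i + j) (by rw [abs_le] at *; omega) hjm]
  · rintro rfl
    exact ⟨m - i, by rwa [abs_sub_comm], by rwa [add_sub_cancel], by rw [add_sub_cancel]⟩

include hL hκ hm

theorem patchSet_nonempty_of_marked
    (hinj : ∀ i j, |i - m| ≤ r → |j - m| ≤ r → ∀ b c, z i = some b → z j = some c →
      b.name = c.name → i = j) : (patchSet S r L κ (shiftBy z m)).Nonempty := by
  obtain ⟨p, hp⟩ := hL.patchStates_nonempty hκ (inputs (shiftBy z m)) 0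
  obtain ⟨y, rfl⟩ := exists_labelsAt_eq p (-(r : ℤ))
  obtain ⟨g, hg⟩ := exists_forall_name_eq (s := {i | |i - m| ≤ r})
    (fun i hi j hj => hinj i j hi hj)
    fun i => (y (i - m)).elim (Classical.arbitrary O) Prod.snd
  refine ⟨g, ?_⟩
  rw [patchSet, Set.mem_ofPred_eq]
  convert hp using 1
  funext j
  obtain ⟨o, ho⟩ := hL.input _ _ _ _ hp j
  set i : ℤ := -r + (j : ℕ) with hi
  have him : |m + i - m| ≤ r := by
    rw [abs_le]
    omega
  obtain ⟨c, hc⟩ := Option.ne_none_iff_exists'.1 (hm.ne_none (him.trans (by simp)))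
  have hgc := hg _ him c hc
  rw [labelsAt, ← hi] at ho
  rw [add_sub_cancel_left, ho] at hgc
  rw [labelsAt, labelsAt, ← hi, ho, shiftBy_apply, hc, Option.map_some, hgc]
  simp [labelsAt, inputs, shiftBy_apply, hc, ← hi]

theorem labelsAt_patchedLabeling_mem_patchStates
    (hinj : ∀ i j, |i - m| ≤ r → |j - m| ≤ r → ∀ b c, z i = some b → z j = some c →
      b.name = c.name → i = j)
    (huniq : ∀ j, |j - m| ≤ 2 * r → Marked (r + κ) (shiftBy z j) → j = m) (g : ℕ → O) :
    labelsAt _ (patchedLabeling S r L κ z g) (m - r) ∈ patchStates S r L κ (inputs z) m := by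
  have hpick := pick_mem (patchSet_nonempty_of_marked hL hκ hm hinj)
  change _ ∈ patchStates S r L κ (shiftBy (inputs z) m) 0 at hpick
  rw [patchStates_shiftBy, add_zero] at hpick
  convert hpick using 1
  change _ = labelsAt _ (shiftBy (fun i => (z i).map fun a =>
    (a.input, pick (patchSet S r L κ (shiftBy z m)) a.name)) m) (-r)
  rw [labelsAt_shiftBy, ← sub_eq_add_neg]
  refine labelsAt_congr fun i hi hi' => ?_
  have him : |i - m| ≤ r := by
    push_cast at hi'
    rw [abs_le]
    omega
  obtain ⟨c, hc⟩ := Option.ne_none_iff_exists'.1 (hm.ne_none (him.trans (by simp)))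
  rw [patchedLabeling, hc, Option.map_some, Option.map_some, patchedOutput,
    patchLabel_eq_singleton hm huniq him hc, if_pos (Set.singleton_nonempty _), pick_singleton]

end patch_of_marked

end block

/-! ### Regular sequences -/

/-- A sequence that describes a long path or cycle with names that are distinct in each stretch of
`n` nodes and a maximal set of chosen nodes at pairwise distance more than `k`. -/
structure IsRegularSeq {I : Type*} (n k : ℕ) (z : ℤ → Option (NodeInfo I)) : Prop where
  inj : ∀ i j a b, z i = some a → z j = some b → a.name = b.name → i ≠ j → (n : ℤ) ≤ |i - j|
  conv : ∀ i j l, i ≤ j → j ≤ l → z i ≠ none → z l ≠ none → z j ≠ none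
  long : ∀ a c b, a < c → c < b → z a = none → z c ≠ none → z b = none → n < b - a
  indep : ∀ i j a b, z i = some a → z j = some b → a.chosen → b.chosen → i ≠ j → k < |i - j|
  dom : ∀ i, z i ≠ none → ∃ j a, |j - i| ≤ k ∧ z j = some a ∧ a.chosen

namespace IsRegularSeq

variable {I : Type*} {z : ℤ → Option (NodeInfo I)} {n k s : ℕ}

theorem neg (h : IsRegularSeq n k z) : IsRegularSeq n k (fun i => z (-i)) where
  inj i j a b hi hj hab hij := by
    have := h.inj _ _ a b hi hj hab (by omega)
    rwa [neg_sub_neg, abs_sub_comm] at this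
  conv i j l hij hjl hi hl := h.conv (-l) (-j) (-i) (by omega) (by omega) hl hi
  long a c b hac hcb ha hc hb := by
    have := h.long (-b) (-c) (-a) (by omega) (by omega) hb hc ha
    omega
  indep i j a b hi hj ha hb hij := by
    have := h.indep _ _ a b hi hj ha hb (by omega)
    rwa [neg_sub_neg, abs_sub_comm] at this
  dom i hi := by
    obtain ⟨j, a, hj, hz, ha⟩ := h.dom (-i) hi
    exact ⟨-j, a, by rwa [← abs_neg, neg_sub', neg_neg], by rwa [neg_neg], ha⟩

theorem shift (h : IsRegularSeq n k z) (p : ℤ) : IsRegularSeq n k (shiftBy z p) where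
  inj i j a b hi hj hab hij := by
    have := h.inj _ _ a b hi hj hab (by omega)
    rwa [add_sub_add_left_eq_sub] at this
  conv i j l hij hjl hi hl := h.conv (p + i) (p + j) (p + l) (by omega) (by omega) hi hl
  long a c b hac hcb ha hc hb := by
    have := h.long (p + a) (p + c) (p + b) (by omega) (by omega) ha hc hb
    omega
  indep i j a b hi hj ha hb hij := by
    have := h.indep _ _ a b hi hj ha hb (by omega)
    rwa [add_sub_add_left_eq_sub] at this
  dom i hi := by
    obtain ⟨j, a, hj, hz, ha⟩ := h.dom (p + i) hi
    exact ⟨j - p, a, by rwa [sub_sub], by rwa [shiftBy_apply, add_sub_cancel], ha⟩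

theorem eq_of_name_eq (h : IsRegularSeq n k z) {i j : ℤ} (hij : |i - j| < n) {a b : NodeInfo I}
    (hi : z i = some a) (hj : z j = some b) (hab : a.name = b.name) : i = j := by
  by_contra hne
  exact hij.not_ge (h.inj i j a b hi hj hab hne)

theorem exists_marked (h : IsRegularSeq n k z) {a b : ℤ} (hab : a + 2 * s + 2 * k ≤ b)
    (hsome : ∀ l, a ≤ l → l ≤ b → z l ≠ none) :
    ∃ j, a ≤ j ∧ j ≤ b ∧ Marked s (shiftBy z j) := by
  obtain ⟨j, c, hj, hz, hc⟩ := h.dom (a + s + k) (hsome _ (by omega) (by omega))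
  rw [abs_le] at hj
  refine ⟨j, by omega, by omega, ⟨c, by rwa [shiftBy_apply, add_zero], hc⟩, fun l hl => ?_⟩
  rw [abs_le] at hl
  exact hsome _ (by omega) (by omega)

theorem eq_of_marked (h : IsRegularSeq n k z) {i j : ℤ} (hi : Marked s (shiftBy z i))
    (hj : Marked s (shiftBy z j)) (hij : |i - j| ≤ k) : i = j := by
  obtain ⟨⟨a, ha, hachosen⟩, -⟩ := hi
  obtain ⟨⟨b, hb, hbchosen⟩, -⟩ := hj
  rw [shiftBy_apply, add_zero] at ha hb
  by_contra hne
  exact hij.not_gt (h.indep i j a b ha hb hachosen hbchosen hne)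

end IsRegularSeq

theorem exists_first {P : ℤ → Prop} {a m : ℤ} (ham : a ≤ m) (hm : P m) :
    ∃ b, a ≤ b ∧ b ≤ m ∧ P b ∧ ∀ i, a ≤ i → i < b → ¬ P i := by
  obtain ⟨b, ⟨hab, hb⟩, hleast⟩ := Int.exists_least_of_bdd (P := fun i => a ≤ i ∧ P i)
    ⟨a, fun _ h => h.1⟩ ⟨m, ham, hm⟩
  exact ⟨b, hab, hleast m ⟨ham, hm⟩, hb, fun i hai hib hi => hib.not_ge (hleast i ⟨hai, hi⟩)⟩

theorem exists_last {P : ℤ → Prop} {a m : ℤ} (hma : m ≤ a) (hm : P m) :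
    ∃ b, m ≤ b ∧ b ≤ a ∧ P b ∧ ∀ i, b < i → i ≤ a → ¬ P i := by
  obtain ⟨b, ⟨hba, hb⟩, hgreatest⟩ := Int.exists_greatest_of_bdd (P := fun i => i ≤ a ∧ P i)
    ⟨a, fun _ h => h.1⟩ ⟨m, hma, hm⟩
  exact ⟨b, hgreatest m ⟨hma, hm⟩, hba, hb, fun i hbi hia hi => hbi.not_ge (hgreatest i ⟨hia, hi⟩)⟩

section filling

variable {I O : Type*} [Nonempty I] [Nonempty O] {S : Set (CenteredLabeledGraph I O)} {r : ℕ}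
  {L : PatchLabeling I O r} {κ k n : ℕ} {z : ℤ → Option (NodeInfo I)} {b : Prop}
  (hL : IsPatchLabeling S r b L) (hκ : κ = Nat.card (EffectPair I O r)) (hz : IsRegularSeq n k z)

include hL hκ hz

theorem IsRegularSeq.mem_patchStates (hk : 2 * r ≤ k) (hn : 2 * r < n) {m : ℤ}
    (hm : Marked (r + κ) (shiftBy z m)) (g : ℕ → O) :
    labelsAt _ (patchedLabeling S r L κ z g) (m - r) ∈ patchStates S r L κ (inputs z) m := by
  refine labelsAt_patchedLabeling_mem_patchStates hL hκ hm (fun i j hi hj c d => ?_)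
    (fun j hj hjm => hz.eq_of_marked hjm hm (by omega)) g
  refine hz.eq_of_name_eq ?_
  rw [abs_le] at hi hj
  rw [abs_lt]
  omega

theorem isBlock_of_marked {B l : ℕ} {m : ℤ} (hk : 2 * r + 1 + 2 * κ ≤ k) (hl : 0 < l)
    (hlB : l ≤ B) (hn : l + 2 * r < n) (hm : Marked (r + κ) (shiftBy z m))
    (hml : Marked (r + κ) (shiftBy z (m + l)))
    (hno : ∀ i, m < i → i < m + l → ¬ Marked (r + κ) (shiftBy z i)) :
    IsBlock S r L κ B z (m - r) l where
  ends i hi := by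
    obtain ⟨m', hm', him'⟩ : ∃ m', Marked (r + κ) (shiftBy z m') ∧ |m' - i| ≤ r := by
      rcases hi with hi | hi
      · exact ⟨m, hm, by rw [abs_le]; omega⟩
      · exact ⟨m + l, hml, by rw [abs_le]; omega⟩
    refine Or.inr ((patchLabel_nonempty_iff (hm'.ne_none ?_)).2 ⟨m', him', hm'⟩)
    rw [abs_sub_comm]
    exact him'.trans (by simp)
  mid i hi hi' := by
    have hzi : z i ≠ none := hz.conv m i (m + l) (by omega) (by omega)
      (hm.ne_none (by simp; omega)) (hml.ne_none (by simp; omega))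
    refine ⟨hzi, fun hpatch => ?_⟩
    obtain ⟨m', him', hm'⟩ := (patchLabel_nonempty_iff hzi).1 hpatch
    rw [abs_le] at him'
    exact hno m' (by omega) (by omega) hm'
  inj i hi j hj c d := by
    rw [Set.mem_Icc] at hi hj
    refine hz.eq_of_name_eq ?_
    rw [abs_lt]
    omega
  visible p hp hp' i _ := by
    refine ⟨fun ⟨_, hmarked⟩ => ⟨?_, ?_⟩,
      fun hi => ⟨by rw [abs_le]; omega, fun j hj => hno j (by omega) (by omega)⟩⟩
    · by_contra hlt
      exact hmarked m (Or.inr (by omega)) hm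
    · by_contra hlt
      exact hmarked (m + l) (Or.inl (by omega)) hml
  reach g := by
    have hkl : k < l := by
      by_contra! hle
      have := hz.eq_of_marked hml hm (by simpa using hle)
      omega
    convert hL.reach_of_mem_patchStates rfl (by omega)
      (hz.mem_patchStates hL hκ (by omega) (by omega) hm g)
      (hz.mem_patchStates hL hκ (by omega) (by omega) hml g) using 2
    · push_cast
      ring
    · ring

theorem isBlock_of_end {B l : ℕ} {e m : ℤ} (hk : 2 * r ≤ k) (hb : b) (hml : m + r = e + l)
    (hlB : l ≤ B) (hn : l + 2 * r < n) (hm : Marked (r + κ) (shiftBy z m))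
    (he : ∀ i ≤ e, z i = none) (hem : ∀ i, e < i → i < m → z i ≠ none)
    (hno : ∀ i < m, ¬ Marked (r + κ) (shiftBy z i)) :
    IsBlock S r L κ B z (e - 2 * r) l where
  ends i hi := by
    rcases hi with hi | hi
    · exact Or.inl (he i (by omega))
    · refine Or.inr ((patchLabel_nonempty_iff (hm.ne_none ?_)).2 ⟨m, ?_, hm⟩)
      · rw [abs_le]
        push_cast
        omega
      · rw [abs_le]
        omega
  mid i hi hi' := by
    have hzi : z i ≠ none := hem i (by omega) (by omega)
    refine ⟨hzi, fun hpatch => ?_⟩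
    obtain ⟨m', him', hm'⟩ := (patchLabel_nonempty_iff hzi).1 hpatch
    rw [abs_le] at him'
    exact hno m' (by omega) hm'
  inj i hi j hj c d := by
    rw [Set.mem_Icc] at hi hj
    refine hz.eq_of_name_eq ?_
    rw [abs_lt]
    omega
  visible p hp hp' i hzi := by
    have hei : e < i := by
      by_contra! hie
      exact hzi (he i hie)
    refine ⟨fun ⟨_, hmarked⟩ => ⟨by omega, ?_⟩,
      fun hi => ⟨by rw [abs_le]; omega, fun j hj => hno j (by omega)⟩⟩
    by_contra hlt
    exact hmarked m (Or.inl (by omega)) hm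
  reach g := by
    have hl : r + κ < m - e := by
      by_contra! hle
      exact hm.ne_none (i := m - r - κ) (by rw [abs_le]; push_cast; omega) (he _ (by omega))
    convert hL.reach_none_of_mem_patchStates hb (a := e + 1) (k := l) (by omega) (by omega)
      (hz.mem_patchStates hL hκ hk (by omega) hm g) using 1
    · funext j
      rw [labelsAt, patchedLabeling, he _ (by omega), Option.map_none]
    · congr 1
      push_cast
      ring
    · congr 1
      omega

theorem windowOK_filledLabeling_of_marked_right (hb : ∀ i, z i = none → b)
    (hk : 2 * r + 1 + 2 * κ ≤ k) {D : ℕ} (hD : 2 * (r + κ) + 2 * k ≤ D)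
    (hn : 2 * D + 4 * r + 10 ≤ n)
    (hright : ∃ m : ℤ, 0 ≤ m ∧ m ≤ D ∧ Marked (r + κ) (shiftBy z m)) :
    WindowOK S r (filledLabeling S r L κ (2 * D + r + 1) z) := by
  by_cases hz0 : z 0 = none
  · exact .of_eq_none (by simp [filledLabeling, hz0])
  obtain ⟨m, hm0, hmD, hm⟩ := hright
  obtain ⟨m₂, hm₂0, hm₂m, hm₂, hfirst⟩ :=
    exists_first (P := fun i => Marked (r + κ) (shiftBy z i)) hm0 hm
  rw [← shiftBy_zero (filledLabeling S r L κ (2 * D + r + 1) z)]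
  by_cases hleft : ∃ m : ℤ, -1 - D ≤ m ∧ m ≤ -1 ∧ Marked (r + κ) (shiftBy z m)
  · obtain ⟨m, hmD, hm0, hm⟩ := hleft
    obtain ⟨m₁, hmm₁, hm₁0, hm₁, hlast⟩ :=
      exists_last (P := fun i => Marked (r + κ) (shiftBy z i)) hm0 hm
    obtain ⟨l, hl⟩ := Int.eq_ofNat_of_zero_le (show 0 ≤ m₂ - m₁ by omega)
    obtain rfl : m₂ = m₁ + l := by omega
    refine (isBlock_of_marked hL hκ hz hk (by omega) (by omega) (by omega) hm₁ hm₂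
      fun i hi hi' => ?_).windowOK_filledLabeling (by omega) (by omega) (by omega)
    rcases lt_or_ge i 0 with hi0 | hi0
    · exact hlast i hi (by omega)
    · exact hfirst i hi0 hi'
  obtain ⟨e, heD, he0, he, hlast⟩ : ∃ e : ℤ, -1 - D ≤ e ∧ e ≤ -1 ∧ z e = none ∧
      ∀ i, e < i → i ≤ -1 → z i ≠ none := by
    by_contra! hcon
    refine hleft (hz.exists_marked (by push_cast; omega) fun l hl hl0 hzl => ?_)
    obtain ⟨e, hle, he0, he, hlast⟩ := exists_last (P := fun i => z i = none) hl0 hzl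
    obtain ⟨i, hei, hi0, hi⟩ := hcon e (by omega) he0 he
    exact hlast i hei hi0 hi
  have hlow (i : ℤ) (hi : i ≤ e) : z i = none := by
    by_contra hzi
    exact hz.conv i e 0 hi (by omega) hzi hz0 he
  have hem₂ : e < m₂ := by omega
  obtain ⟨l, hl⟩ := Int.eq_ofNat_of_zero_le (show 0 ≤ m₂ + r - e by omega)
  refine (isBlock_of_end hL hκ hz (by omega) (hb e he) (l := l) (by omega) (by omega) (by omega) hm₂
    hlow (fun i hi hi' => ?_) fun i hi hmi => ?_).windowOK_filledLabeling (by omega) (by omega)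
    (by omega)
  · rcases lt_or_ge i 0 with hi0 | hi0
    · exact hlast i hi (by omega)
    · exact hz.conv 0 i m₂ hi0 (by omega) hz0 (hm₂.ne_none (by simp; omega))
  · rcases lt_or_ge i 0 with hi0 | hi0
    · have hei : e < i := by
        by_contra! hie
        exact hmi.ne_none (by simp; omega) (hlow i hie)
      exact hleft ⟨i, by omega, by omega, hmi⟩
    · exact hfirst i hi0 hi hmi

theorem windowOK_filledLabeling_zero (hb : ∀ i, z i = none → b) (hk : 2 * r + 1 + 2 * κ ≤ k)
    {D : ℕ} (hD : 2 * (r + κ) + 2 * k ≤ D) (hn : 2 * D + 4 * r + 10 ≤ n) :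
    WindowOK S r (filledLabeling S r L κ (2 * D + r + 1) z) := by
  by_cases hz0 : z 0 = none
  · exact .of_eq_none (by simp [filledLabeling, hz0])
  by_cases hright : ∃ m : ℤ, 0 ≤ m ∧ m ≤ D ∧ Marked (r + κ) (shiftBy z m)
  · exact windowOK_filledLabeling_of_marked_right hL hκ hz hb hk hD hn hright
  obtain ⟨c, hc0, hcD, hc⟩ : ∃ c : ℤ, 0 ≤ c ∧ c ≤ D ∧ z c = none := by
    by_contra! hcon
    exact hright (hz.exists_marked (by push_cast; omega) hcon)
  have hleft : ∃ m : ℤ, 0 ≤ m ∧ m ≤ D ∧ Marked (r + κ) (shiftBy (fun i => z (-i)) m) := by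
    refine hz.neg.exists_marked (by push_cast; omega) fun l hl hlD hzl => ?_
    have hl0 : l ≠ 0 := fun h => hz0 (by rwa [h, neg_zero] at hzl)
    have hcne : c ≠ 0 := fun h => hz0 (by rwa [h] at hc)
    have := hz.long (-l) 0 c (by omega) (by omega) hzl hz0 hc
    omega
  refine (windowOK_filledLabeling_of_marked_right hL hκ hz.neg (fun i hi => hb _ hi) hk hD hn
    hleft).neg.congr fun j _ => ?_
  rw [filledLabeling_comp_neg hL, neg_neg]

theorem windowOK_filledLabeling (hb : ∀ i, z i = none → b) (hk : 2 * r + 1 + 2 * κ ≤ k)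
    {D : ℕ} (hD : 2 * (r + κ) + 2 * k ≤ D) (hn : 2 * D + 4 * r + 10 ≤ n) (p : ℤ) :
    WindowOK S r (shiftBy (filledLabeling S r L κ (2 * D + r + 1) z) p) := by
  rw [← filledLabeling_shiftBy]
  exact windowOK_filledLabeling_zero hL hκ (hz.shift p) (fun i hi => hb _ hi) hk hD hn

end filling

/-! ### Color reduction -/

theorem eventually_mul_pow_le_two_pow (K E : ℕ) : ∀ᶠ c : ℕ in atTop, K * c ^ E ≤ 2 ^ c := by
  have hlittle := (isLittleO_pow_const_const_pow_of_one_lt E (r := (2 : ℝ))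
    (by norm_num)).const_mul_left (K : ℝ)
  filter_upwards [hlittle.bound one_pos] with c hc
  rw [one_mul, Real.norm_of_nonneg (by positivity), Real.norm_of_nonneg (by positivity)] at hc
  exact_mod_cast hc

theorem eventually_pow_clog_le (A E : ℕ) :
    ∀ᶠ s : ℕ in atTop, (A * (Nat.clog 2 (A * (s + 1)) + 1)) ^ E ≤ s := by
  rcases Nat.eq_zero_or_pos A with rfl | hA
  · filter_upwards [eventually_ge_atTop 1] with s hs
    rw [zero_mul]
    exact (pow_le_one₀ (Nat.zero_le _) (Nat.zero_le _)).trans hs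
  obtain ⟨c₀, hc₀⟩ :=
    eventually_atTop.1 (eventually_mul_pow_le_two_pow (2 * (A * ((2 * A) ^ E + 1))) E)
  filter_upwards [eventually_ge_atTop (2 ^ (c₀ + 1))] with s hs
  have hs' : 2 ^ (c₀ + 1) ≤ A * (s + 1) := by nlinarith
  set c := Nat.clog 2 (A * (s + 1)) with hc
  have hcc₀ : c₀ + 1 ≤ c := by
    rw [← Nat.clog_pow 2 (c₀ + 1) (by norm_num)]
    exact Nat.clog_mono_right 2 hs'
  have hpow : 2 ^ c < 2 * (A * (s + 1)) := by
    have hpred := Nat.pow_pred_clog_lt_self (b := 2) (by norm_num)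
      (lt_of_lt_of_le (Nat.one_lt_two_pow (by omega)) hs')
    rw [← hc, Nat.pred_eq_sub_one] at hpred
    rw [← Nat.sub_add_cancel (show 1 ≤ c by omega), pow_succ]
    omega
  have hpoly : A * ((A * (c + 1)) ^ E + 1) ≤ A * ((2 * A) ^ E + 1) * c ^ E := by
    rw [mul_assoc, add_mul, one_mul, ← mul_pow]
    refine Nat.mul_le_mul_left _ (Nat.add_le_add (Nat.pow_le_pow_left ?_ _)
      (Nat.one_le_pow _ _ (by omega)))
    nlinarith
  have hexp := hc₀ c (by omega)
  rw [mul_assoc] at hexp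
  have hlt : A * ((A * (c + 1)) ^ E + 1) < A * (s + 1) := by omega
  exact (Nat.lt_of_add_lt_add_right (Nat.lt_of_mul_lt_mul_left hlt)).le

theorem exists_injOn_image_lt_card {α β : Type*} (f : α → β) {s : Finset α} (hs : s.Nonempty) :
    ∃ enc : β → ℕ, (∀ b, enc b < s.card) ∧ Set.InjOn enc (f '' s) := by
  classical
  refine ⟨fun b => if h : b ∈ s.image f then (s.image f).equivFin ⟨b, h⟩ else 0, fun b => ?_, ?_⟩
  · beta_reduce
    split_ifs
    · exact (Fin.is_lt _).trans_le Finset.card_image_le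
    · exact hs.card_pos
  · intro b hb c hc hbc
    rw [← Finset.coe_image, Finset.mem_coe] at hb hc
    simpa only [dif_pos hb, dif_pos hc, Fin.val_inj, EmbeddingLike.apply_eq_iff_eq,
      Subtype.mk.injEq] using hbc

/-- The colors of nodes at distance at most `k` are distinct. -/
def IsProper (k : ℕ) (z : ℤ → Option ℕ) : Prop :=
  ∀ i j : ℤ, i ≠ j → |i - j| ≤ (k : ℤ) → ∀ a, z i = some a → z j ≠ some a

open scoped Classical in
/-- The least position of a bit that distinguishes the first color from the second one, with the
value of this bit in the first color. -/
noncomputable def distinguishingBit : Option ℕ → Option ℕ → Option (ℕ × Bool)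
  | some a, some b => if h : ∃ i, a.testBit i ≠ b.testBit i then
      some (Nat.find h, a.testBit (Nat.find h)) else none
  | _, _ => none

theorem distinguishingBit_ne_none {a b : ℕ} (h : a ≠ b) :
    distinguishingBit (some a) (some b) ≠ none := by
  have hex : ∃ i, a.testBit i ≠ b.testBit i := by
    by_contra! heq
    exact h (Nat.eq_of_testBit_eq heq)
  simp [distinguishingBit, hex]

theorem of_mem_distinguishingBit {x y : Option ℕ} {t : ℕ × Bool} (h : t ∈ distinguishingBit x y) :
    ∃ a b, x = some a ∧ y = some b ∧ a.testBit t.1 = t.2 ∧ b.testBit t.1 ≠ t.2 := by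
  classical
  match x, y, h with
  | some a, some b, h =>
    rw [distinguishingBit] at h
    split_ifs at h with hex
    · obtain rfl := Option.some_inj.1 h
      exact ⟨a, b, rfl, rfl, rfl, (Nat.find_spec hex).symm⟩
    · simp at h

theorem lt_of_mem_distinguishingBit {x y : Option ℕ} {s : ℕ} (hx : ∀ a ∈ x, a < 2 ^ s)
    (hy : ∀ b ∈ y, b < 2 ^ s) {t : ℕ × Bool} (h : t ∈ distinguishingBit x y) : t.1 < s := by
  obtain ⟨a, b, rfl, rfl, ha, hb⟩ := of_mem_distinguishingBit h
  by_contra! hs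
  have hpow : 2 ^ s ≤ 2 ^ t.1 := Nat.pow_le_pow_right (by norm_num) hs
  rw [← ha, Nat.testBit_lt_two_pow ((hx a rfl).trans_le hpow),
    Nat.testBit_lt_two_pow ((hy b rfl).trans_le hpow)] at hb
  exact hb rfl

/-- The bits of the color of `0` that distinguish it from the colors around. -/
def bitSet (k : ℕ) (z : ℤ → Option ℕ) : Set (ℕ × Bool) :=
  {t | ∃ j : ℤ, |j| ≤ k ∧ t ∈ distinguishingBit (z 0) (z j)}

theorem isRule_bitSet (k : ℕ) : IsRule k (bitSet k) := by
  refine .of_le (fun z z' h => ?_) fun z => ?_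
  · rintro t ⟨j, hj, ht⟩
    exact ⟨j, hj, by rwa [← h j hj, ← h 0 (by simp)]⟩
  · rintro t ⟨j, hj, ht⟩
    exact ⟨-j, by rwa [abs_neg], by simpa only [neg_zero, neg_neg] using ht⟩

theorem bitSet_ne {k : ℕ} {z : ℤ → Option ℕ} (hz : IsProper k z) {i j : ℤ} (hij : i ≠ j)
    (hk : |i - j| ≤ k) {a b : ℕ} (ha : z i = some a) (hb : z j = some b) :
    bitSet k (shiftBy z i) ≠ bitSet k (shiftBy z j) := by
  intro heq
  have hab : a ≠ b := fun hab => hz i j hij hk a ha (hab ▸ hb)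
  obtain ⟨t, ht⟩ := Option.ne_none_iff_exists'.1 (distinguishingBit_ne_none hab)
  have hmem : t ∈ bitSet k (shiftBy z i) := by
    refine ⟨j - i, by rwa [abs_sub_comm], ?_⟩
    rw [shiftBy_apply, shiftBy_apply, add_zero, add_sub_cancel, ha, hb]
    exact ht
  obtain ⟨_, b', -, hbb', -, hbt⟩ := of_mem_distinguishingBit ht
  obtain ⟨l, -, hl⟩ := heq ▸ hmem
  obtain ⟨b'', -, hbb'', -, hbt', -⟩ := of_mem_distinguishingBit hl
  rw [shiftBy_apply, add_zero, hb, hbb'] at hbb''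
  rw [← Option.some_inj.1 hbb''] at hbt'
  exact hbt hbt'

theorem exists_encoding_bitSet (k s : ℕ) : ∃ enc : Set (ℕ × Bool) → ℕ,
    (∀ T, enc T < (2 * s + 1) ^ (2 * k + 1)) ∧
      Set.InjOn enc (bitSet k '' {z | ∀ i, ∀ a ∈ z i, a < 2 ^ s}) := by
  let P : Finset (Finset.Icc (-k : ℤ) k → Option (ℕ × Bool)) :=
    Fintype.piFinset fun _ => (Finset.range s ×ˢ Finset.univ).insertNone
  have hcard : P.card = (2 * s + 1) ^ (2 * k + 1) := by
    rw [Fintype.card_piFinset, Finset.prod_const, Finset.card_insertNone, Finset.card_product,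
      Finset.card_range, Finset.card_univ, Fintype.card_bool, Finset.card_univ, Fintype.card_coe,
      Int.card_Icc, mul_comm]
    congr 1
    omega
  obtain ⟨enc, hlt, hinj⟩ := exists_injOn_image_lt_card (fun f => {t | ∃ j, t ∈ f j})
    (s := P) (Finset.card_pos.1 (hcard ▸ by positivity))
  refine ⟨enc, hcard ▸ hlt, hinj.mono ?_⟩
  rintro _ ⟨z, hz, rfl⟩
  refine ⟨fun j => distinguishingBit (z 0) (z j), ?_, ?_⟩
  · rw [Finset.mem_coe, Fintype.mem_piFinset]
    intro j
    rw [Finset.mem_insertNone]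
    intro t ht
    simpa using lt_of_mem_distinguishingBit (hz 0) (hz j) ht
  · ext t
    exact ⟨fun ⟨j, hj⟩ => ⟨j, abs_le.2 (Finset.mem_Icc.1 j.2), hj⟩,
      fun ⟨j, hj, ht⟩ => ⟨⟨j, Finset.mem_Icc.2 (abs_le.1 hj)⟩, ht⟩⟩

/-- Some rule of radius `ρ` turns locally distinct colors below `m` into such colors below `q`. -/
def ColorReducible (q k m ρ : ℕ) : Prop :=
  ∃ Y : (ℤ → Option ℕ) → ℕ, IsRule ρ Y ∧ (∀ z, Y z < q) ∧
    ∀ z, (∀ i, ∀ a ∈ z i, a < m) → IsProper k z →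
      IsProper k fun i => (z i).map fun _ => Y (shiftBy z i)

namespace ColorReducible

variable {q k m m' s ρ ρ' : ℕ}

theorem mono (h : ColorReducible q k m ρ) (hm : m' ≤ m) (hρ : ρ ≤ ρ') :
    ColorReducible q k m' ρ' := by
  obtain ⟨Y, hY, hlt, hproper⟩ := h
  exact ⟨Y, hY.mono hρ, hlt, fun z hz => hproper z fun i a ha => (hz i a ha).trans_le hm⟩

theorem self (hq : 0 < q) : ColorReducible q k q 0 := by
  refine ⟨fun z => if (z 0).getD 0 < q then (z 0).getD 0 else 0, ⟨fun z z' h => ?_, fun z => ?_⟩,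
    fun z => ?_, fun z hz hp => ?_⟩
  · rw [h 0 (by simp)]
  · simp only [neg_zero]
  · beta_reduce
    split_ifs with h
    · exact h
    · exact hq
  · convert hp using 1
    funext i
    rcases hi : z i with _ | a
    · rfl
    · simp [shiftBy_apply, hi, hz i a hi]

theorem step (h : ColorReducible q k ((2 * s + 1) ^ (2 * k + 1)) ρ) :
    ColorReducible q k (2 ^ s) (ρ + k) := by
  obtain ⟨Y, hY, hlt, hproper⟩ := h
  obtain ⟨enc, henc_lt, henc⟩ := exists_encoding_bitSet k s
  refine ⟨_, hY.comp (isRule_bitSet k) (fun _ T => enc T), fun z => hlt _, fun z hz hp => ?_⟩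
  have hz' := hproper (fun i => (z i).map fun _ => enc (bitSet k (shiftBy z i))) ?_ ?_
  · convert hz' using 1
    funext i
    rcases z i with _ | a
    · rfl
    · simp only [Option.map_some, shiftBy_shiftBy]
      rfl
  · intro i a ha
    obtain ⟨_, -, rfl⟩ := Option.map_eq_some_iff.1 ha
    exact henc_lt _
  · intro i j hij hk a ha hb
    obtain ⟨c, hc, hca⟩ := Option.map_eq_some_iff.1 ha
    obtain ⟨d, hd, hda⟩ := Option.map_eq_some_iff.1 hb
    exact bitSet_ne hp hij hk hc hd (henc ⟨_, fun l => hz (i + l), rfl⟩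
      ⟨_, fun l => hz (j + l), rfl⟩ (hca.trans hda.symm))

theorem two_steps {l A : ℕ} (h : ColorReducible q k l ρ) (hm : m ≤ 2 ^ s) (hA : 4 * k + 2 ≤ A)
    (hs : 2 * s + 1 ≤ A * (l + 1))
    (hl : (A * (Nat.clog 2 (A * (l + 1)) + 1)) ^ (2 * k + 1) ≤ l) :
    ColorReducible q k m (ρ + 2 * k) := by
  set c := Nat.clog 2 (A * (l + 1))
  have hfirst : (2 * ((2 * k + 1) * c) + 1) ^ (2 * k + 1) ≤ l := by
    refine (Nat.pow_le_pow_left ?_ _).trans hl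
    nlinarith
  have hsecond : (2 * s + 1) ^ (2 * k + 1) ≤ 2 ^ ((2 * k + 1) * c) := by
    rw [mul_comm (2 * k + 1) c, pow_mul]
    exact Nat.pow_le_pow_left (hs.trans (Nat.le_pow_clog (by norm_num) _)) _
  exact ((h.mono hfirst le_rfl).step.mono hsecond le_rfl).step.mono hm (by omega)

end ColorReducible

theorem logStar_of_one_lt {n : ℕ} (hn : 1 < n) : logStar n = 1 + logStar (Nat.clog 2 n) := by
  rw [logStar, if_neg (by omega)]

theorem le_clog_two {s n : ℕ} (h : 2 ^ s ≤ n) : s ≤ Nat.clog 2 n := by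
  rw [← Nat.clog_pow 2 s (by norm_num)]
  exact Nat.clog_mono_right 2 h

theorem exists_colorReducible (k : ℕ) :
    ∃ q, ∀ m, ColorReducible q k m (2 * k * logStar m) := by
  obtain ⟨s₀, hs₀⟩ := eventually_atTop.1 (eventually_pow_clog_le (4 * k + 2) (2 * k + 1))
  have hpos := Nat.one_le_two_pow (n := s₀)
  refine ⟨2 ^ s₀ + 1, fun m => ?_⟩
  induction m using Nat.strong_induction_on with
  | _ m ih =>
    rcases le_or_gt m (2 ^ s₀ + 1) with hm | hm
    · exact (ColorReducible.self (by positivity)).mono hm (Nat.zero_le _)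
    · rw [logStar_of_one_lt (by omega)]
      exact ((ih _ (clog_two_lt (by omega))).two_steps (Nat.le_pow_clog (by norm_num) m) le_rfl
        (by nlinarith) (hs₀ _ (le_clog_two (by omega)))).mono le_rfl (by ring_nf; rfl)

theorem exists_eventually_colorReducible_pow (k c : ℕ) :
    ∃ q, ∀ᶠ n in atTop, ColorReducible q k (n ^ c + 1) (2 * k * logStar n) := by
  obtain ⟨q, hq⟩ := exists_colorReducible k
  obtain ⟨s₀, hs₀⟩ := eventually_atTop.1 (eventually_pow_clog_le (4 * k + 2 * c + 3) (2 * k + 1))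
  have hpos := Nat.one_le_two_pow (n := s₀)
  refine ⟨q, ?_⟩
  filter_upwards [eventually_ge_atTop (2 ^ s₀ + 2)] with n hn
  have hpow : n ^ c + 1 ≤ 2 ^ (c * Nat.clog 2 n + 1) := by
    have hpow' : n ^ c ≤ 2 ^ (c * Nat.clog 2 n) := by
      rw [mul_comm, pow_mul]
      exact Nat.pow_le_pow_left (Nat.le_pow_clog (by norm_num) n) c
    have := Nat.one_le_two_pow (n := c * Nat.clog 2 n)
    rw [pow_succ]
    omega
  rw [logStar_of_one_lt (by omega)]
  exact ((hq (Nat.clog 2 n)).two_steps hpow (A := 4 * k + 2 * c + 3) (by omega) (by nlinarith)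
    (hs₀ _ (le_clog_two (by omega)))).mono le_rfl (by ring_nf; rfl)

/-! ### Greedy choice -/

/-- The node at `0` is chosen when the color classes below `t` are added greedily to a set of nodes
at pairwise distance more than `k`. -/
def Chosen (k : ℕ) : ℕ → (ℤ → Option ℕ) → Prop
  | 0, _ => False
  | t + 1, z => Chosen k t z ∨ z 0 = some t ∧ ∀ j : ℤ, |j| ≤ k → ¬ Chosen k t (shiftBy z j)

theorem isRule_chosen (k t : ℕ) : IsRule (k * t) (Chosen k t) := by
  induction t with
  | zero => exact ⟨fun _ _ _ => rfl, fun _ => rfl⟩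
  | succ t ih =>
    refine .of_le (fun z z' h => ?_) fun z => ?_
    · rintro (hc | ⟨h0, hc⟩)
      · refine Or.inl (ih.congr (fun i hi => h i (hi.trans ?_)) ▸ hc)
        exact_mod_cast Nat.mul_le_mul_left k t.le_succ
      · refine Or.inr ⟨by rwa [← h 0 (by simp)], fun j hj => ?_⟩
        rw [← ih.congr (shiftBy_congr h (p := j) (by push_cast at *; linarith))]
        exact hc j hj
    · rintro (hc | ⟨h0, hc⟩)
      · exact Or.inl (by rwa [ih.comp_neg])
      · refine Or.inr ⟨by simpa only [neg_zero] using h0, fun j hj => ?_⟩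
        rw [shiftBy_comp_neg, ih.comp_neg]
        exact hc (-j) (by rwa [abs_neg])

namespace Chosen

variable {k t : ℕ} {z : ℤ → Option ℕ}

theorem mono {t' : ℕ} (ht : t ≤ t') (h : Chosen k t z) : Chosen k t' z := by
  induction ht with
  | refl => exact h
  | step _ ih => exact Or.inl ih

theorem ne_none (h : Chosen k t z) : z 0 ≠ none := by
  induction t with
  | zero => exact h.elim
  | succ t ih =>
    rcases h with h | ⟨h, -⟩
    · exact ih h
    · simp [h]

theorem lt_abs_sub (hz : IsProper k z) {i j : ℤ} (hi : Chosen k t (shiftBy z i))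
    (hj : Chosen k t (shiftBy z j)) (hij : i ≠ j) : k < |i - j| := by
  induction t with
  | zero => exact hi.elim
  | succ t ih =>
    by_contra! hk
    rcases hi with hi | ⟨hi, hi'⟩ <;> rcases hj with hj | ⟨hj, hj'⟩
    · exact hk.not_gt (ih hi hj)
    · refine hj' (i - j) hk ?_
      rwa [shiftBy_shiftBy, add_sub_cancel]
    · refine hi' (j - i) (by rwa [abs_sub_comm]) ?_
      rwa [shiftBy_shiftBy, add_sub_cancel]
    · rw [shiftBy_apply, add_zero] at hi hj
      exact hz i j hij hk t hi hj

theorem exists_near {i : ℤ} {a : ℕ} (hi : z i = some a) (ha : a < t) :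
    ∃ j, |j - i| ≤ k ∧ Chosen k t (shiftBy z j) := by
  by_cases h : ∃ j : ℤ, |j| ≤ k ∧ Chosen k a (shiftBy (shiftBy z i) j)
  · obtain ⟨j, hj, hc⟩ := h
    rw [shiftBy_shiftBy] at hc
    exact ⟨i + j, by simpa using hj, hc.mono ha.le⟩
  · push Not at h
    exact ⟨i, by simp, mono (show a + 1 ≤ t from ha)
      (Or.inr ⟨by simpa [shiftBy_apply] using hi, h⟩)⟩

end Chosen

/-! ### Completing the labels of a chart -/

theorem IsChart.lt_sub_of_none {n : ℕ} {G : SimpleGraph (Fin n)} {ψ : ℤ → Option (Fin n)}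
    (h : IsChart G ψ) {a b c : ℤ} (hac : a < c) (hcb : c < b) (ha : ψ a = none) (hc : ψ c ≠ none)
    (hb : ψ b = none) : n < b - a := by
  choose f hf using h.surj
  have hmem (v) : f v ∈ Finset.Ioo a b := by
    have hv : ψ (f v) ≠ none := by simp [hf]
    rw [Finset.mem_Ioo]
    constructor
    · by_contra hlt
      exact h.ordConnected.out hv hc ⟨not_lt.1 hlt, hac.le⟩ ha
    · by_contra hlt
      exact h.ordConnected.out hc hv ⟨hcb.le, not_lt.1 hlt⟩ hb
  have hinj : Function.Injective f := fun v w hvw =>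
    Option.some_injective _ (by rw [← hf, ← hf, hvw])
  have hcard := Finset.card_le_card_of_injOn f (s := Finset.univ) (fun v _ => hmem v) hinj.injOn
  rw [Finset.card_univ, Fintype.card_fin, Int.card_Ioo] at hcard
  omega

/-- The sequence of nodes of a chart, where `chosen i v` tells whether the node `v` at position `i`
is chosen. -/
def nodeInfos {I V : Type*} (ψ : ℤ → Option V) (name : V → ℕ) (x : V → I) (chosen : ℤ → V → Prop)
    (i : ℤ) : Option (NodeInfo I) :=
  (ψ i).map fun v => ⟨name v, x v, chosen i v⟩

theorem IsChart.isRegularSeq {I : Type*} {n k : ℕ} {G : SimpleGraph (Fin n)}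
    {ψ : ℤ → Option (Fin n)} (h : IsChart G ψ) (name : Fin n ↪ ℕ) (x : Fin n → I)
    {chosen : ℤ → Fin n → Prop}
    (hindep : ∀ i j v w, ψ i = some v → ψ j = some w → chosen i v → chosen j w → i ≠ j →
      (k : ℤ) < |i - j|)
    (hdom : ∀ i v, ψ i = some v → ∃ j w, |j - i| ≤ k ∧ ψ j = some w ∧ chosen j w) :
    IsRegularSeq n k (nodeInfos ψ name x chosen) where
  inj i j a b hi hj hab hij := by
    obtain ⟨v, hv, rfl⟩ := Option.map_eq_some_iff.1 hi
    obtain ⟨w, hw, rfl⟩ := Option.map_eq_some_iff.1 hj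
    obtain rfl := name.injective hab
    exact h.le_abs_sub hv hw hij
  conv i j l hij hjl hi hl := by
    simp only [nodeInfos, ne_eq, Option.map_eq_none_iff] at hi hl ⊢
    exact h.ordConnected.out hi hl ⟨hij, hjl⟩
  long a c b hac hcb ha hc hb := by
    simp only [nodeInfos, ne_eq, Option.map_eq_none_iff] at ha hb hc
    exact h.lt_sub_of_none hac hcb ha hc hb
  indep i j a b hi hj ha hb hij := by
    obtain ⟨v, hv, rfl⟩ := Option.map_eq_some_iff.1 hi
    obtain ⟨w, hw, rfl⟩ := Option.map_eq_some_iff.1 hj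
    exact hindep i j v w hv hw ha hb hij
  dom i hi := by
    simp only [nodeInfos, ne_eq, Option.map_eq_none_iff] at hi
    obtain ⟨v, hv⟩ := Option.ne_none_iff_exists'.1 hi
    obtain ⟨j, w, hji, hw, hchosen⟩ := hdom i v hv
    exact ⟨j, _, hji, by rw [nodeInfos, hw, Option.map_some], hchosen⟩

/-- On graphs with at least `n₀` nodes, the rule `Y` solves `P` whenever the sequence of nodes is
regular. The proposition `b` has to hold if the graph is a path. -/
def LabelingProblem.IsCompletion {I O : Type*} (P : LabelingProblem I O) (b : Prop) (k n₀ : ℕ)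
    (Y : (ℤ → Option (NodeInfo I)) → NodeInfo I → O) : Prop :=
  ∀ ⦃n⦄, n₀ ≤ n → ∀ ⦃G : SimpleGraph (Fin n)⦄ ⦃ψ⦄, IsChart G ψ → (∀ i, ψ i = none → b) →
    ∀ ⦃name x chosen⦄, IsRegularSeq n k (nodeInfos ψ name x chosen) → ∀ ⦃y⦄, (∀ p v, ψ p = some v →
      y v = Y (shiftBy (nodeInfos ψ name x chosen) p) ⟨name v, x v, chosen p v⟩) → y ∈ P.sol G x

/-- `P` can be solved by a local rule once a sparse set of chosen nodes is known. -/
def LabelingProblem.Completable {I O : Type*} (P : LabelingProblem I O) (b : Prop) : Prop :=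
  ∃ ρ k n₀ Y, IsRule ρ Y ∧ P.IsCompletion b k n₀ Y

theorem IsPatchLabeling.completable {I O : Type*} [Nonempty I] [Nonempty O]
    {P : LabelingProblem I O} {S : Set (CenteredLabeledGraph I O)} {r Δ : ℕ} (hΔ : 2 ≤ Δ)
    (hS : P.IsCheckedBy S r Δ) {b : Prop} {L : PatchLabeling I O r} (hL : IsPatchLabeling S r b L) :
    P.Completable b := by
  set κ := Nat.card (EffectPair I O r) with hκ
  set k := 2 * r + 1 + 2 * κ
  set D := 2 * (r + κ) + 2 * k
  refine ⟨_, k, 2 * D + 4 * r + 10, fillOutput S r L κ (2 * D + r + 1), isRule_fillOutput hL,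
    fun n hn G ψ h hb name x chosen hz y hy => ?_⟩
  refine (h.mem_sol_iff hΔ hS x y (by omega)).2 fun p => ?_
  refine (windowOK_filledLabeling hL hκ hz (fun i hi => hb i (Option.map_eq_none_iff.1 hi)) le_rfl
    le_rfl hn p).congr fun j _ => ?_
  rw [shiftBy_apply, filledLabeling]
  rcases hv : ψ (p + j) with _ | v
  · simp [nodeInfos, hv]
  · rw [Option.map_some, hy _ v hv, nodeInfos, hv]
    rfl

/-! ### Solving problems in the LOCAL model -/

theorem IsRule.map {α β γ : Type*} {ρ : ℕ} {Y : (ℤ → Option β) → γ} (h : IsRule ρ Y) (f : α → β) :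
    IsRule ρ (fun z => Y fun i => (z i).map f) where
  congr z z' hz := h.congr fun i hi => by rw [hz i hi]
  comp_neg z := h.comp_neg fun i => (z i).map f

section localView

variable {I O : Type*} {n : ℕ}

theorem image_neighborSet_eq_localView {t s : ℕ} {G : SimpleGraph (Fin n)} {ident : Fin n ↪ ℕ}
    {v a : Fin n} (x : Fin n → I) (hs : s < t) (ha : a ∈ nbhd G s v) :
    ident '' G.neighborSet a = (localView t G x ident v).graph.neighborSet (ident a) := by
  ext b
  simp only [localView, Set.mem_image, SimpleGraph.mem_neighborSet]
  rw [SimpleGraph.map_adj]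
  simp only [spanningCoe_induce_adj]
  constructor
  · rintro ⟨w, hw, rfl⟩
    exact ⟨a, w, ⟨hw, nbhd_mono hs.le v ha, nbhd_mono hs v (mem_nbhd_succ.2 (Or.inr ⟨a, ha, hw⟩))⟩,
      rfl, rfl⟩
  · rintro ⟨a', w, ⟨hw, -⟩, haa', rfl⟩
    obtain rfl := ident.injective haa'
    exact ⟨w, hw, rfl⟩

theorem localView_input {t : ℕ} {G : SimpleGraph (Fin n)} {x : Fin n → I} {ident : Fin n ↪ ℕ}
    {v a : Fin n} (ha : a ∈ nbhd G t v) :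
    (localView t G x ident v).input (ident a) = some (x a) := by
  simp only [localView]
  rw [ident.injective.extend_apply, restrictInput, if_pos ha]

variable {n' : ℕ} {G : SimpleGraph (Fin n)} {G' : SimpleGraph (Fin n')} {ψ : ℤ → Option (Fin n)}
  {ψ' : ℤ → Option (Fin n')} {x : Fin n → I} {x' : Fin n' → I} {ident : Fin n ↪ ℕ}
  {ident' : Fin n' ↪ ℕ} {v : Fin n} {v' : Fin n'} {p p' : ℤ} {t : ℕ}

theorem IsChart.map_prod_eq_of_localView_eq (h : IsChart G ψ) (h' : IsChart G' ψ')
    (hp : ψ p = some v) (hp' : ψ' p' = some v')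
    (hview : localView t G x ident v = localView t G' x' ident' v') {i j : ℤ} (hi : |i| ≤ t)
    (hj : |j| ≤ t) (hij : (ψ (p + i)).map ident = (ψ' (p' + j)).map ident') :
    (ψ (p + i)).map (fun v => (ident v, x v)) = (ψ' (p' + j)).map fun v => (ident' v, x' v) := by
  rcases ha : ψ (p + i) with _ | a <;> rcases hb : ψ' (p' + j) with _ | b <;>
    simp only [ha, hb, Option.map_some, Option.map_none, reduceCtorEq, Option.some_inj] at hij ⊢
  have hxa := localView_input (x := x) (ident := ident) ((h.mem_nbhd_iff hp).2 ⟨i, hi, ha⟩)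
  have hxb := localView_input (x := x') (ident := ident') ((h'.mem_nbhd_iff hp').2 ⟨j, hj, hb⟩)
  rw [hview, hij, hxb, Option.some_inj] at hxa
  exact Prod.ext hij hxa.symm

theorem IsRule.apply_eq_of_localView_eq {β : Type*} {Y : (ℤ → Option (ℕ × I)) → β} (hY : IsRule t Y)
    (hn : 3 ≤ n) (hn' : 3 ≤ n') (h : IsChart G ψ) (h' : IsChart G' ψ') (hp : ψ p = some v)
    (hp' : ψ' p' = some v') (hview : localView t G x ident v = localView t G' x' ident' v') :
    Y (fun i => (ψ (p + i)).map fun v => (ident v, x v)) =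
      Y fun i => (ψ' (p' + i)).map fun v => (ident' v, x' v) := by
  rcases IsChart.map_eq_or_eq_neg hn hn' h h' ident ident' hp hp'
    (congrArg LocalView.center hview) (t := t) (fun s hs a ha a' ha' haa => by
      rw [image_neighborSet_eq_localView x hs ha, image_neighborSet_eq_localView x' hs ha', hview,
        haa]) with hnames | hnames
  · exact hY.congr fun i hi => h.map_prod_eq_of_localView_eq h' hp hp' hview hi hi (hnames i hi)
  · rw [← hY.comp_neg fun i => (ψ' (p' + i)).map fun v => (ident' v, x' v)]
    exact hY.congr fun i hi =>
      h.map_prod_eq_of_localView_eq h' hp hp' hview hi (by rwa [abs_neg]) (hnames i hi)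

theorem LabelingProblem.localSolvable_of_isRule [Nonempty O] {P : LabelingProblem I O}
    {F : GraphFamily} {c : ℕ} (hn : 3 ≤ n) {Y : (ℤ → Option (ℕ × I)) → ℕ × I → O} (hY : IsRule t Y)
    (hsol : ∀ G ∈ F n, ∃ ψ, IsChart G ψ ∧ ∀ (x : Fin n → I) (ident : Fin n ↪ ℕ),
      (∀ v, ident v ≤ n ^ c) → ∀ y : Fin n → O,
      (∀ p v, ψ p = some v →
        y v = Y (shiftBy (fun i => (ψ i).map fun v => (ident v, x v)) p) (ident v, x v)) →
      y ∈ P.sol G x) : P.LocalSolvable F c n t := by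
  let A (view : LocalView I) : Set O := {o | ∃ (G : SimpleGraph (Fin n)) (ψ : ℤ → Option (Fin n))
    (x : Fin n → I) (ident : Fin n ↪ ℕ) (p : ℤ) (v : Fin n), IsChart G ψ ∧ ψ p = some v ∧
    localView t G x ident v = view ∧
    o = Y (fun i => (ψ (p + i)).map fun v => (ident v, x v)) (ident v, x v)}
  refine ⟨fun view => pick (A view), fun G hG x ident hident => ?_⟩
  obtain ⟨ψ, h, hsol⟩ := hsol G hG
  refine hsol x ident (fun v => (hident v).2) _ fun p v hp => ?_
  obtain ⟨G', ψ', x', ident', p', v', h', hp', hview, ho⟩ :=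
    pick_mem (s := A (localView t G x ident v)) ⟨_, G, ψ, x, ident, p, v, h, hp, rfl, rfl⟩
  have hinfo : (ident' v', x' v') = (ident v, x v) := by
    have hcenter : ident' v' = ident v := congrArg LocalView.center hview
    simpa [hp, hp'] using h'.map_prod_eq_of_localView_eq h hp' hp hview (i := 0) (j := 0) (by simp)
      (by simp) (by simpa [hp, hp'] using hcenter)
  rw [hinfo, hY.apply_eq_of_localView_eq hn hn h' h hp' hp hview] at ho
  exact ho

end localView

/-- Whether the node at `0` is chosen by the greedy algorithm if the names are colored by `Yc`. -/
def ChosenByColor {I : Type*} (k q : ℕ) (Yc : (ℤ → Option ℕ) → ℕ) (z : ℤ → Option (ℕ × I)) : Prop :=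
  Chosen k q fun i => (z i).map fun _ => Yc fun j => (shiftBy z i j).map Prod.fst

theorem isRule_chosenByColor {I : Type*} {k q ρ : ℕ} {Yc : (ℤ → Option ℕ) → ℕ} (hYc : IsRule ρ Yc) :
    IsRule (k * q + ρ) (ChosenByColor (I := I) k q Yc) :=
  (isRule_chosen k q).comp (hYc.map Prod.fst) fun _ a => a

section chart

variable {I : Type*} {n k m q : ℕ} {G : SimpleGraph (Fin n)} {ψ : ℤ → Option (Fin n)}

theorem IsChart.isProper_map (h : IsChart G ψ) (ident : Fin n ↪ ℕ) (hk : k < n) :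
    IsProper k fun i => (ψ i).map ident := by
  intro i j hij hijk a ha hb
  obtain ⟨v, hv, rfl⟩ := Option.map_eq_some_iff.1 ha
  obtain ⟨w, hw, hvw⟩ := Option.map_eq_some_iff.1 hb
  obtain rfl := ident.injective hvw
  have := h.le_abs_sub hv hw hij
  omega

theorem IsChart.isRegularSeq_chosenByColor (h : IsChart G ψ) (ident : Fin n ↪ ℕ) (x : Fin n → I)
    (hk : k < n) (hm : ∀ v, ident v < m) {Yc : (ℤ → Option ℕ) → ℕ} (hYq : ∀ z, Yc z < q)
    (hYp : ∀ z, (∀ i, ∀ a ∈ z i, a < m) → IsProper k z →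
      IsProper k fun i => (z i).map fun _ => Yc (shiftBy z i)) :
    IsRegularSeq n k (nodeInfos ψ ident x fun i _ =>
      ChosenByColor k q Yc (shiftBy (fun j => (ψ j).map fun v => (ident v, x v)) i)) := by
  set z : ℤ → Option (ℕ × I) := fun j => (ψ j).map fun v => (ident v, x v) with hz
  set zc : ℤ → Option ℕ := fun i => (z i).map fun _ => Yc fun j => (shiftBy z i j).map Prod.fst
    with hzc
  have hfst (i : ℤ) : (z i).map Prod.fst = (ψ i).map ident := Option.map_map ..
  have hproper : IsProper k zc := by
    have := hYp (fun i => (z i).map Prod.fst) (fun i a ha => ?_)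
      (by simpa only [hfst] using h.isProper_map ident hk)
    · simp only [Option.map_map] at this
      exact this
    · rw [hfst] at ha
      obtain ⟨v, -, rfl⟩ := Option.map_eq_some_iff.1 ha
      exact hm v
  have hchosen (i : ℤ) : ChosenByColor k q Yc (shiftBy z i) = Chosen k q (shiftBy zc i) := by
    simp only [ChosenByColor, shiftBy_shiftBy]
    rfl
  simp only [hchosen]
  refine h.isRegularSeq ident x (fun i j _ _ _ _ hi hj => hi.lt_abs_sub hproper hj)
    fun i v hv => ?_
  obtain ⟨j, hji, hj⟩ := Chosen.exists_near (k := k) (z := zc) (i := i)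
    (a := Yc fun j => (shiftBy z i j).map Prod.fst) (by simp only [hzc, hz, hv, Option.map_some])
    (hYq _)
  obtain ⟨w, hw⟩ : ∃ w, ψ j = some w := by
    simpa [hzc, hz, shiftBy_apply, Option.ne_none_iff_exists'] using hj.ne_none
  exact ⟨j, w, hji, hw, hj⟩

end chart

theorem LabelingProblem.Completable.exists_localSolvable {I O : Type*} [Nonempty O]
    {P : LabelingProblem I O} {F : GraphFamily} (hF : IsPathCycleFamily F)
    (h : P.Completable (F ≠ cycles)) (c : ℕ) :
    ∃ C, ∀ᶠ n in atTop, P.LocalSolvable F c n (C * logStar n + C) := by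
  obtain ⟨ρ, k, n₀, Y, hY, hsol⟩ := h
  obtain ⟨q, hq⟩ := exists_eventually_colorReducible_pow k c
  refine ⟨ρ + k * q + 2 * k, ?_⟩
  filter_upwards [hq, eventually_ge_atTop n₀, eventually_ge_atTop 3, eventually_gt_atTop k] with
    n ⟨Yc, hYc, hYq, hYp⟩ hn₀ hn hk
  have hchosen := isRule_chosenByColor (I := I) (k := k) (q := q) hYc
  have hrule : IsRule (ρ + (k * q + 2 * k * logStar n)) fun z (a : ℕ × I) =>
      Y (fun i => (z i).map fun a => ⟨a.1, a.2, ChosenByColor k q Yc (shiftBy z i)⟩)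
        ⟨a.1, a.2, ChosenByColor k q Yc z⟩ := by
    have hcomp := hY.comp hchosen fun (a : ℕ × I) m => ⟨a.1, a.2, m⟩
    exact ⟨fun z z' hz => by rw [hcomp.congr hz, (hchosen.mono (by omega)).congr hz],
      fun z => by rw [hcomp.comp_neg, hchosen.comp_neg]⟩
  refine localSolvable_of_isRule hn (hrule.mono ?_) fun G hG => ?_
  · nlinarith [Nat.zero_le (ρ * logStar n), Nat.zero_le (k * q * logStar n)]
  · obtain ⟨ψ, hψ, hFψ⟩ := hF.exists_chart hG
    refine ⟨ψ, hψ, fun x ident hident y hy => ?_⟩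
    refine hsol hn₀ hψ (fun i hi hcyc => hFψ hcyc i hi) (hψ.isRegularSeq_chosenByColor ident x hk
      (fun v => Nat.lt_succ_of_le (hident v)) hYq hYp) fun p v hp => ?_
    rw [hy p v hp]
    refine congrArg (Y · _) (funext fun i => ?_)
    simp only [shiftBy_shiftBy]
    simp only [shiftBy_apply, Option.map_map]
    rfl

/-! ### The online-LOCAL model -/

theorem onlineRun_eq {I O : Type*} {n : ℕ} {a : OnlineView n I O → O} {t : ℕ}
    {G : SimpleGraph (Fin n)} {x : Fin n → I} {σ : Equiv.Perm (Fin n)} (m : ℕ) (v : Fin n) :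
    onlineRun a t G x σ m v = if (σ.symm v : ℕ) < m then
      some (a (onlineView t G x σ (σ.symm v) (onlineRun a t G x σ (σ.symm v)))) else none := by
  induction m with
  | zero => simp [onlineRun]
  | succ m ih =>
    rw [onlineRun]
    split_ifs with hm hv hv
    · rcases eq_or_ne v (σ ⟨m, hm⟩) with rfl | hne
      · simp
      · have hvm : (σ.symm v : ℕ) ≠ m := fun h =>
          hne (σ.symm.injective (by rw [σ.symm_apply_apply, ← Fin.val_inj, h]))
        rw [Function.update_of_ne hne, ih, if_pos (by omega)]
    · rw [Function.update_of_ne, ih, if_neg (by omega)]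
      rintro rfl
      simp at hv
    · rw [ih, if_pos (by omega)]
    · have := (σ.symm v).2
      omega

section reveal

variable {n t R k j : ℕ} {G G' : SimpleGraph (Fin n)} {σ σ' : Equiv.Perm (Fin n)} {u w i : Fin n}

theorem nbhd_subset_revealed (hi : (i : ℕ) ≤ j) : nbhd G t (σ i) ⊆ revealed t G σ j :=
  fun _ hu => ⟨i, hi, hu⟩

/-- Two graphs and orders that have revealed the same up to time `j`. -/
structure SameReveal (t : ℕ) (G G' : SimpleGraph (Fin n)) (σ σ' : Equiv.Perm (Fin n)) (j : ℕ) :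
    Prop where
  order : ∀ ⦃i : Fin n⦄, (i : ℕ) ≤ j → σ i = σ' i
  nodes : revealed t G σ j = revealed t G' σ' j
  graph : (G.induce (revealed t G σ j)).spanningCoe = (G'.induce (revealed t G' σ' j)).spanningCoe

theorem sameReveal_of_onlineView_eq {I O : Type*} {x x' : Fin n → I} {j j' : Fin n}
    {y y' : Fin n → Option O} (h : onlineView t G x σ j y = onlineView t G' x' σ' j' y') :
    j = j' ∧ SameReveal t G G' σ σ' j ∧ ∀ u ∈ revealed t G σ j, x u = x' u := by
  have horder := congrArg OnlineView.order h
  have hgraph := congrArg OnlineView.graph h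
  have hinput := congrArg OnlineView.input h
  simp only [onlineView] at horder hgraph hinput
  obtain rfl : j = j' := by
    have := congrArg List.length horder
    simp only [List.length_map, List.length_take, List.length_finRange] at this
    omega
  have hnodes : revealed t G σ j = revealed t G' σ' j := by
    ext u
    have := congrFun hinput u
    unfold restrictInput at this
    split_ifs at this <;> simp_all
  refine ⟨rfl, ⟨fun i hi => ?_, hnodes, hgraph⟩, fun u hu => ?_⟩
  · have := congrArg (fun l => l[(i : ℕ)]?) horder
    simpa [List.getElem?_take, show (i : ℕ) < j + 1 by omega] using this
  · have := congrFun hinput u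
    rw [restrictInput, restrictInput, if_pos hu, if_pos (hnodes ▸ hu)] at this
    exact Option.some_injective _ this

theorem SameReveal.symm (h : SameReveal t G G' σ σ' j) : SameReveal t G' G σ' σ j where
  order _ hi := (h.order hi).symm
  nodes := h.nodes.symm
  graph := h.graph.symm

theorem SameReveal.adj (h : SameReveal t G G' σ σ' j) (hu : u ∈ revealed t G σ j)
    (hw : w ∈ revealed t G σ j) (huw : G.Adj u w) : G'.Adj u w := by
  have := spanningCoe_induce_adj.2 ⟨huw, hu, hw⟩
  rw [h.graph] at this
  exact (spanningCoe_induce_adj.1 this).1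

theorem SameReveal.nbhd_eq (h : SameReveal t G G' σ σ' j) (hi : (i : ℕ) ≤ j) {s : ℕ} (hs : s ≤ t) :
    nbhd G s (σ i) = nbhd G' s (σ' i) := by
  rw [← nbhd_spanningCoe_induce ((nbhd_mono hs _).trans (nbhd_subset_revealed hi)), h.graph,
    h.order hi, nbhd_spanningCoe_induce ((nbhd_mono hs _).trans (nbhd_subset_revealed hi))]

theorem SameReveal.mem_nbhd (h : SameReveal t G G' σ σ' j) (hi : (i : ℕ) ≤ j) {s : ℕ} (hs : s ≤ t)
    (hu : u ∈ nbhd G s (σ i)) : u ∈ nbhd G' s (σ' i) :=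
  h.nbhd_eq hi hs ▸ hu

theorem nbhd_subset_revealed_of_mem (hRk : R + k ≤ t) (hi : (i : ℕ) ≤ j) (hu : u ∈ nbhd G R (σ i)) :
    nbhd G k u ⊆ revealed t G σ j :=
  fun _ hw => nbhd_subset_revealed hi (nbhd_mono hRk _ (mem_nbhd_trans hu hw))

theorem SameReveal.nbhd_eq_of_mem (h : SameReveal t G G' σ σ' j) (hRk : R + k ≤ t)
    (hi : (i : ℕ) ≤ j) (hu : u ∈ nbhd G R (σ i)) : nbhd G k u = nbhd G' k u := by
  rw [← nbhd_spanningCoe_induce (nbhd_subset_revealed_of_mem hRk hi hu), h.graph,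
    nbhd_spanningCoe_induce (nbhd_subset_revealed_of_mem hRk hi (h.mem_nbhd hi (by omega) hu))]

theorem SameReveal.neighborSet_eq (h : SameReveal t G G' σ σ' j) (hi : (i : ℕ) ≤ j) {s : ℕ}
    (hs : s < t) (hu : u ∈ nbhd G s (σ i)) : G.neighborSet u = G'.neighborSet u := by
  have hadj {G G' : SimpleGraph (Fin n)} {σ σ' : Equiv.Perm (Fin n)}
      (h : SameReveal t G G' σ σ' j) (hu : u ∈ nbhd G s (σ i)) {w : Fin n} (huw : G.Adj u w) :
      G'.Adj u w :=
    h.adj (nbhd_subset_revealed_of_mem hs hi hu (self_mem_nbhd G 1 u))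
      (nbhd_subset_revealed_of_mem hs hi hu (mem_nbhd_of_adj huw)) huw
  ext w
  exact ⟨hadj h hu, hadj h.symm (h.mem_nbhd hi hs.le hu)⟩

end reveal

theorem LabelingProblem.randOnlineSolvable_of_forall {I O : Type*} [Nonempty O]
    {P : LabelingProblem I O} {F : GraphFamily} {n t : ℕ}
    (f : SimpleGraph (Fin n) → (Fin n → I) → Equiv.Perm (Fin n) → Fin n → O)
    (hsol : ∀ G ∈ F n, ∀ x σ, f G x σ ∈ P.sol G x)
    (hf : ∀ G ∈ F n, ∀ G' ∈ F n, ∀ x x' σ σ' (j : Fin n), SameReveal t G G' σ σ' j →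
      (∀ u ∈ revealed t G σ j, x u = x' u) → f G x σ (σ j) = f G' x' σ' (σ' j)) :
    P.RandOnlineSolvable F n t := by
  classical
  let A (view : OnlineView n I O) : Set O := {o | ∃ G ∈ F n, ∃ x σ, ∃ j : Fin n, ∃ y,
    onlineView t G x σ j y = view ∧ o = f G x σ (σ j)}
  refine ⟨PMF.pure fun view => pick (A view), fun G hG x σ => ?_⟩
  rw [PMF.toOuterMeasure_pure_apply, if_neg]
  · exact zero_le
  · refine not_not.2 ⟨f G x σ, hsol G hG x σ, funext fun v => ?_⟩
    rw [onlineRun_eq, if_pos (σ.symm v).2]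
    obtain ⟨G', hG', x', σ', j', y', hview, ho⟩ :=
      pick_mem (s := A (onlineView t G x σ _ _)) ⟨_, G, hG, x, σ, σ.symm v, _, rfl, rfl⟩
    obtain ⟨rfl, hs, hx⟩ := sameReveal_of_onlineView_eq hview
    rw [ho, hf G' hG' G hG x' x σ' σ _ hs hx, σ.apply_symm_apply]

theorem localView_spanningCoe_induce {I : Type*} {n t : ℕ} {G : SimpleGraph (Fin n)}
    {x x' : Fin n → I} {ident : Fin n ↪ ℕ} {v : Fin n} {U : Set (Fin n)} (hU : nbhd G t v ⊆ U)
    (hx : ∀ u ∈ U, x u = x' u) :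
    localView t (G.induce U).spanningCoe x ident v = localView t G x' ident v := by
  have hgraph : (((G.induce U).spanningCoe).induce (nbhd G t v)).spanningCoe =
      (G.induce (nbhd G t v)).spanningCoe := by
    ext u w
    simp only [spanningCoe_induce_adj]
    exact ⟨fun ⟨⟨huw, _⟩, hmem⟩ => ⟨huw, hmem⟩,
      fun ⟨huw, hu, hw⟩ => ⟨⟨huw, hU hu, hU hw⟩, hu, hw⟩⟩
  have hinput : restrictInput x (nbhd G t v) = restrictInput x' (nbhd G t v) := by
    funext u
    unfold restrictInput
    split_ifs with hu
    · rw [hx u (hU hu)]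
    · rfl
  rw [localView, localView, nbhd_spanningCoe_induce hU, hgraph, hinput]

theorem LabelingProblem.LocalSolvable.randOnlineSolvable {I O : Type*} {P : LabelingProblem I O}
    {F : GraphFamily} {c n t : ℕ} (hc : 1 ≤ c) (h : P.LocalSolvable F c n t) :
    P.RandOnlineSolvable F n t := by
  obtain ⟨a, ha⟩ := h
  have : Nonempty O := ⟨a ⟨0, ⊥, fun _ => none⟩⟩
  let ident : Fin n ↪ ℕ := ⟨fun v => v + 1, fun v w hvw => Fin.ext (Nat.succ_injective hvw)⟩
  have hident (v : Fin n) : 1 ≤ ident v ∧ ident v ≤ n ^ c :=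
    ⟨Nat.le_add_left 1 v, (Nat.succ_le_of_lt v.2).trans (Nat.le_self_pow (by omega) n)⟩
  refine randOnlineSolvable_of_forall (fun G x _ v => a (localView t G x ident v))
    (fun G hG x _ => ha G hG x ident hident) fun G _ G' _ x x' σ σ' j hs hx => ?_
  rw [← localView_spanningCoe_induce (nbhd_subset_revealed le_rfl) fun _ _ => rfl, hs.graph,
    hs.order le_rfl, localView_spanningCoe_induce (nbhd_subset_revealed le_rfl) fun u hu =>
      hx u (hs.nodes ▸ hu)]

/-! ### Greedy choices in the online-LOCAL model -/

/-- The greedy maximal set of nodes at pairwise distance more than `k`, where nodes are considered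
by increasing `key`. -/
def Greedy {V : Type*} (G : SimpleGraph V) (k : ℕ) (key : V → ℕ) (u : V) : Prop :=
  ∀ w, w ∈ nbhd G k u → key w < key u → ¬ Greedy G k key w
termination_by key u

section greedy

variable {V : Type*} {G : SimpleGraph V} {k : ℕ} {key : V → ℕ} {u w : V}

theorem Greedy.notMem_nbhd (hkey : Function.Injective key) (hu : Greedy G k key u)
    (hw : Greedy G k key w) (huw : u ≠ w) : w ∉ nbhd G k u := by
  intro hmem
  rcases lt_or_gt_of_ne (hkey.ne huw) with hlt | hlt
  · rw [Greedy] at hw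
    exact hw u (mem_nbhd_comm.1 hmem) hlt hu
  · rw [Greedy] at hu
    exact hu w hmem hlt hw

theorem exists_greedy_mem_nbhd (G : SimpleGraph V) (k : ℕ) (key : V → ℕ) (u : V) :
    ∃ w ∈ nbhd G k u, Greedy G k key w := by
  by_cases hu : Greedy G k key u
  · exact ⟨u, self_mem_nbhd G k u, hu⟩
  · rw [Greedy] at hu
    push Not at hu
    obtain ⟨w, hw, -, hgreedy⟩ := hu
    exact ⟨w, hw, hgreedy⟩

end greedy

section revealKey

variable {n t j k R : ℕ} {G G' : SimpleGraph (Fin n)} {σ σ' : Equiv.Perm (Fin n)} {u w i : Fin n}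

/-- The first time at which a node within distance `R` of `u` is presented. -/
noncomputable def firstReveal (R : ℕ) (G : SimpleGraph (Fin n)) (σ : Equiv.Perm (Fin n))
    (u : Fin n) : ℕ :=
  sInf {j | ∃ i : Fin n, (i : ℕ) = j ∧ u ∈ nbhd G R (σ i)}

/-- Nodes are ordered by the time at which they are revealed, then by name. -/
noncomputable def revealKey (R : ℕ) (G : SimpleGraph (Fin n)) (σ : Equiv.Perm (Fin n))
    (u : Fin n) : ℕ :=
  firstReveal R G σ u * n + u

theorem exists_eq_firstReveal (R : ℕ) (G : SimpleGraph (Fin n)) (σ : Equiv.Perm (Fin n))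
    (u : Fin n) : ∃ i : Fin n, (i : ℕ) = firstReveal R G σ u ∧ u ∈ nbhd G R (σ i) :=
  Nat.sInf_mem (s := {j | ∃ i : Fin n, (i : ℕ) = j ∧ u ∈ nbhd G R (σ i)})
    ⟨_, σ.symm u, rfl, by rw [σ.apply_symm_apply]; exact self_mem_nbhd G R u⟩

theorem firstReveal_le (hu : u ∈ nbhd G R (σ i)) : firstReveal R G σ u ≤ i :=
  Nat.sInf_le ⟨i, rfl, hu⟩

theorem revealKey_injective : Function.Injective (revealKey R G σ) := by
  intro u w h
  have hmod := congrArg (· % n) h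
  simp only [revealKey, Nat.mul_add_mod_self_right, Nat.mod_eq_of_lt u.2,
    Nat.mod_eq_of_lt w.2] at hmod
  exact Fin.ext hmod

theorem firstReveal_le_of_revealKey_lt (h : revealKey R G σ w < revealKey R G σ u) :
    firstReveal R G σ w ≤ firstReveal R G σ u := by
  by_contra! hlt
  have hmul := Nat.mul_le_mul_right n (Nat.succ_le_of_lt hlt)
  have := u.2
  rw [revealKey, revealKey] at h
  rw [Nat.succ_mul] at hmul
  omega

theorem SameReveal.revealKey_eq (h : SameReveal t G G' σ σ' j) (hR : R ≤ t) (hi : (i : ℕ) ≤ j)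
    (hu : u ∈ nbhd G R (σ i)) : revealKey R G σ u = revealKey R G' σ' u := by
  have hle {G G' : SimpleGraph (Fin n)} {σ σ' : Equiv.Perm (Fin n)}
      (h : SameReveal t G G' σ σ' j) (hu : u ∈ nbhd G R (σ i)) :
      firstReveal R G' σ' u ≤ firstReveal R G σ u := by
    obtain ⟨l, hl, hul⟩ := exists_eq_firstReveal R G σ u
    rw [← hl]
    refine firstReveal_le ?_
    rwa [← h.nbhd_eq (hl.trans_le ((firstReveal_le hu).trans hi)) hR]
  rw [revealKey, revealKey, (hle h.symm (h.mem_nbhd hi hR hu)).antisymm (hle h hu)]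

theorem SameReveal.greedy (h : SameReveal t G G' σ σ' j) (hRk : R + k ≤ t) (hi : (i : ℕ) ≤ j)
    (hu : u ∈ nbhd G R (σ i)) (hgreedy : Greedy G k (revealKey R G σ) u) :
    Greedy G' k (revealKey R G' σ') u := by
  induction hm : revealKey R G σ u using Nat.strong_induction_on generalizing G G' σ σ' u i with
  | h m ih =>
    rw [Greedy] at hgreedy ⊢
    intro w hw hlt hgreedyw
    rw [← h.nbhd_eq_of_mem hRk hi hu] at hw
    obtain ⟨l, hl, hwl⟩ := exists_eq_firstReveal R G' σ' w
    have hlj : (l : ℕ) ≤ j := by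
      have := firstReveal_le_of_revealKey_lt hlt
      have := firstReveal_le (h.mem_nbhd (s := R) hi (by omega) hu)
      omega
    rw [h.symm.revealKey_eq (by omega) hlj hwl, ← h.revealKey_eq (by omega) hi hu] at hlt
    exact hgreedy w hw hlt (ih _ (by rw [← hm, h.symm.revealKey_eq (by omega) hlj hwl]; exact hlt)
      h.symm hlj hwl hgreedyw rfl)

theorem SameReveal.greedy_iff (h : SameReveal t G G' σ σ' i) (hRk : R + k ≤ t)
    (hu : u ∈ nbhd G R (σ i)) :
    Greedy G k (revealKey R G σ) u ↔ Greedy G' k (revealKey R G' σ') u :=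
  ⟨h.greedy hRk le_rfl hu, h.symm.greedy hRk le_rfl (h.mem_nbhd le_rfl (by omega) hu)⟩

/-- The sequence of nodes of a chart, where the nodes are named by their numbers and the chosen
nodes are those that are chosen greedily as they are revealed. -/
def revealInfos {I : Type*} (R k : ℕ) (G : SimpleGraph (Fin n)) (ψ : ℤ → Option (Fin n))
    (x : Fin n → I) (σ : Equiv.Perm (Fin n)) : ℤ → Option (NodeInfo I) :=
  nodeInfos ψ Fin.val x fun _ => Greedy G k (revealKey R G σ)

theorem IsChart.isRegularSeq_revealInfos {I : Type*} {ψ : ℤ → Option (Fin n)} (h : IsChart G ψ)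
    (x : Fin n → I) (hk : k < n) : IsRegularSeq n k (revealInfos R k G ψ x σ) := by
  refine h.isRegularSeq Fin.valEmbedding x (fun i j v w hv hw hgv hgw hij => ?_) fun i v hv => ?_
  · by_contra! hle
    rcases eq_or_ne v w with rfl | hvw
    · have := h.le_abs_sub hv hw hij
      omega
    · refine hgv.notMem_nbhd revealKey_injective hgw hvw ((h.mem_nbhd_iff hv).2 ⟨j - i, ?_, ?_⟩)
      · rwa [abs_sub_comm]
      · rwa [add_sub_cancel]
  · obtain ⟨w, hw, hgreedy⟩ := exists_greedy_mem_nbhd G k (revealKey R G σ) v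
    obtain ⟨l, hl, hwl⟩ := (h.mem_nbhd_iff hv).1 hw
    exact ⟨i + l, w, by rwa [add_sub_cancel_left], hwl, hgreedy⟩

theorem SameReveal.apply_revealInfos_eq {I β : Type*} {x x' : Fin n → I} {i : Fin n}
    {ψ ψ' : ℤ → Option (Fin n)} {p p' : ℤ} {Y : (ℤ → Option (NodeInfo I)) → β} (hY : IsRule R Y)
    (hn : 3 ≤ n) (h : SameReveal t G G' σ σ' i) (hRk : R + k ≤ t)
    (hx : ∀ u ∈ revealed t G σ i, x u = x' u) (hψ : IsChart G ψ) (hψ' : IsChart G' ψ')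
    (hp : ψ p = some (σ i)) (hp' : ψ' p' = some (σ' i)) :
    Y (shiftBy (revealInfos R k G ψ x σ) p) = Y (shiftBy (revealInfos R k G' ψ' x' σ') p') := by
  have hinfos {l l' : ℤ} (hl : |l| ≤ R) (heq : ψ (p + l) = ψ' (p' + l')) :
      revealInfos R k G ψ x σ (p + l) = revealInfos R k G' ψ' x' σ' (p' + l') := by
    rw [revealInfos, revealInfos, nodeInfos, nodeInfos, ← heq]
    refine Option.map_congr fun v hv => ?_
    have hmem : v ∈ nbhd G R (σ i) := (hψ.mem_nbhd_iff hp).2 ⟨l, hl, hv⟩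
    rw [hx v (nbhd_subset_revealed le_rfl (nbhd_mono (by omega) _ hmem)), h.greedy_iff hRk hmem]
  have hmap := IsChart.map_eq_or_eq_neg hn hn hψ hψ' (.refl _) (.refl _) hp hp' (t := R)
    (h.order le_rfl) fun s hs a ha a' _ haa => by
      obtain rfl : a = a' := haa
      rw [h.neighborSet_eq le_rfl (by omega) ha]
  simp only [Function.Embedding.coe_refl, Option.map_id, id_eq] at hmap
  rcases hmap with hmap | hmap
  · exact hY.congr fun l hl => hinfos hl (hmap l hl)
  · rw [← hY.comp_neg (shiftBy (revealInfos R k G' ψ' x' σ') p')]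
    exact hY.congr fun l hl => hinfos hl (hmap l hl)

end revealKey

theorem LabelingProblem.Completable.exists_randOnlineSolvable {I O : Type*} [Nonempty O]
    {P : LabelingProblem I O} {F : GraphFamily} (hF : IsPathCycleFamily F)
    (h : P.Completable (F ≠ cycles)) : ∃ t, ∀ᶠ n in atTop, P.RandOnlineSolvable F n t := by
  obtain ⟨ρ, k, n₀, Y, hY, hsol⟩ := h
  refine ⟨ρ + k, ?_⟩
  filter_upwards [eventually_ge_atTop n₀, eventually_ge_atTop 3, eventually_gt_atTop k] with
    n hn₀ hn hk
  choose! ψ hψ hFψ using fun G (hG : G ∈ F n) => hF.exists_chart hG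
  choose! pos hpos using fun G hG => (hψ G hG).surj
  refine randOnlineSolvable_of_forall
    (fun G x σ v => Y (shiftBy (revealInfos ρ k G (ψ G) x σ) (pos G v))
      ⟨v, x v, Greedy G k (revealKey ρ G σ) v⟩)
    (fun G hG x σ => ?_) fun G hG G' hG' x x' σ σ' j hs hx => ?_
  · refine hsol hn₀ (hψ G hG) (fun i hi hcyc => hFψ G hG hcyc i hi)
      ((hψ G hG).isRegularSeq_revealInfos (R := ρ) (σ := σ) x hk) fun p v hp => ?_
    change Y (revealInfos ρ k G (shiftBy (ψ G) (pos G v)) x σ) _ =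
      Y (revealInfos ρ k G (shiftBy (ψ G) p) x σ) _
    rw [(hψ G hG).shiftBy_eq (hpos G hG v) hp]
  · simp only [← hs.order le_rfl, ← hx (σ j) (nbhd_subset_revealed le_rfl (self_mem_nbhd G _ _)),
      ← hs.greedy_iff le_rfl (self_mem_nbhd G ρ (σ j))]
    exact congrFun (hs.apply_revealInfos_eq hY hn le_rfl hx (hψ G hG) (hψ G' hG') (hpos G hG _)
      ((hpos G' hG' _).trans (congrArg some (hs.order le_rfl)))) _

/-! ### Far apart nodes in the online-LOCAL model -/

section farApart

variable {I O : Type*} {n t j K : ℕ} {G G' : SimpleGraph (Fin n)} {σ : Equiv.Perm (Fin n)}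

theorem sameReveal_of_neighborSet_eq (h : ∀ i : Fin n, (i : ℕ) ≤ j → ∀ u ∈ nbhd G t (σ i),
    G.neighborSet u = G'.neighborSet u) : SameReveal t G G' σ σ j := by
  have hnbhd (i : Fin n) (hi : (i : ℕ) ≤ j) : nbhd G t (σ i) = nbhd G' t (σ i) :=
    nbhd_congr fun s hs u hu w => Set.ext_iff.1 (h i hi u (nbhd_mono hs.le _ hu)) w
  have hnodes : revealed t G σ j = revealed t G' σ j :=
    Set.ext fun u => exists_congr fun i => and_congr_right fun hi => by rw [hnbhd i hi]
  refine ⟨fun _ _ => rfl, hnodes, ?_⟩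
  ext u w
  rw [spanningCoe_induce_adj, spanningCoe_induce_adj, ← hnodes]
  refine and_congr_left fun ⟨⟨i, hi, hu⟩, _⟩ => ?_
  exact Set.ext_iff.1 (h i hi u hu) w

theorem SameReveal.onlineView_eq (h : SameReveal t G G' σ σ j) (x : Fin n → I)
    (y : Fin n → Option O) : onlineView t G x σ j y = onlineView t G' x σ j y := by
  rw [onlineView, onlineView, h.graph, h.nodes]

theorem onlineRun_eq_of_neighborSet_eq (h : ∀ i : Fin n, (i : ℕ) < K → ∀ u ∈ nbhd G t (σ i),
    G.neighborSet u = G'.neighborSet u) (a : OnlineView n I O → O) (x : Fin n → I) {m : ℕ}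
    (hm : m ≤ K) : onlineRun a t G x σ m = onlineRun a t G' x σ m := by
  induction m with
  | zero => rfl
  | succ m ih =>
    have hs : SameReveal t G G' σ σ m := sameReveal_of_neighborSet_eq fun i hi => h i (by omega)
    rw [onlineRun, onlineRun, ih (by omega), hs.onlineView_eq]

theorem exists_perm_of_nodup {l : List (Fin n)} (hl : l.Nodup) :
    ∃ σ : Equiv.Perm (Fin n), ∀ (i : Fin n) (h : (i : ℕ) < l.length), σ i = l[(i : ℕ)] := by
  have hn : l.length ≤ n := by simpa using hl.length_le_card
  let f : {i : Fin n // (i : ℕ) < l.length} ≃ Fin l.length :=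
    ⟨fun i => ⟨i.1, i.2⟩, fun i => ⟨⟨i, by omega⟩, i.2⟩, fun _ => rfl, fun _ => rfl⟩
  let e := f.trans (hl.getEquiv l)
  exact ⟨e.extendSubtype, fun i h => e.extendSubtype_apply_of_mem i h⟩

theorem exists_perm_lt_iff_mem (A : Finset (Fin n)) :
    ∃ σ : Equiv.Perm (Fin n), ∀ i : Fin n, (i : ℕ) < A.card ↔ σ i ∈ A := by
  obtain ⟨σ, hσ⟩ := exists_perm_of_nodup A.nodup_toList
  have hA : A.card ≤ n := by simpa using A.card_le_univ
  refine ⟨σ, fun i => ⟨fun hi => ?_, fun hi => ?_⟩⟩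
  · rw [hσ i (by simpa using hi)]
    exact A.mem_toList.1 (List.getElem_mem _)
  · obtain ⟨k, hk, hik⟩ := List.getElem_of_mem (A.mem_toList.2 hi)
    rw [A.length_toList] at hk
    rw [← σ.injective ((hσ ⟨k, hk.trans_le hA⟩ (by simpa using hk)).trans hik)]
    exact hk

theorem exists_forall_notMem_of_toOuterMeasure_le {α ι : Type*} [Fintype ι] (A : PMF α)
    (bad : ι → Set α) (h : ∀ j, A.toOuterMeasure (bad j) ≤ (n : ℝ≥0∞)⁻¹)
    (hn : Fintype.card ι < n) : ∃ a, ∀ j, a ∉ bad j := by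
  by_contra! hbad
  have hunion : A.toOuterMeasure (⋃ j, bad j) = 1 :=
    (A.toOuterMeasure_apply_eq_one_iff _).2 fun a _ => Set.mem_iUnion.2 (hbad a)
  have hle : (1 : ℝ≥0∞) ≤ Fintype.card ι / n := by
    calc (1 : ℝ≥0∞) = A.toOuterMeasure (⋃ j, bad j) := hunion.symm
      _ ≤ ∑ j, A.toOuterMeasure (bad j) := MeasureTheory.measure_iUnion_fintype_le _ _
      _ ≤ ∑ _j : ι, (n : ℝ≥0∞)⁻¹ := Finset.sum_le_sum fun j _ => h j
      _ = Fintype.card ι / n := by simp [div_eq_mul_inv]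
  rw [ENNReal.le_div_iff_mul_le (by simp; omega) (by simp), one_mul, Nat.cast_le] at hle
  omega

theorem LabelingProblem.RandOnlineSolvable.exists_eqOn {P : LabelingProblem I O} {F : GraphFamily}
    (hP : P.RandOnlineSolvable F n t) {ι : Type*} [Fintype ι] (hι : Fintype.card ι < n)
    {G : ι → SimpleGraph (Fin n)} (hG : ∀ j, G j ∈ F n) (x : Fin n → I) {U : Set (Fin n)}
    (hU : ∀ j j', ∀ v ∈ U, ∀ u ∈ nbhd (G j) t v, (G j).neighborSet u = (G j').neighborSet u) :
    ∃ y : ι → Fin n → O, (∀ j, y j ∈ P.sol (G j) x) ∧ ∀ j j', Set.EqOn (y j) (y j') U := by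
  classical
  obtain ⟨A, hA⟩ := hP
  -- the nodes of `U` are presented first, before the algorithm can tell the graphs apart
  obtain ⟨σ, hσ⟩ := exists_perm_lt_iff_mem U.toFinset
  simp only [Set.mem_toFinset] at hσ
  obtain ⟨a, ha⟩ :=
    exists_forall_notMem_of_toOuterMeasure_le A _ (fun j => hA (G j) (hG j) x σ) hι
  simp only [Set.mem_ofPred_eq, not_not] at ha
  choose y hy hrun using ha
  refine ⟨y, hy, fun j j' v hv => ?_⟩
  have hlt := (hσ (σ.symm v)).2 (by rwa [σ.apply_symm_apply])
  have hsame := fun i hi => hU j j' (σ i) ((hσ i).1 hi)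
  have hj := congrFun (hrun j) v
  have hj' := congrFun (hrun j') v
  rw [onlineRun_eq, if_pos (σ.symm v).2] at hj hj'
  have hview : SameReveal t (G j) (G j') σ σ (σ.symm v) :=
    sameReveal_of_neighborSet_eq fun i hi => hsame i (by omega)
  rw [onlineRun_eq_of_neighborSet_eq hsame a x hlt.le, hview.onlineView_eq, hj'] at hj
  exact (Option.some_injective _ hj).symm

end farApart

/-! ### Arrangements of fragments -/

section occurs

variable {α : Type*} {ψ : ℤ → Option α} {a : ℤ} {l l' : List α}

/-- The sequence `ψ` contains the list `l` at position `a`. -/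
def Occurs (ψ : ℤ → Option α) (a : ℤ) (l : List α) : Prop :=
  ∀ (i : ℕ) (h : i < l.length), ψ (a + i) = some l[i]

theorem occurs_append : Occurs ψ a (l ++ l') ↔ Occurs ψ a l ∧ Occurs ψ (a + l.length) l' := by
  constructor
  · refine fun h => ⟨fun i hi => ?_, fun i hi => ?_⟩
    · rw [h i (by simp; omega), List.getElem_append_left hi]
    · have := h (l.length + i) (by simpa using hi)
      rw [List.getElem_append_right (by omega)] at this
      simpa [add_assoc] using this
  · rintro ⟨hl, hl'⟩ i hi
    rw [List.getElem_append]
    split_ifs with h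
    · exact hl i h
    · rw [← hl' (i - l.length) (by simp at hi; omega)]
      congr 1
      omega

theorem Occurs.shiftBy (h : Occurs ψ a l) : Occurs (shiftBy ψ a) 0 l := fun i hi => by
  simpa [shiftBy_apply] using h i hi

theorem Occurs.reverse (h : Occurs ψ a l) :
    Occurs (fun i => ψ (-i)) (1 - a - l.length) l.reverse := fun i hi => by
  rw [List.length_reverse] at hi
  rw [List.getElem_reverse, ← h (l.length - 1 - i) (by omega)]
  exact congrArg ψ (by omega)

end occurs

section segment

variable {n t k : ℕ} {G G' : SimpleGraph (Fin n)} {l : List (Fin n)} {u : Fin n}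

/-- The nodes of `l` are consecutive on the path or cycle `G`. -/
def IsSegment (G : SimpleGraph (Fin n)) (l : List (Fin n)) : Prop :=
  ∃ ψ, IsChart G ψ ∧ Occurs ψ 0 l

theorem IsChart.isSegment {ψ : ℤ → Option (Fin n)} (hψ : IsChart G ψ) {a : ℤ}
    (h : Occurs ψ a l) : IsSegment G l :=
  ⟨_, hψ.recenter a, h.shiftBy⟩

namespace IsSegment

theorem of_reverse (h : IsSegment G l.reverse) : IsSegment G l := by
  obtain ⟨ψ, hψ, hocc⟩ := h
  exact hψ.neg.isSegment (l.reverse_reverse ▸ hocc.reverse)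

theorem neighborSet_getElem (h : IsSegment G l) (hk : 0 < k) (hkl : k + 1 < l.length) :
    G.neighborSet l[k] = {l[k + 1], l[k - 1]} := by
  obtain ⟨ψ, hψ, hocc⟩ := h
  ext w
  have hpred : (0 : ℤ) + k - 1 = 0 + (k - 1 : ℕ) := by omega
  rw [SimpleGraph.mem_neighborSet, hψ.adj_iff (hocc k (by omega)), hpred, hocc (k - 1) (by omega),
    add_assoc, ← Nat.cast_succ, hocc (k + 1) hkl]
  simp [eq_comm]

theorem exists_of_mem_nbhd (h : IsSegment G l) (hk : t ≤ k) (hkl : k + t < l.length)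
    (hu : u ∈ nbhd G t l[k]) : ∃ (i : ℕ) (hi : i < l.length), l[i] = u ∧ k ≤ i + t ∧ i ≤ k + t := by
  obtain ⟨ψ, hψ, hocc⟩ := h
  obtain ⟨j, hj, hju⟩ := (hψ.mem_nbhd_iff (hocc k (by omega))).1 hu
  rw [abs_le] at hj
  have hpos := hocc (k + j).toNat (by omega)
  rw [Int.toNat_of_nonneg (by omega), ← add_assoc, hju] at hpos
  exact ⟨(k + j).toNat, by omega, (Option.some_injective _ hpos).symm, by omega, by omega⟩

theorem neighborSet_eq_of_mem_nbhd (h : IsSegment G l) (h' : IsSegment G' l) (hk : t < k)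
    (hkl : k + t + 1 < l.length) (hu : u ∈ nbhd G t l[k]) : G.neighborSet u = G'.neighborSet u := by
  obtain ⟨i, hi, rfl, hik, hik'⟩ := h.exists_of_mem_nbhd hk.le (by omega) hu
  rw [h.neighborSet_getElem (by omega) (by omega), h'.neighborSet_getElem (by omega) (by omega)]

end IsSegment

end segment

section arrangement

variable {I A : Type*} {n t : ℕ}

theorem exists_disjoint_lists_map_eq [Fintype A] [Nonempty I] (W : A → List I)
    (hW : ∑ a, (W a).length ≤ n) : ∃ (N : A → List (Fin n)) (x : Fin n → I),
    (∀ a, (N a).Nodup) ∧ Pairwise (Function.onFun List.Disjoint N) ∧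
      ∀ a, (N a).map x = W a := by
  obtain ⟨e⟩ : Nonempty ((Σ a, Fin (W a).length) ↪ Fin n) :=
    Function.Embedding.nonempty_of_card_le (by simpa using hW)
  refine ⟨fun a => List.ofFn fun i => e ⟨a, i⟩,
    Function.extend e (fun p => (W p.1)[p.2]) fun _ => Classical.arbitrary I, fun a => ?_,
    fun a b hab v hva hvb => ?_, fun a => ?_⟩
  · exact List.nodup_ofFn.2 fun i j hij => by simpa using e.injective hij
  · obtain ⟨i, rfl⟩ := List.mem_ofFn.1 hva
    obtain ⟨j, hj⟩ := List.mem_ofFn.1 hvb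
    exact hab (congrArg Sigma.fst (e.injective hj)).symm
  · simp [List.map_ofFn, Function.comp_def, e.injective.extend_apply]

/-- The list `l`, read backwards if `s` holds. -/
def orientList {α : Type*} (s : Bool) (l : List α) : List α := if s then l.reverse else l

theorem mem_orientList {α : Type*} {s : Bool} {l : List α} {v : α} :
    v ∈ orientList s l ↔ v ∈ l := by
  cases s <;> simp [orientList]

theorem nodup_orientList {α : Type*} {s : Bool} {l : List α} :
    (orientList s l).Nodup ↔ l.Nodup := by
  cases s <;> simp [orientList]

/-- The concatenation of the oriented lists that `l₀` selects. -/
def arrange {α : Type*} (N : A → List α) (l₀ : List (A × Bool)) : List α :=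
  l₀.flatMap fun p => orientList p.2 (N p.1)

theorem nodup_arrange {α : Type*} {N : A → List α} (hN : ∀ a, (N a).Nodup)
    (hdisj : Pairwise (Function.onFun List.Disjoint N)) {l₀ : List (A × Bool)}
    (hl₀ : (l₀.map Prod.fst).Nodup) : (arrange N l₀).Nodup :=
  List.nodup_flatMap.2 ⟨fun p _ => nodup_orientList.2 (hN p.1),
    (List.pairwise_map.1 hl₀).imp fun h _ hp hq =>
      hdisj h (mem_orientList.1 hp) (mem_orientList.1 hq)⟩

theorem IsPathCycleFamily.exists_chart_occurs {F : GraphFamily} (hF : IsPathCycleFamily F)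
    (hn : 3 ≤ n) {l : List (Fin n)} (hl : l.Nodup) : ∃ G ∈ F n, ∃ ψ, IsChart G ψ ∧
      Occurs ψ 0 l ∧ (F ≠ cycles → ∀ i < 0, ψ i = none) := by
  obtain ⟨π, hπ⟩ := exists_perm_of_nodup hl
  obtain ⟨G, hG, ψ, hψ, hψπ, hnone⟩ := hF.exists_mem_of_perm hn π
  refine ⟨G, hG, ψ, hψ, fun i hi => ?_, hnone⟩
  have hin : i < n := hi.trans_le (by simpa using hl.length_le_card)
  rw [← hπ ⟨i, hin⟩ hi, ← hψπ, zero_add]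

theorem IsPathCycleFamily.exists_arrangement [Finite A] {F : GraphFamily}
    (hF : IsPathCycleFamily F) (hn : 3 ≤ n) {N : A → List (Fin n)} (hN : ∀ a, (N a).Nodup)
    (hdisj : Pairwise (Function.onFun List.Disjoint N)) {l₀ : List (A × Bool)}
    (hl₀ : (l₀.map Prod.fst).Nodup) : ∃ G ∈ F n, (∀ a, IsSegment G (N a)) ∧
      ∃ ψ, IsChart G ψ ∧ Occurs ψ 0 (arrange N l₀) ∧ (F ≠ cycles → ∀ i < 0, ψ i = none) := by
  classical
  have := Fintype.ofFinite A
  let rest := (Finset.univ.toList.filter (· ∉ l₀.map Prod.fst)).map fun a => (a, false)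
  have hnodup : ((l₀ ++ rest).map Prod.fst).Nodup := by
    simp only [rest, List.map_append, List.map_map, Function.comp_def, List.map_id']
    exact hl₀.append (Finset.univ.nodup_toList.filter _) fun a ha ha' => by simp_all
  have hmem (a : A) : ∃ s, (a, s) ∈ l₀ ++ rest := by
    by_cases ha : a ∈ l₀.map Prod.fst
    · obtain ⟨⟨_, s⟩, hs, rfl⟩ := List.mem_map.1 ha
      exact ⟨s, List.mem_append_left _ hs⟩
    · exact ⟨false, List.mem_append_right _ (List.mem_map.2 ⟨a, by simpa using ha, rfl⟩)⟩
  obtain ⟨G, hG, ψ, hψ, hocc, hnone⟩ :=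
    hF.exists_chart_occurs hn (nodup_arrange hN hdisj hnodup)
  refine ⟨G, hG, fun a => ?_, ψ, hψ, ?_, hnone⟩
  · obtain ⟨s, hs⟩ := hmem a
    obtain ⟨l₁, l₂, hl⟩ := List.append_of_mem hs
    rw [arrange, hl, List.flatMap_append, List.flatMap_cons, occurs_append, occurs_append] at hocc
    have hseg := hψ.isSegment hocc.2.1
    cases s
    · exact hseg
    · exact hseg.of_reverse
  · rw [arrange, List.flatMap_append, occurs_append] at hocc
    exact hocc.1

variable {O : Type*}

theorem LabelingProblem.RandOnlineSolvable.exists_output_on_arrangements [Finite A]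
    {P : LabelingProblem I O} {F : GraphFamily} (hP : P.RandOnlineSolvable F n t)
    (hF : IsPathCycleFamily F) (hn : 3 ≤ n) {N : A → List (Fin n)} (hN : ∀ a, (N a).Nodup)
    (hdisj : Pairwise (Function.onFun List.Disjoint N)) (x : Fin n → I) {ι : Type*} [Fintype ι]
    [Nonempty ι] (hι : Fintype.card ι < n) {l₀ : ι → List (A × Bool)}
    (hl₀ : ∀ j, ((l₀ j).map Prod.fst).Nodup) : ∃ y₀ : Fin n → O, ∀ j, ∃ G ∈ F n,
      ∃ ψ, IsChart G ψ ∧ Occurs ψ 0 (arrange N (l₀ j)) ∧ (F ≠ cycles → ∀ i < 0, ψ i = none) ∧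
      ∃ y ∈ P.sol G x, ∀ a k, t < k → ∀ h : k + t + 1 < (N a).length,
        y (N a)[k] = y₀ (N a)[k] := by
  choose G hG hseg ψ hψ hocc hnone using fun j => hF.exists_arrangement hn hN hdisj (hl₀ j)
  let U := {v | ∃ a k, ∃ h : k + t + 1 < (N a).length, t < k ∧ (N a)[k] = v}
  obtain ⟨y, hy, heq⟩ := hP.exists_eqOn hι hG x (U := U) fun j j' v ⟨a, k, hk, htk, hv⟩ u hu =>
    (hseg j a).neighborSet_eq_of_mem_nbhd (hseg j' a) htk hk (hv ▸ hu)
  exact ⟨y (Classical.arbitrary ι), fun j => ⟨G j, hG j, ψ j, hψ j, hocc j, hnone j, y j, hy j,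
    fun a k htk hk => heq _ _ ⟨a, k, hk, htk, rfl⟩⟩⟩

end arrangement

/-- A patch of `d` positions together with data on its two sides: either the words that leave it,
both read away from the patch, or the types of these words. -/
@[ext]
structure Fragment (α W : Type*) (d : ℕ) where
  left : W
  mid : Fin d → α
  right : W

namespace Fragment

variable {α β W W' : Type*} {d : ℕ}

/-- The fragment read from the other side. -/
def rev (f : Fragment α W d) : Fragment α W d := ⟨f.right, f.mid ∘ Fin.rev, f.left⟩

/-- The fragment, read from the other side if `s` holds. -/
def orient (s : Bool) (f : Fragment α W d) : Fragment α W d := if s then f.rev else f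

/-- The fragment with its positions and its sides replaced. -/
def map (φ : α → β) (φ' : W → W') (f : Fragment α W d) : Fragment β W' d :=
  ⟨φ' f.left, φ ∘ f.mid, φ' f.right⟩

/-- The word that a fragment stands for. -/
def toList (f : Fragment α (List α) d) : List α := f.left.reverse ++ List.ofFn f.mid ++ f.right

theorem rev_rev (f : Fragment α W d) : f.rev.rev = f := by
  simp [rev, Function.comp_assoc, Fin.rev_involutive.comp_self]

theorem orient_orient (s : Bool) (f : Fragment α W d) : (f.orient s).orient s = f := by
  cases s
  · rfl
  · exact f.rev_rev

theorem orient_not (s : Bool) (f : Fragment α W d) : f.orient (!s) = (f.orient s).rev := by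
  cases s
  · rfl
  · exact f.rev_rev.symm

theorem orient_not_rev (s : Bool) (f : Fragment α W d) : f.rev.orient (!s) = f.orient s := by
  cases s
  · exact f.rev_rev
  · rfl

theorem orient_map (φ : α → β) (φ' : W → W') (s : Bool) (f : Fragment α W d) :
    (f.map φ φ').orient s = (f.orient s).map φ φ' := by
  cases s <;> rfl

theorem toList_rev (f : Fragment α (List α) d) : f.rev.toList = f.toList.reverse := by
  have : List.ofFn (f.mid ∘ Fin.rev) = (List.ofFn f.mid).reverse :=
    List.ext_getElem (by simp) fun i hi _ => by
      simp only [List.getElem_ofFn, List.getElem_reverse, List.length_ofFn, Function.comp_apply]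
      congr 1
      ext
      simp only [Fin.val_rev]
      omega
  simp [toList, rev, this]

theorem toList_orient (s : Bool) (f : Fragment α (List α) d) :
    (f.orient s).toList = orientList s f.toList := by
  cases s
  · rfl
  · exact f.toList_rev

theorem length_toList (f : Fragment α (List α) d) :
    f.toList.length = f.left.length + d + f.right.length := by
  simp [toList, add_assoc]

theorem getElem_toList (f : Fragment α (List α) d) (j : Fin d) :
    f.toList[f.left.length + j]'(by rw [length_toList]; omega) = f.mid j := by
  simp [toList]

theorem exists_map_eq {φ : α → β} {l : List α} {f : Fragment β (List β) d}
    (h : l.map φ = f.toList) :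
    ∃ g : Fragment α (List α) d, g.toList = l ∧ g.map φ (List.map φ) = f := by
  obtain ⟨l', right, rfl, h', hright⟩ := List.map_eq_append_iff.1 h
  obtain ⟨left, mid, rfl, hleft, hmid⟩ := List.map_eq_append_iff.1 h'
  have hlen : mid.length = d := by simpa using congrArg List.length hmid
  subst hlen
  refine ⟨⟨left.reverse, mid.get, right⟩, by simp [toList], Fragment.ext ?_ ?_ hright⟩
  · simp [map, hleft]
  · rw [← List.ofFn_inj, ← hmid, map, ← List.map_ofFn, List.ofFn_get]

instance [Finite α] [Finite W] : Finite (Fragment α W d) :=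
  Finite.of_injective (fun f => (f.left, f.mid, f.right)) fun f g h => by
    simpa [Fragment.ext_iff] using h

end Fragment

section fragments

variable {I O : Type*} {S : Set (CenteredLabeledGraph I O)} {r n : ℕ}

variable (S r) in
/-- With `m` between the labeled fragments `f` and `g`, the labels of `f` and `g` can be completed
from the patch of `f` to the patch of `g`. -/
def Joinable (f g : Fragment (I × O) (List I) (2 * r + 1)) (m : List I) : Prop :=
  Reach S r (some ∘ f.mid) (f.right ++ m ++ g.left.reverse ++ List.ofFn (Prod.fst ∘ g.mid))
    (some ∘ g.mid)

variable (S r) in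
/-- With `m` between the end of a path and the labeled fragment `g`, the labels of `g` can be
completed from the end of the path to the patch of `g`. -/
def Startable (g : Fragment (I × O) (List I) (2 * r + 1)) (m : List I) : Prop :=
  Reach S r (fun _ => none) (m ++ g.left.reverse ++ List.ofFn (Prod.fst ∘ g.mid)) (some ∘ g.mid)

section charts

variable {ψ : ℤ → Option (Fin n)} {x : Fin n → I} {y : Fin n → O}

theorem labelsAt_of_occurs {Λ : Type*} {d : ℕ} {mid : Fin d → Fin n} {a : ℤ}
    (h : Occurs ψ a (List.ofFn mid)) (φ : Fin n → Λ) :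
    labelsAt d (fun i => (ψ i).map φ) a = some ∘ φ ∘ mid := by
  funext j
  simp [labelsAt, h j (by simp)]

theorem factor_eq_map_of_occurs {X : ℤ → I} {a : ℤ} {l : List (Fin n)} (h : Occurs ψ a l)
    (hX : ∀ i v, ψ i = some v → X i = x v) : factor X a l.length = l.map x := by
  rw [factor, ← List.ofFn_getElem_eq_map]
  exact congrArg List.ofFn (funext fun j => hX _ _ (h j j.2))

theorem reach_of_occurs
    (hy : ∀ p, WindowOK S r (fun i => (ψ (p + i)).map fun v => (x v, y v))) {a : ℤ}
    {l : List (Fin n)} (h : Occurs ψ (a + (2 * r + 1 : ℕ)) l) :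
    Reach S r (labelsAt _ (fun i => (ψ i).map fun v => (x v, y v)) a) (l.map x)
      (labelsAt _ (fun i => (ψ i).map fun v => (x v, y v)) (a + l.length)) := by
  rcases l.eq_nil_or_concat with rfl | ⟨l', v, rfl⟩
  · simp [Reach]
  · have hX (i u) (hu : ψ i = some u) : (fun i => ((ψ i).map x).getD (x v)) i = x u := by simp [hu]
    rw [← factor_eq_map_of_occurs h hX]
    refine reach_of_follows fun i hi1 hi2 => ⟨pairOK_labelsAt.2 ⟨hy _, hy _⟩, ?_⟩
    have hpos := h (i - a).toNat (by omega)
    rw [show a + ((2 * r + 1 : ℕ) : ℤ) + ((i - a).toNat : ℤ) = i + (2 * r + 1 : ℕ) by omega] at hpos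
    exact ⟨_, by simp only [hpos, Option.map_some, Option.getD_some]; rfl⟩

theorem reach_of_occurs_append_ofFn
    (hy : ∀ p, WindowOK S r (fun i => (ψ (p + i)).map fun v => (x v, y v))) {a : ℤ}
    {l : List (Fin n)} {mid : Fin (2 * r + 1) → Fin n}
    (h : Occurs ψ (a + (2 * r + 1 : ℕ)) (l ++ List.ofFn mid)) :
    Reach S r (labelsAt _ (fun i => (ψ i).map fun v => (x v, y v)) a)
      (l.map x ++ List.ofFn (x ∘ mid)) (some ∘ (fun v => (x v, y v)) ∘ mid) := by
  have hmid := (occurs_append.1 h).2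
  have hreach := reach_of_occurs hy h
  rw [add_right_comm] at hmid
  rwa [List.length_append, List.length_ofFn, Nat.cast_add, ← add_assoc, labelsAt_of_occurs hmid,
    List.map_append, List.map_ofFn] at hreach

theorem joinable_of_occurs
    (hy : ∀ p, WindowOK S r (fun i => (ψ (p + i)).map fun v => (x v, y v))) {a : ℤ}
    {f g : Fragment (Fin n) (List (Fin n)) (2 * r + 1)} {l : List (Fin n)}
    (h : Occurs ψ a (f.toList ++ l ++ g.toList)) :
    Joinable S r (f.map (fun v => (x v, y v)) (List.map x))
      (g.map (fun v => (x v, y v)) (List.map x)) (l.map x) := by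
  simp only [Fragment.toList, List.append_assoc] at h
  rw [occurs_append, occurs_append, ← List.append_assoc, ← List.append_assoc, ← List.append_assoc,
    occurs_append, List.length_ofFn] at h
  have hreach := reach_of_occurs_append_ofFn hy h.2.2.1
  rw [labelsAt_of_occurs h.2.1] at hreach
  simpa only [Joinable, Fragment.map, List.map_append, List.map_reverse, List.append_assoc,
    Function.comp_def] using hreach

theorem startable_of_occurs
    (hy : ∀ p, WindowOK S r (fun i => (ψ (p + i)).map fun v => (x v, y v)))
    (hnone : ∀ i < 0, ψ i = none) {g : Fragment (Fin n) (List (Fin n)) (2 * r + 1)}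
    {l : List (Fin n)} (h : Occurs ψ 0 (l ++ g.toList)) :
    Startable S r (g.map (fun v => (x v, y v)) (List.map x)) (l.map x) := by
  simp only [Fragment.toList] at h
  rw [← List.append_assoc, ← List.append_assoc, occurs_append] at h
  have hreach := reach_of_occurs_append_ofFn hy (a := -(2 * r + 1 : ℕ))
    (by rw [neg_add_cancel]; exact h.1)
  have hend : labelsAt (2 * r + 1) (fun i => (ψ i).map fun v => (x v, y v)) (-(2 * r + 1 : ℕ)) =
      fun _ => none := by
    funext j
    rw [labelsAt, hnone _ (by omega), Option.map_none]
  rw [hend] at hreach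
  simpa only [Startable, Fragment.map, List.map_append, List.map_reverse, Function.comp_def]
    using hreach

end charts

end fragments

/-! ### Patch labelings from online algorithms -/

section lowerBound

variable {I O E Z : Type*} {S : Set (CenteredLabeledGraph I O)} {r n t : ℕ}

/-- A list is placed before the patch `e₁` and between the patches `e₁` and `e₂`. -/
def pairArrangement (e₁ e₂ : E × Bool) (z : Z) : List ((E ⊕ Z × Bool) × Bool) :=
  [(.inr (z, false), false), (.inl e₁.1, e₁.2), (.inr (z, true), false), (.inl e₂.1, e₂.2)]

theorem nodup_pairArrangement {e₁ e₂ : E × Bool} (h : e₁.1 ≠ e₂.1) (z : Z) :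
    ((pairArrangement e₁ e₂ z).map Prod.fst).Nodup := by
  simp [pairArrangement, h]

theorem arrange_pairArrangement (f : E → Fragment (Fin n) (List (Fin n)) (2 * r + 1))
    (l : Z × Bool → List (Fin n)) (e₁ e₂ : E × Bool) (z : Z) :
    arrange (Sum.elim (fun e => (f e).toList) l) (pairArrangement e₁ e₂ z) =
      l (z, false) ++ ((f e₁.1).orient e₁.2).toList ++ l (z, true) ++
        ((f e₂.1).orient e₂.2).toList := by
  simp [arrange, pairArrangement, Fragment.toList_orient, orientList]

theorem exists_disjoint_fragments_map_eq [Fintype E] [Fintype Z] [Nonempty I]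
    (W : E → Fragment I (List I) (2 * r + 1)) (M : Z → List I)
    (hWM : ∑ e, (W e).toList.length + 2 * ∑ z, (M z).length ≤ n) :
    ∃ (f : E → Fragment (Fin n) (List (Fin n)) (2 * r + 1)) (l : Z × Bool → List (Fin n))
      (x : Fin n → I), (∀ a, (Sum.elim (fun e => (f e).toList) l a).Nodup) ∧
      Pairwise (Function.onFun List.Disjoint (Sum.elim (fun e => (f e).toList) l)) ∧
      (∀ e, (f e).map x (List.map x) = W e) ∧ ∀ z, (l z).map x = M z.1 := by
  obtain ⟨N, x, hN, hdisj, hx⟩ := exists_disjoint_lists_map_eq (n := n)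
    (Sum.elim (fun e => (W e).toList) fun z : Z × Bool => M z.1) (by
      simpa [Fintype.sum_prod_type, ← two_mul, Finset.mul_sum] using hWM)
  choose f hf hfW using fun e => Fragment.exists_map_eq (hx (.inl e))
  have hN_eq : N = Sum.elim (fun e => (f e).toList) (fun z => N (.inr z)) := by
    funext a
    cases a
    · exact (hf _).symm
    · rfl
  rw [hN_eq] at hN hdisj
  exact ⟨f, _, x, hN, hdisj, hfW, fun z => hx (.inr z)⟩

theorem LabelingProblem.RandOnlineSolvable.exists_joinable [Fintype E] [Fintype Z] [Nontrivial E]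
    [Nonempty Z] [Nonempty I] {P : LabelingProblem I O} {F : GraphFamily} {Δ : ℕ}
    (hP : P.RandOnlineSolvable F n t) (hF : IsPathCycleFamily F) (hΔ : 2 ≤ Δ)
    (hS : P.IsCheckedBy S r Δ) {W : E → Fragment I (List I) (2 * r + 1)} (M : Z → List I)
    (hWt : ∀ e, t < (W e).left.length ∧ t < (W e).right.length)
    (hWM : ∑ e, (W e).toList.length + 2 * ∑ z, (M z).length ≤ n)
    (hn : Fintype.card ((E × Bool) × (E × Bool) × Z) < n) (hr : 2 * r + 3 ≤ n) :
    ∃ T : E → Fragment (I × O) (List I) (2 * r + 1), (∀ e, (T e).map Prod.fst id = W e) ∧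
      ∀ e₁ e₂, e₁ ≠ e₂ → ∀ s₁ s₂ z,
        Joinable S r ((T e₁).orient s₁) ((T e₂).orient s₂) (M z) ∧
        (F ≠ cycles → Startable S r ((T e₁).orient s₁) (M z)) := by
  classical
  obtain ⟨f, l, x, hnodup, hdisj, hfW, hlM⟩ := exists_disjoint_fragments_map_eq W M hWM
  let ι := {j : (E × Bool) × (E × Bool) × Z // j.1.1 ≠ j.2.1.1}
  have : Nonempty ι := by
    obtain ⟨e₁, e₂, he⟩ := exists_pair_ne E
    exact ⟨((e₁, false), (e₂, false), Classical.arbitrary Z), he⟩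
  obtain ⟨y₀, hy₀⟩ := hP.exists_output_on_arrangements hF (by omega) hnodup hdisj x (ι := ι)
    ((Fintype.card_subtype_le _).trans_lt hn) fun j => nodup_pairArrangement j.2 j.1.2.2
  refine ⟨fun e => (f e).map (fun v => (x v, y₀ v)) (List.map x), hfW, fun e₁ e₂ he s₁ s₂ z => ?_⟩
  obtain ⟨G, -, ψ, hψ, hocc, hnone, y, hy, hyy₀⟩ := hy₀ ⟨((e₁, s₁), (e₂, s₂), z), he⟩
  rw [hψ.mem_sol_iff hΔ hS _ _ (by omega)] at hy
  rw [arrange_pairArrangement] at hocc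
  have hlabel (e : E) : (f e).map (fun v => (x v, y₀ v)) (List.map x) =
      (f e).map (fun v => (x v, y v)) (List.map x) := by
    refine Fragment.ext rfl (funext fun j => ?_) rfl
    obtain ⟨hleft, hright⟩ := hWt e
    rw [← hfW e, Fragment.map, List.length_map] at hleft
    rw [← hfW e, Fragment.map, List.length_map] at hright
    have := hyy₀ (.inl e) ((f e).left.length + j) (by omega)
      (by simp only [Sum.elim_inl, Fragment.length_toList]; omega)
    simp only [Sum.elim_inl, Fragment.getElem_toList] at this
    simp only [Fragment.map, Function.comp_apply, this]
  simp only [hlabel, Fragment.orient_map]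
  refine ⟨?_, fun hFc => ?_⟩
  · rw [List.append_assoc, List.append_assoc, occurs_append, ← List.append_assoc] at hocc
    exact hlM (z, true) ▸ joinable_of_occurs hy hocc.2
  · rw [List.append_assoc, occurs_append] at hocc
    exact hlM (z, false) ▸ startable_of_occurs hy (hnone hFc) hocc.1

/-- Of sufficiently many copies of each patch, two are labeled in the same way, and each of the two
can stand for the other one. -/
theorem LabelingProblem.RandOnlineSolvable.exists_joinable_self {C : Type*} [Fintype C] [Nonempty C]
    [Fintype Z] [Nonempty Z] [Nonempty I] [Fintype (State I O r)] {P : LabelingProblem I O}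
    {F : GraphFamily} {Δ κ : ℕ} (hP : P.RandOnlineSolvable F n t) (hF : IsPathCycleFamily F)
    (hΔ : 2 ≤ Δ) (hS : P.IsCheckedBy S r Δ) {W : C → Fragment I (List I) (2 * r + 1)}
    (M : Z → List I) (hWt : ∀ c, t < (W c).left.length ∧ t < (W c).right.length)
    (hκ : Fintype.card (State I O r) < κ)
    (hWM : κ * ∑ c, (W c).toList.length + 2 * ∑ z, (M z).length ≤ n)
    (hn : Fintype.card (((C × Fin κ) × Bool) × ((C × Fin κ) × Bool) × Z) < n)
    (hr : 2 * r + 3 ≤ n) :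
    ∃ T : C → Fragment (I × O) (List I) (2 * r + 1), (∀ c, (T c).map Prod.fst id = W c) ∧
      ∀ c₁ c₂ s₁ s₂ z, Joinable S r ((T c₁).orient s₁) ((T c₂).orient s₂) (M z) ∧
        (F ≠ cycles → Startable S r ((T c₁).orient s₁) (M z)) := by
  have : Nontrivial (C × Fin κ) := by
    have : Nonempty (State I O r) := ⟨fun _ => none⟩
    have : 1 < κ := lt_of_le_of_lt Fintype.card_pos hκ
    have : Nontrivial (Fin κ) := Fin.nontrivial_iff_two_le.2 this
    infer_instance
  obtain ⟨T, hT, hjoin⟩ := hP.exists_joinable hF hΔ hS M (W := fun e : C × Fin κ => W e.1)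
    (fun e => hWt e.1) (by simpa [Fintype.sum_prod_type, Finset.mul_sum] using hWM) hn hr
  choose k₁ k₂ hk hmid using fun c =>
    Fintype.exists_ne_map_eq_of_card_lt (fun k => some ∘ (T (c, k)).mid : _ → State I O r)
      (by simpa using hκ)
  have hT₁₂ (c : C) : T (c, k₁ c) = T (c, k₂ c) := by
    have h := (hT (c, k₁ c)).trans (hT (c, k₂ c)).symm
    refine Fragment.ext ?_ ((Option.some_injective _).comp_left (hmid c)) ?_
    · exact congrArg (fun f : Fragment I (List I) (2 * r + 1) => f.left) h
    · exact congrArg (fun f : Fragment I (List I) (2 * r + 1) => f.right) h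
  refine ⟨fun c => T (c, k₁ c), fun c => hT _, fun c₁ c₂ s₁ s₂ z => ?_⟩
  have hne : (c₁, k₁ c₁) ≠ (c₂, k₂ c₂) := fun h => by
    obtain ⟨rfl, h⟩ := Prod.ext_iff.1 h
    exact hk _ h
  have h := hjoin _ _ hne s₁ s₂ z
  rwa [← hT₁₂ c₂] at h

variable (S r) in
/-- The types of words that are long enough to be pumped. -/
def IsLongType (α : EffectPair I O r) : Prop :=
  ∃ v : List I, v.length = Nat.card (EffectPair I O r) ∧ effect S r v = α

theorem exists_long_representative [Finite I] [Finite O] [Nonempty I] (L : ℕ)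
    (α : EffectPair I O r) : ∃ w : List I, L ≤ w.length ∧
      w.length ≤ Nat.card (EffectPair I O r) * (L + 1) ∧
      (IsLongType S r α → effect S r w = α) := by
  by_cases h : IsLongType S r α
  · obtain ⟨v, hv, rfl⟩ := h
    obtain ⟨w, hw, hLw, hwL⟩ := exists_effect_eq_of_card_le_length (S := S) hv.ge L
    exact ⟨w, hLw, hv ▸ hwL, fun _ => hw⟩
  · refine ⟨List.replicate L (Classical.arbitrary I), by simp, ?_, fun h' => absurd h' h⟩
    have : 0 < Nat.card (EffectPair I O r) := Nat.card_pos
    rw [List.length_replicate]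
    nlinarith

theorem reach_replace {p q : State I O r} {v v' m m' w w' u : List I}
    (hv : effect S r v = effect S r v') (hm : effect S r m = effect S r m')
    (hw : effect S r w = effect S r w') (h : Reach S r p (v ++ m ++ w.reverse ++ u) q) :
    Reach S r p (v' ++ m' ++ w'.reverse ++ u) q := by
  simp only [reach_append] at h ⊢
  obtain ⟨a, ⟨b, ⟨c, hpc, hcb⟩, hba⟩, haq⟩ := h
  exact ⟨a, ⟨b, ⟨c, (reach_congr hv).1 hpc, (reach_congr hm).1 hcb⟩,
    (reach_reverse_congr hw).1 hba⟩, haq⟩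

/-- A patch is labeled as the fragment that `T` assigns to it or to its reversal. -/
def patchLabelingOf (S : Set (CenteredLabeledGraph I O)) (r : ℕ)
    (T : Fragment I (EffectPair I O r) (2 * r + 1) → Fragment (I × O) (List I) (2 * r + 1)) :
    PatchLabeling I O r := fun α u β =>
  {p | IsLongType S r α ∧ IsLongType S r β ∧ ∃ s,
    p = some ∘ ((T (Fragment.orient s ⟨α, u, β⟩)).orient s).mid}

theorem isPatchLabeling_patchLabelingOf {rep : EffectPair I O r → List I} {paths : Prop}
    (hrep : ∀ α, IsLongType S r α → effect S r (rep α) = α)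
    {T : Fragment I (EffectPair I O r) (2 * r + 1) → Fragment (I × O) (List I) (2 * r + 1)}
    (hT : ∀ c, (T c).map Prod.fst id = c.map id rep)
    (hjoin : ∀ c₁ c₂ s₁ s₂ m, Joinable S r ((T c₁).orient s₁) ((T c₂).orient s₂) m)
    (hstart : paths → ∀ c s m, Startable S r ((T c).orient s) m) :
    IsPatchLabeling S r paths (patchLabelingOf S r T) := by
  have hmap (c s) : ((T (Fragment.orient s c)).orient s).map Prod.fst id = c.map id rep := by
    rw [← Fragment.orient_map, hT, Fragment.orient_map, Fragment.orient_orient]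
  have hleft (c s) : ((T (Fragment.orient s c)).orient s).left = rep c.left :=
    congrArg Fragment.left (hmap c s)
  have hmid (c s) : Prod.fst ∘ ((T (Fragment.orient s c)).orient s).mid = c.mid :=
    congrArg Fragment.mid (hmap c s)
  have hright (c s) : ((T (Fragment.orient s c)).orient s).right = rep c.right :=
    congrArg Fragment.right (hmap c s)
  refine ⟨fun v w u hv hw => ⟨_, ⟨v, hv, rfl⟩, ⟨w, hw, rfl⟩, false, rfl⟩, ?_, ?_, ?_, ?_⟩
  · rintro α u β p ⟨-, -, s, rfl⟩ j
    exact ⟨_, congrArg some (Prod.ext (congrFun (hmid ⟨α, u, β⟩ s) j) rfl)⟩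
  · rintro α u β p ⟨hα, hβ, s, rfl⟩
    refine ⟨hβ, hα, !s, ?_⟩
    rw [show (⟨β, u ∘ Fin.rev, α⟩ : Fragment I _ (2 * r + 1)) = Fragment.rev ⟨α, u, β⟩ from rfl,
      Fragment.orient_not_rev, Fragment.orient_not]
    rfl
  · rintro α u v w u' β p ⟨-, hv, s, rfl⟩ q ⟨hw, -, s', rfl⟩ m
    have := hjoin (Fragment.orient s ⟨α, u, effect S r v⟩)
      (Fragment.orient s' ⟨effect S r w, u', β⟩) s s' m
    rw [Joinable, hright, hleft, hmid] at this
    exact reach_replace (hrep _ hv) rfl (hrep _ hw) this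
  · rintro hpaths w u β q ⟨hw, -, s, rfl⟩ m
    have := hstart hpaths (Fragment.orient s ⟨effect S r w, u, β⟩) s m
    rw [Startable, hleft, hmid] at this
    exact reach_replace (v := []) (v' := []) rfl rfl (hrep _ hw) this

theorem exists_isPatchLabeling [Finite I] [Finite O] [Nonempty I] {P : LabelingProblem I O} {Δ : ℕ}
    (hΔ : 2 ≤ Δ) (hS : P.IsCheckedBy S r Δ) {F : GraphFamily} (hF : IsPathCycleFamily F) :
    ∃ K N, ∀ n ≥ N, ∀ t, K * (t + 1) ≤ n → P.RandOnlineSolvable F n t →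
      ∃ L, IsPatchLabeling S r (F ≠ cycles) L := by
  have := Fintype.ofFinite (State I O r)
  have := Fintype.ofFinite (EffectPair I O r)
  let C := Fragment I (EffectPair I O r) (2 * r + 1)
  have : Nonempty C := ⟨⟨effect S r [], fun _ => Classical.arbitrary I, effect S r []⟩⟩
  have := Fintype.ofFinite C
  set κ := Fintype.card (State I O r) + 1
  have hκ : Fintype.card (State I O r) < κ := Nat.lt_succ_self _
  set ε := Nat.card (EffectPair I O r)
  let M : EffectPair I O r → List I := Function.invFun (effect S r)
  have hM (m : List I) : effect S r (M (effect S r m)) = effect S r m :=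
    Function.invFun_eq ⟨m, rfl⟩
  refine ⟨κ * (Fintype.card C * (4 * ε + (2 * r + 1))) + 2 * ∑ z, (M z).length,
    Fintype.card (((C × Fin κ) × Bool) × ((C × Fin κ) × Bool) × EffectPair I O r) + 2 * r + 3,
    fun n hn t hK hP => ?_⟩
  choose rep htrep hrepε hrep using exists_long_representative (S := S) (r := r) (t + 1)
  have hlen (c : C) : (c.map id rep).toList.length ≤ (4 * ε + (2 * r + 1)) * (t + 1) := by
    have hl := hrepε c.left
    have hr := hrepε c.right
    simp only [Fragment.length_toList, Fragment.map]
    nlinarith [Nat.zero_le (ε * t), Nat.zero_le (r * t)]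
  have hsum := Finset.sum_le_card_nsmul Finset.univ _ _ fun c _ => hlen c
  rw [smul_eq_mul, Finset.card_univ] at hsum
  obtain ⟨T, hT, hjoin⟩ := hP.exists_joinable_self hF hΔ hS M (W := fun c : C => c.map id rep)
    (fun c => ⟨htrep c.left, htrep c.right⟩) hκ
    (by nlinarith [Nat.mul_le_mul_left κ hsum, Nat.zero_le ((∑ z, (M z).length) * t)])
    (by omega) (by omega)
  exact ⟨_, isPatchLabeling_patchLabelingOf hrep hT
    (fun c₁ c₂ s₁ s₂ m => reach_replace rfl (hM m) rfl (hjoin c₁ c₂ s₁ s₂ (effect S r m)).1)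
    fun hFc c s m => reach_replace (v := []) (v' := []) rfl (hM m) rfl
      ((hjoin c c s s (effect S r m)).2 hFc)⟩

end lowerBound

/-! ### Gathering the whole graph -/

section gather

variable {I O : Type*} {P : LabelingProblem I O} {F : GraphFamily} {n t : ℕ}
  {G G' : SimpleGraph (Fin n)}

theorem nbhd_eq_univ_of_connected (hG : G.Connected) (v : Fin n) : nbhd G n v = Set.univ := by
  refine Set.eq_univ_of_forall fun u => mem_nbhd_iff_exists_walk.2 ?_
  obtain ⟨p, hp⟩ := (hG.preconnected v u).exists_isPath
  exact ⟨p, by simpa using hp.length_lt.le⟩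

theorem localView_eq_of_connected (hG : G.Connected) (x : Fin n → I) (ident : Fin n ↪ ℕ)
    (v : Fin n) : localView n G x ident v =
      ⟨ident v, G.map ident, Function.extend ident (some ∘ x) fun _ => none⟩ := by
  rw [localView, nbhd_eq_univ_of_connected hG]
  congr 2
  · ext a b
    simp
  · funext u
    exact if_pos (Set.mem_univ u)

theorem exists_iso_of_map_eq {x x' : Fin n → I} {ident ident' : Fin n ↪ ℕ}
    (hgraph : G.map ident = G'.map ident')
    (hinput : Function.extend ident (some ∘ x) (fun _ => none) =
      Function.extend ident' (some ∘ x') fun _ => none) :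
    ∃ φ : G ≃g G', (∀ v, ident' (φ v) = ident v) ∧ x' ∘ φ = x := by
  have hvalue (v : Fin n) :
      Function.extend ident' (some ∘ x') (fun _ => none) (ident v) = some (x v) := by
    rw [← hinput, ident.injective.extend_apply, Function.comp_apply]
  have hident (v : Fin n) : ∃ w, ident' w = ident v := by
    by_contra hv
    simpa [Function.extend_apply' _ _ _ hv] using hvalue v
  choose f hf using hident
  have hinj : Function.Injective f := fun a b hab =>
    ident.injective (by rw [← hf a, ← hf b, hab])
  refine ⟨⟨.ofBijective f (Finite.injective_iff_bijective.1 hinj), fun {a b} => ?_⟩, hf,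
    funext fun v => ?_⟩
  · change G'.Adj (f a) (f b) ↔ G.Adj a b
    rw [← SimpleGraph.map_adj_apply (f := ident'), hf, hf, ← hgraph, SimpleGraph.map_adj_apply]
  · have := hvalue v
    rw [← hf v, ident'.injective.extend_apply] at this
    exact Option.some_injective _ this

theorem LabelingProblem.localSolvable_self [Nonempty O] (hF : ∀ G ∈ F n, G.Connected)
    (h : ∀ G ∈ F n, ∀ x, (P.sol G x).Nonempty) (c : ℕ) : P.LocalSolvable F c n n := by
  let A (H : SimpleGraph ℕ) (f : ℕ → Option I) : Set (ℕ → O) :=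
    {g | ∃ G ∈ F n, ∃ (x : Fin n → I) (ident : Fin n ↪ ℕ), H = G.map ident ∧
      f = Function.extend ident (some ∘ x) (fun _ => none) ∧ g ∘ ident ∈ P.sol G x}
  refine ⟨fun view => pick (A view.graph view.input) view.center, fun G hG x ident _ => ?_⟩
  simp only [localView_eq_of_connected (hF G hG)]
  obtain ⟨y, hy⟩ := h G hG x
  have hy' : Function.extend ident y (fun _ => Classical.arbitrary O) ∘ ident ∈ P.sol G x := by
    rwa [Function.extend_comp ident.injective]
  obtain ⟨G', -, x', ident', hgraph, hinput, hsol⟩ :=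
    pick_mem (s := A _ _) ⟨_, G, hG, x, ident, rfl, rfl, hy'⟩
  obtain ⟨φ, hφ, hx⟩ := exists_iso_of_map_eq hgraph hinput
  have := P.iso_closed G G' φ x' _ hsol
  rw [hx] at this
  convert this using 1
  exact funext fun v => congrArg _ (hφ v).symm

namespace LabelingProblem.RandOnlineSolvable

theorem nonempty_output (h : P.RandOnlineSolvable F n t) : Nonempty O := by
  obtain ⟨A, -⟩ := h
  obtain ⟨a, -⟩ := A.support_nonempty
  exact ⟨a ⟨[], ⊥, fun _ => none, fun _ => none⟩⟩

theorem sol_nonempty (h : P.RandOnlineSolvable F n t) (hn : 2 ≤ n) (hG : G ∈ F n) (x : Fin n → I) :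
    (P.sol G x).Nonempty := by
  obtain ⟨A, hA⟩ := h
  obtain ⟨a, ha⟩ := exists_forall_notMem_of_toOuterMeasure_le (ι := Unit) A _
    (fun _ => hA G hG x (Equiv.refl _)) (by simpa)
  obtain ⟨y, hy, -⟩ := not_not.1 (ha ())
  exact ⟨y, hy⟩

theorem localSolvable_self (h : P.RandOnlineSolvable F n t) (hF : IsPathCycleFamily F) (c : ℕ) :
    P.LocalSolvable F c n n :=
  have := h.nonempty_output
  LabelingProblem.localSolvable_self (fun _ hG => hF.connected hG)
    (fun _ hG => h.sol_nonempty (hF.two_le hG) hG) c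

end LabelingProblem.RandOnlineSolvable

end gather

/-! ### Asymptotics of localities -/

theorem logStar_le_self (n : ℕ) : logStar n ≤ n := by
  induction n using Nat.strong_induction_on with
  | _ n ih =>
    rcases le_or_gt n 1 with hn | hn
    · rw [logStar, if_pos hn]
      exact n.zero_le
    · have := clog_two_lt hn.not_ge
      rw [logStar_of_one_lt hn, add_comm]
      exact (Nat.succ_le_succ (ih _ this)).trans this

theorem isLittleO_logStar : (fun n => (logStar n : ℝ)) =o[atTop] fun n => (n : ℝ) := by
  refine isLittleO_iff_nat_mul_le.2 fun A => ?_
  filter_upwards [eventually_pow_clog_le (A + 1) 1, eventually_gt_atTop 1] with n hA hn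
  have hlog : logStar n ≤ Nat.clog 2 ((A + 1) * (n + 1)) + 1 := by
    rw [logStar_of_one_lt hn, add_comm]
    exact Nat.succ_le_succ ((logStar_le_self _).trans (Nat.clog_mono_right 2 (by nlinarith)))
  rw [Real.norm_natCast, Real.norm_natCast]
  exact_mod_cast (Nat.mul_le_mul A.le_succ hlog).trans (by simpa using hA)

theorem isBigO_mul_logStar_add (C : ℕ) :
    (fun n => ((C * logStar n + C : ℕ) : ℝ)) =O[atTop] fun n => (logStar n : ℝ) := by
  refine .of_bound (2 * C) ?_
  filter_upwards [eventually_gt_atTop 1] with n hn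
  have : 1 ≤ logStar n := by
    rw [logStar_of_one_lt hn]
    exact Nat.le_add_right 1 _
  rw [Real.norm_natCast, Real.norm_natCast]
  norm_cast
  nlinarith

theorem exists_forall_and_eventuallyEq {α β : Type*} {l : Filter α} {p : α → β → Prop} {f g : α → β}
    (hf : ∀ a, p a (f a)) (hg : ∀ᶠ a in l, p a (g a)) : ∃ h, (∀ a, p a (h a)) ∧ h =ᶠ[l] g := by
  classical
  refine ⟨fun a => if p a (g a) then g a else f a, fun a => ?_, hg.mono fun a ha => if_pos ha⟩
  by_cases h : p a (g a) <;> simp [h, hf a]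

theorem isBigO_of_eventuallyEq {f g : ℕ → ℕ} {h : ℕ → ℝ} (hfg : f =ᶠ[atTop] g)
    (hg : (fun n => (g n : ℝ)) =O[atTop] h) : (fun n => (f n : ℝ)) =O[atTop] h :=
  hg.congr' (hfg.symm.fun_comp Nat.cast) .rfl

namespace LabelingProblem

variable {I O : Type*} {P : LabelingProblem I O} {F : GraphFamily} {T : ℕ → ℕ}

theorem HasRandOnlineLocality.exists_hasLocalLocality (hT : P.HasRandOnlineLocality F T)
    (hF : IsPathCycleFamily F) (h : P.Completable (F ≠ cycles)) (c : ℕ) :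
    ∃ T' : ℕ → ℕ, P.HasLocalLocality F c T' ∧
      (fun n => (T' n : ℝ)) =O[atTop] fun n => (logStar n : ℝ) := by
  have := (hT 0).nonempty_output
  obtain ⟨C, hC⟩ := h.exists_localSolvable hF c
  obtain ⟨T', hT', hT'C⟩ :=
    exists_forall_and_eventuallyEq (fun n => (hT n).localSolvable_self hF c) hC
  exact ⟨T', hT', isBigO_of_eventuallyEq hT'C (isBigO_mul_logStar_add C)⟩

theorem HasRandOnlineLocality.exists_isBigO_one (hT : P.HasRandOnlineLocality F T)
    (hF : IsPathCycleFamily F) (h : P.Completable (F ≠ cycles)) :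
    ∃ T' : ℕ → ℕ, P.HasRandOnlineLocality F T' ∧
      (fun n => (T' n : ℝ)) =O[atTop] fun _ => (1 : ℝ) := by
  have := (hT 0).nonempty_output
  obtain ⟨t, ht⟩ := h.exists_randOnlineSolvable hF
  obtain ⟨T', hT', hT't⟩ := exists_forall_and_eventuallyEq hT ht
  exact ⟨T', hT', isBigO_of_eventuallyEq hT't (isBigO_const_const _ one_ne_zero _)⟩

theorem IsLCL.exists_completable [Finite I] [Finite O] {r Δ : ℕ} (hP : P.IsLCL r Δ) (hΔ : 2 ≤ Δ)
    (hF : IsPathCycleFamily F) : ∃ K N, ∀ n ≥ N, ∀ t, K * (t + 1) ≤ n →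
      P.RandOnlineSolvable F n t → P.Completable (F ≠ cycles) := by
  obtain ⟨S, -, hS⟩ := hP
  rcases isEmpty_or_nonempty I with hI | hI
  · refine ⟨0, 0, fun n _ t _ _ => ⟨0, 0, 1, fun _ a => isEmptyElim a.input,
      ⟨fun _ _ _ => ?_, fun _ => ?_⟩, fun m hm G ψ _ _ name x => ?_⟩⟩
    · exact funext fun a => isEmptyElim a.input
    · exact funext fun a => isEmptyElim a.input
    · exact isEmptyElim (x ⟨0, hm⟩)
  · obtain ⟨K, N, h⟩ := exists_isPatchLabeling hΔ hS hF
    refine ⟨K, N, fun n hn t hK ht => ?_⟩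
    have := ht.nonempty_output
    obtain ⟨L, hL⟩ := h n hn t hK ht
    exact hL.completable hΔ hS

theorem IsLCL.completable_or_isBigO [Finite I] [Finite O] {r Δ : ℕ} (hP : P.IsLCL r Δ) (hΔ : 2 ≤ Δ)
    (hF : IsPathCycleFamily F) (hT : P.HasRandOnlineLocality F T) :
    P.Completable (F ≠ cycles) ∨ (fun n : ℕ => (n : ℝ)) =O[atTop] fun n => (T n : ℝ) := by
  obtain ⟨K, N, h⟩ := hP.exists_completable hΔ hF
  refine or_iff_not_imp_left.2 fun hcompl => .of_bound (2 * K) ?_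
  filter_upwards [eventually_ge_atTop N, eventually_ge_atTop K] with n hn hKn
  have hlt : n < K * (T n + 1) := not_le.1 fun hle => hcompl (h n hn _ hle (hT n))
  have hpos : 1 ≤ T n := by
    by_contra! hzero
    rw [Nat.lt_one_iff.1 hzero] at hlt
    omega
  rw [Real.norm_natCast, Real.norm_natCast]
  norm_cast
  nlinarith

theorem IsLCL.completable_of_isLittleO [Finite I] [Finite O] {r Δ : ℕ} (hP : P.IsLCL r Δ)
    (hΔ : 2 ≤ Δ) (hF : IsPathCycleFamily F) (hT : P.HasRandOnlineLocality F T)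
    (hTo : (fun n => (T n : ℝ)) =o[atTop] fun n => (n : ℝ)) : P.Completable (F ≠ cycles) :=
  (hP.completable_or_isBigO hΔ hF hT).resolve_right fun h =>
    isLittleO_irrefl ((eventually_gt_atTop 0).mono fun n hn => by simpa using hn.ne').frequently
      (h.trans_isLittleO hTo)

theorem IsRandOnlineComplexity.isBigO_of_hasRandOnlineLocality {T' : ℕ → ℕ}
    (hT : P.IsRandOnlineComplexity F T) (hT' : P.HasRandOnlineLocality F T') :
    (fun n => (T n : ℝ)) =O[atTop] fun n => (T' n : ℝ) :=
  isBigO_of_le _ fun n => by simpa using (hT n).2 (hT' n)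

end LabelingProblem

theorem mainTheorem11 {I O : Type*} [Finite I] [Finite O] (P : LabelingProblem I O)
    (r Δ : ℕ) (hΔ : 2 ≤ Δ) (hP : P.IsLCL r Δ)
    (F : GraphFamily) (hF : F = paths ∨ F = cycles ∨ F = pathsAndCycles)
    (c : ℕ) (hc : 1 ≤ c) :
    (∀ T : ℕ → ℕ, P.HasRandOnlineLocality F T →
      ∃ T' : ℕ → ℕ, P.HasLocalLocality F c T' ∧
        (fun n => (T' n : ℝ)) =O[atTop] (fun n => (T n : ℝ) + (logStar n : ℝ))) ∧
    (∀ T : ℕ → ℕ, P.IsRandOnlineComplexity F T →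
      (fun n => (T n : ℝ)) =O[atTop] (fun _ => (1 : ℝ)) ∨
        (fun n => (T n : ℝ)) =Θ[atTop] (fun n => (n : ℝ))) ∧
    ((∃ T : ℕ → ℕ, P.HasRandOnlineLocality F T ∧
        (fun n => (T n : ℝ)) =O[atTop] (fun _ => (1 : ℝ))) ↔
      ∃ T' : ℕ → ℕ, P.HasLocalLocality F c T' ∧
        (fun n => (T' n : ℝ)) =O[atTop] (fun n => (logStar n : ℝ))) := by
  refine ⟨fun T hT => ?_, fun T hT => ?_, fun ⟨T, hT, hT1⟩ => ?_, fun ⟨T', hT', hlog⟩ => ?_⟩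
  · rcases hP.completable_or_isBigO hΔ hF hT with hcompl | hn
    · obtain ⟨T', hT', hlog⟩ := hT.exists_hasLocalLocality hF hcompl c
      exact ⟨T', hT', hlog.trans (isBigO_of_le _ fun n => by norm_cast; simp)⟩
    · exact ⟨fun n => n, fun n => (hT n).localSolvable_self hF c,
        hn.trans (isBigO_of_le _ fun n => by norm_cast; simp)⟩
  · have hsol : P.HasRandOnlineLocality F T := fun n => (hT n).1
    refine (hP.completable_or_isBigO hΔ hF hsol).imp (fun hcompl => ?_) fun hn => ⟨?_, hn⟩
    · obtain ⟨T', hT', h1⟩ := hsol.exists_isBigO_one hF hcompl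
      exact (hT.isBigO_of_hasRandOnlineLocality hT').trans h1
    · exact hT.isBigO_of_hasRandOnlineLocality fun n =>
        ((hsol n).localSolvable_self hF c).randOnlineSolvable hc
  · have hTo := hT1.trans_isLittleO (isLittleO_const_id_atTop (1 : ℝ) |>.comp_tendsto
      tendsto_natCast_atTop_atTop)
    exact hT.exists_hasLocalLocality hF (hP.completable_of_isLittleO hΔ hF hT hTo) c
  · have hT : P.HasRandOnlineLocality F T' := fun n => (hT' n).randOnlineSolvable hc
    exact hT.exists_isBigO_one hF
      (hP.completable_of_isLittleO hΔ hF hT (hlog.trans_isLittleO isLittleO_logStar))
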